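/- A (closed, oriented) 3-dimensional triangulation $T$ is obtained from a finite nonempty set of oriented tetrahedra by gluing their faces in pairs, reversing orientations, so that the result is connected, no face is glued to itself and no edge is identified with itself in the reverse direction; several sub-simplices of a tetrahedron may be identified, and vertices and edges are identified only as forced by the gluings of faces. Graphs may have loops and multiple edges. A spanning tree of tetrahedra $T_0$ of $T$ is a set of triangles of $T$ that is a spanning tree of the dual graph (tetrahedra as nodes, triangles as links); we also write $T_0$ for the tree of tetrahedra obtained by gluing the tetrahedra along these triangles only. If $T$ has $n-1$ tetrahedra, the boundary $\partial T_0$ has $2n$ triangles, glued in pairs in $T$ to form the $n$ triangles of $T$ not in $T_0$. A spanning tree of edges $E$ of $T$ is a spanning tree of the graph of vertices and edges of $T$. *Triple-tree triangulations.* Let $T^{T_0}$ be the 2-complex formed by the triangles of $T$ not in $T_0$, with all the edges and vertices of $T$. Let $T^{T_0}_E$ be obtained from it by replacing each edge $e\in E$ by one copy for each side of a triangle lying on $e$, each copy belonging to that side only, and then keeping two triangles attached at a vertex only as forced by shared edges containing this vertex. Let $\mathsf{Cut}(E)$ be the set of the copies of edges of $E$. $T$ is a triple-tree triangulation for $(T_0,E)$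 if $T_0$ and $E$ are spanning trees of tetrahedra and of edges, $T^{T_0}_E$ is a tree of triangles (the graph with a node for each triangle and each edge of $T^{T_0}_E$, and a link for each side of a triangle, between the triangle and the edge on which this side lies, is a tree), $\mathsf{Cut}(E)$ is a spanning tree of edges of $T^{T_0}_E$, and $T$ can be rooted at an oriented edge of $E$ together with a triangle not in $T_0$ containing it. *Local constructions.* A local construction of $T$ based on a spanning tree of tetrahedra $T_0$ starts from the tree of tetrahedra $T_0$ and produces $T$ in $n$ steps: at each step one chooses an edge shared by two triangles $A\neq B$ on the boundary of the current complex and glues $A$ to $B$, identifying the chosen edge with itself and the two other edges of $A$ with those of $B$ accordingly. Its critical set of edges consists of the edges of $T$ that do not come from the edge chosen at any step; it is called the critical tree if it is a spanning tree of edges of $T$. Given a spanning tree of edges $E_0$ of $\partial T_0$, let $E_s$ be its image in the complex after $s$ steps. The local construction avoids $E_0$ if, at each step $s+1$, the chosen edge is not in $E_s$, and any two edges identified by the gluing are both in $E_s$ or both not in $E_s$. It is tree-avoiding if it avoids some spanning tree $E_0$ of $\partial T_0$. $T$ is (tree-avoiding) locally constructible if, for some spanning tree of tetrahedra $T_0$,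 it admits a (tree-avoiding) local construction based on $T_0$. **Theorem.** Let $T$ be a 3-dimensional triangulation, $T_0$ a spanning tree of tetrahedra and $E$ a spanning tree of edges of $T$. The following are equivalent: (i) $T$ is a triple-tree triangulation for $(T_0,E)$; (ii) there exists a tree-avoiding local construction of $T$ based on $T_0$ whose critical tree is $E$. Consequently, $$\{\text{triangulations that are triple-tree for some }(T_0,E)\}=\{\text{tree-avoiding locally constructible triangulations}\}\subsetneq\{\text{locally constructible triangulations}\}.$$ -/

import Mathlib

universe u

/-! ### Spanning trees of multigraphs -/

/-- The multigraph with vertex type `V` and link type `L` (loops and multiple links allowed)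
in which the link `l` has the pair of ends `ends l`. -/
def Graph.ofEnds {V L : Type*} (ends : L → Sym2 V) : Graph V L where
  vertexSet := Set.univ
  IsLink l u v := ends l = s(u, v)
  isLink_symm := fun _ _ => ⟨fun _ _ h => h.trans Sym2.eq_swap⟩
  eq_or_eq_of_isLink_of_isLink := by
    intro l x y v w h h'
    have h2 := h.symm.trans h'
    rw [Sym2.eq_iff] at h2
    rcases h2 with h2 | h2
    · exact Or.inl h2.1
    · exact Or.inr h2.1
  left_mem_of_isLink := fun _ _ _ _ => Set.mem_univ _

/-- `u` and `v` are joined by a path that uses only links in `F`. -/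
def Graph.JoinedBy {V L : Type*} (G : Graph V L) (F : Set L) (u v : V) : Prop :=
  Relation.EqvGen (fun a b => ∃ l ∈ F, G.IsLink l a b) u v

/-- The set of links `F` is a spanning tree of the multigraph `G`: any two vertices of `G` are
joined by a path in `F`, and no link of `F` lies on a cycle in `F` (the ends of a link `l` of `F`
are not joined in `F` without `l`; in particular `l` is not a loop). -/
structure Graph.IsSpanningTree {V L : Type*} (G : Graph V L) (F : Set L) : Prop where
  subset : F ⊆ G.edgeSet
  nonempty : G.vertexSet.Nonempty
  joined : ∀ u ∈ G.vertexSet, ∀ v ∈ G.vertexSet, G.JoinedBy F u v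
  acyclic : ∀ l ∈ F, ∀ u v, G.IsLink l u v → ¬ G.JoinedBy (F \ {l}) u v

/-- The multigraph `G` is a tree. -/
def Graph.IsTree {V L : Type*} (G : Graph V L) : Prop := G.IsSpanningTree G.edgeSet

/-! ### Tetrahedra with a gluing of their faces -/

/-- A collection of tetrahedra, each with vertices labelled by `Fin 4`, together with a pairwise
gluing of all their faces. The face `(k, i)` of the tetrahedron `k` is the one opposite to its
vertex `i`; it is glued to the face `perm k i i` of the tetrahedron `adj k i`, and the vertex
`j ≠ i` of the face `(k, i)` is glued to the vertex `perm k i j` of `adj k i`. -/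
structure TetGluing : Type (u + 1) where
  Tet : Type u
  adj : Tet → Fin 4 → Tet
  perm : Tet → Fin 4 → Equiv.Perm (Fin 4)
  adj_adj : ∀ k i, adj (adj k i) (perm k i i) = k
  perm_perm : ∀ k i, perm (adj k i) (perm k i i) = (perm k i)⁻¹

namespace TetGluing

variable (T : TetGluing.{u})

/-- The face of a tetrahedron to which a given face of a tetrahedron is glued. -/
def mate (f : T.Tet × Fin 4) : T.Tet × Fin 4 := (T.adj f.1 f.2, T.perm f.1 f.2 f.2)

/-- The triangles of the closed complex: faces of tetrahedra, up to the gluing. -/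
def Triangle : Type u := Quot (fun f g : T.Tet × Fin 4 => g = T.mate f)

/-- The flags. The flag `(k, q)` stands for the vertex `q 0`, the edge `{q 0, q 1}`, oriented from
`q 0` to `q 1`, and the face with vertices `q 0, q 1, q 2` (the face `q 3`) of the
tetrahedron `k`. -/
abbrev Flag : Type u := T.Tet × Equiv.Perm (Fin 4)

variable {T}

/-- Rearranging the vertices of a flag inside its tetrahedron. -/
def Flag.act (x : T.Flag) (τ : Equiv.Perm (Fin 4)) : T.Flag := (x.1, x.2 * τ)

/-- The same edge and face, with the edge reversed. -/
def Flag.flip (x : T.Flag) : T.Flag := Flag.act x (Equiv.swap 0 1)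

/-- The flag with which a flag is identified when its face is glued to the other side. -/
def Flag.glue (x : T.Flag) : T.Flag := (T.adj x.1 (x.2 3), T.perm x.1 (x.2 3) * x.2)

/-- The face of a tetrahedron in a flag. -/
def Flag.face (x : T.Flag) : T.Tet × Fin 4 := (x.1, x.2 3)

variable (T)

/-- The triangle of the closed complex that contains a flag. -/
def triangle (x : T.Flag) : T.Triangle := Quot.mk _ (Flag.face x)

/-- One step of an identification of flags: either rearrange the vertices by an element of `H`, or
cross the triangle of the flag, which is allowed if this triangle belongs to `S`. -/
def FlagStep (H : Set (Equiv.Perm (Fin 4))) (S : Set T.Triangle) (x y : T.Flag) : Prop :=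
  (∃ τ ∈ H, y = Flag.act x τ) ∨ (T.triangle x ∈ S ∧ y = Flag.glue x)

/- For a set `S` of triangles, `T_S` denotes the complex obtained from the tetrahedra by gluing
only the pairs of faces that form the triangles in `S`. Its boundary triangles are the two copies
of each triangle not in `S`; and `T_univ` is the closed complex. -/

/-- The vertices of `T_S`. -/
def Vertex (S : Set T.Triangle) : Type u := Quot (T.FlagStep {τ | τ 0 = 0} S)

/-- The oriented edges of `T_S`. -/
def OrEdge (S : Set T.Triangle) : Type u := Quot (T.FlagStep {τ | τ 0 = 0 ∧ τ 1 = 1} S)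

/-- The edges of `T_S`. -/
def Edge (S : Set T.Triangle) : Type u :=
  Quot (T.FlagStep {τ | (τ 0 = 0 ∧ τ 1 = 1) ∨ (τ 0 = 1 ∧ τ 1 = 0)} S)

/-- The corners of the triangles of the closed complex: pairs of a triangle and one of its three
vertices. -/
def Corner : Type u := Quot (T.FlagStep {τ | τ 3 = 3 ∧ τ 0 = 0} Set.univ)

/-- The sides of the triangles of the closed complex: pairs of a triangle and one of its three
sides. -/
def Side : Type u := Quot (T.FlagStep {τ | τ 3 = 3 ∧ τ 2 = 2} Set.univ)

def vertex (S : Set T.Triangle) (x : T.Flag) : T.Vertex S := Quot.mk _ x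

def orEdge (S : Set T.Triangle) (x : T.Flag) : T.OrEdge S := Quot.mk _ x

def edge (S : Set T.Triangle) (x : T.Flag) : T.Edge S := Quot.mk _ x

def corner (x : T.Flag) : T.Corner := Quot.mk _ x

def side (x : T.Flag) : T.Side := Quot.mk _ x

/-- The dual graph of the closed complex: its nodes are the tetrahedra, its links the triangles. -/
def dualGraph : Graph T.Tet T.Triangle :=
  Graph.ofEnds (Quot.lift (fun f => s(f.1, T.adj f.1 f.2)) (by
    rintro ⟨k, i⟩ g rfl
    simp only [mate, T.adj_adj]
    exact Sym2.eq_swap))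

variable {T}

theorem flip_flip (x : T.Flag) : Flag.flip (Flag.flip x) = x := by
  simp [Flag.flip, Flag.act, mul_assoc]

theorem triangle_glue (x : T.Flag) : T.triangle (Flag.glue x) = T.triangle x :=
  (Quot.sound (by simp [Flag.face, Flag.glue, mate])).symm

theorem triangle_act (x : T.Flag) {τ : Equiv.Perm (Fin 4)} (h : τ 3 = 3) :
    T.triangle (Flag.act x τ) = T.triangle x := by
  have : Flag.face (Flag.act x τ) = Flag.face x := by simp [Flag.face, Flag.act, h]
  unfold triangle
  rw [this]

theorem glue_act (x : T.Flag) {τ : Equiv.Perm (Fin 4)} (h : τ 3 = 3) :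
    Flag.glue (Flag.act x τ) = Flag.act (Flag.glue x) τ := by
  simp [Flag.glue, Flag.act, h, mul_assoc]

theorem swap01_three : (Equiv.swap 0 1 : Equiv.Perm (Fin 4)) 3 = 3 := by decide

theorem triangle_flip (x : T.Flag) : T.triangle (Flag.flip x) = T.triangle x :=
  triangle_act x swap01_three

theorem orEdge_glue {S : Set T.Triangle} {x : T.Flag} (h : T.triangle x ∈ S) :
    T.orEdge S (Flag.glue x) = T.orEdge S x := by
  symm; exact Quot.sound (Or.inr ⟨h, rfl⟩)

theorem orEdge_act {S : Set T.Triangle} (x : T.Flag) {τ : Equiv.Perm (Fin 4)}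
    (h0 : τ 0 = 0) (h1 : τ 1 = 1) : T.orEdge S (Flag.act x τ) = T.orEdge S x := by
  symm; exact Quot.sound (Or.inl ⟨τ, ⟨h0, h1⟩, rfl⟩)

/-- Two flags with the same edge carry the same orientation of it or opposite ones. -/
theorem orEdge_of_edge_eq {S : Set T.Triangle} {x y : T.Flag} (h : T.edge S x = T.edge S y) :
    (T.orEdge S x = T.orEdge S y ∧ T.orEdge S (Flag.flip x) = T.orEdge S (Flag.flip y)) ∨
    (T.orEdge S x = T.orEdge S (Flag.flip y) ∧ T.orEdge S (Flag.flip x) = T.orEdge S y) := by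
  have h' := Quot.eqvGen_exact h
  clear h
  induction h' with
  | rel x y h =>
    rcases h with ⟨τ, (⟨h0, h1⟩ | ⟨h0, h1⟩), rfl⟩ | ⟨hS, rfl⟩
    · refine Or.inl ⟨(orEdge_act x h0 h1).symm, ?_⟩
      have : Flag.flip (Flag.act x τ)
          = Flag.act (Flag.flip x) (Equiv.swap 0 1 * τ * Equiv.swap 0 1) := by
        simp [Flag.flip, Flag.act, mul_assoc]
      rw [this, orEdge_act] <;> simp [h0, h1]
    · refine Or.inr ⟨?_, ?_⟩
      · have : Flag.flip (Flag.act x τ) = Flag.act x (τ * Equiv.swap 0 1) := by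
          simp [Flag.flip, Flag.act, mul_assoc]
        rw [this, orEdge_act] <;> simp [h0, h1]
      · have : Flag.act x τ = Flag.act (Flag.flip x) (Equiv.swap 0 1 * τ) := by
          simp [Flag.flip, Flag.act, mul_assoc]
        rw [this, orEdge_act] <;> simp [h0, h1]
    · refine Or.inl ⟨(orEdge_glue hS).symm, ?_⟩
      have : Flag.flip (Flag.glue x) = Flag.glue (Flag.flip x) :=
        (glue_act x swap01_three).symm
      rw [this, orEdge_glue]
      rw [triangle_flip]
      exact hS
  | refl x => exact Or.inl ⟨rfl, rfl⟩
  | symm x y _ ih =>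
    rcases ih with ⟨h1, h2⟩ | ⟨h1, h2⟩
    · exact Or.inl ⟨h1.symm, h2.symm⟩
    · exact Or.inr ⟨h2.symm, h1.symm⟩
  | trans x y z _ _ ih1 ih2 =>
    rcases ih1 with ⟨h1, h2⟩ | ⟨h1, h2⟩ <;> rcases ih2 with ⟨h3, h4⟩ | ⟨h3, h4⟩
    · exact Or.inl ⟨h1.trans h3, h2.trans h4⟩
    · exact Or.inr ⟨h1.trans h3, h2.trans h4⟩
    · exact Or.inr ⟨h1.trans h4, h2.trans h3⟩
    · exact Or.inl ⟨h1.trans h4, h2.trans h3⟩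

theorem vertex_of_orEdge_eq {S : Set T.Triangle} {x y : T.Flag}
    (h : T.orEdge S x = T.orEdge S y) : T.vertex S x = T.vertex S y := by
  have h' := Quot.eqvGen_exact h
  clear h
  induction h' with
  | rel x y h =>
    rcases h with ⟨τ, ⟨h0, _⟩, rfl⟩ | h
    · exact Quot.sound (Or.inl ⟨τ, h0, rfl⟩)
    · exact Quot.sound (Or.inr h)
  | refl x => rfl
  | symm x y _ ih => exact ih.symm
  | trans x y z _ _ ih1 ih2 => exact ih1.trans ih2

/-- Two flags with the same side of the same triangle carry the same orientation of it or
opposite ones. -/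
theorem corner_of_side_eq {x y : T.Flag} (h : T.side x = T.side y) :
    (T.corner x = T.corner y ∧ T.corner (Flag.flip x) = T.corner (Flag.flip y)) ∨
    (T.corner x = T.corner (Flag.flip y) ∧ T.corner (Flag.flip x) = T.corner y) := by
  have h' := Quot.eqvGen_exact h
  clear h
  induction h' with
  | rel x y h =>
    rcases h with ⟨τ, ⟨h3, h2⟩, rfl⟩ | ⟨_, rfl⟩
    · have hτ : τ = 1 ∨ τ = Equiv.swap 0 1 := by revert τ; decide
      rcases hτ with rfl | rfl
      · left; simp [Flag.act]
      · right
        refine ⟨?_, rfl⟩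
        change _ = T.corner (Flag.flip (Flag.flip x))
        rw [flip_flip]
    · refine Or.inl ⟨Quot.sound (Or.inr ⟨Set.mem_univ _, rfl⟩), ?_⟩
      have : Flag.flip (Flag.glue x) = Flag.glue (Flag.flip x) :=
        (glue_act x swap01_three).symm
      rw [this]
      exact Quot.sound (Or.inr ⟨Set.mem_univ _, rfl⟩)
  | refl x => exact Or.inl ⟨rfl, rfl⟩
  | symm x y _ ih =>
    rcases ih with ⟨h1, h2⟩ | ⟨h1, h2⟩
    · exact Or.inl ⟨h1.symm, h2.symm⟩
    · exact Or.inr ⟨h2.symm, h1.symm⟩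
  | trans x y z _ _ ih1 ih2 =>
    rcases ih1 with ⟨h1, h2⟩ | ⟨h1, h2⟩ <;> rcases ih2 with ⟨h3, h4⟩ | ⟨h3, h4⟩
    · exact Or.inl ⟨h1.trans h3, h2.trans h4⟩
    · exact Or.inr ⟨h1.trans h3, h2.trans h4⟩
    · exact Or.inr ⟨h1.trans h4, h2.trans h3⟩
    · exact Or.inl ⟨h1.trans h4, h2.trans h3⟩

theorem triangle_of_side_eq {x y : T.Flag} (h : T.side x = T.side y) :
    T.triangle x = T.triangle y := by
  have h' := Quot.eqvGen_exact h
  clear h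
  induction h' with
  | rel x y h =>
    rcases h with ⟨τ, ⟨h3, _⟩, rfl⟩ | ⟨_, rfl⟩
    · exact (triangle_act x h3).symm
    · exact (triangle_glue x).symm
  | refl x => rfl
  | symm x y _ ih => exact ih.symm
  | trans x y z _ _ ih1 ih2 => exact ih1.trans ih2

variable (T)

/-- The graph of vertices and edges of `T_S`. -/
def edgeGraph (S : Set T.Triangle) : Graph (T.Vertex S) (T.Edge S) :=
  Graph.ofEnds (Quot.lift (fun x => s(T.vertex S x, T.vertex S (Flag.flip x))) (by
    intro x y h
    rcases orEdge_of_edge_eq (Quot.sound h : T.edge S x = T.edge S y) with ⟨h1, h2⟩ | ⟨h1, h2⟩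
    · exact Sym2.eq_iff.2 (Or.inl ⟨vertex_of_orEdge_eq h1, vertex_of_orEdge_eq h2⟩)
    · exact Sym2.eq_iff.2 (Or.inr ⟨vertex_of_orEdge_eq h1, vertex_of_orEdge_eq h2⟩)))

/-! ### Removing a tree of tetrahedra and cutting along edges -/

/- For a set `T0` of triangles and a set `E` of edges, the 2-complex `T^{T0}` consists of the
triangles not in `T0`, with all edges and vertices. The 2-complex `T^{T0}_E` is obtained from it by
replacing every edge in `E` by one copy for each side of a triangle that lies on it, and then
keeping two triangles attached at a vertex only if this is forced by edges that they share. -/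

/-- The flags whose triangle belongs to `T^{T0}`. -/
abbrev CutFlag (T0 : Set T.Triangle) : Type u := {x : T.Flag // T.triangle x ∉ T0}

/-- The triangles of `T^{T0}_E`. -/
abbrev CutTriangle (T0 : Set T.Triangle) : Type u := {f : T.Triangle // f ∉ T0}

/-- The sides of the triangles of `T^{T0}_E`. -/
def CutSide (T0 : Set T.Triangle) : Type u :=
  Quot (fun x y : T.CutFlag T0 => T.side x.1 = T.side y.1)

/-- The edges of `T^{T0}_E`: two sides of triangles belong to the same one if they are the same
side of the same triangle, or if they belong to the same edge of `T` and this edge is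
not in `E`. -/
def CutEdge (T0 : Set T.Triangle) (E : Set (T.Edge Set.univ)) : Type u :=
  Quot (fun x y : T.CutFlag T0 => T.side x.1 = T.side y.1 ∨
    (T.edge Set.univ x.1 ∉ E ∧ T.edge Set.univ x.1 = T.edge Set.univ y.1))

/-- The vertices of `T^{T0}_E`: two corners of triangles belong to the same one if they are linked
by a sequence of corners in which the triangles of consecutive corners share an edge, not in `E`,
that contains the given vertices. -/
def CutVertex (T0 : Set T.Triangle) (E : Set (T.Edge Set.univ)) : Type u :=
  Quot (fun x y : T.CutFlag T0 => T.corner x.1 = T.corner y.1 ∨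
    (T.edge Set.univ x.1 ∉ E ∧ T.orEdge Set.univ x.1 = T.orEdge Set.univ y.1))

def cutEdge (T0 : Set T.Triangle) (E : Set (T.Edge Set.univ)) (x : T.CutFlag T0) :
    T.CutEdge T0 E := Quot.mk _ x

def cutVertex (T0 : Set T.Triangle) (E : Set (T.Edge Set.univ)) (x : T.CutFlag T0) :
    T.CutVertex T0 E := Quot.mk _ x

/-- The set `Cut(E)` of the edges of `T^{T0}_E` that are copies of edges in `E`. -/
def cut (T0 : Set T.Triangle) (E : Set (T.Edge Set.univ)) : Set (T.CutEdge T0 E) :=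
  {c | ∃ x : T.CutFlag T0, T.edge Set.univ x.1 ∈ E ∧ T.cutEdge T0 E x = c}

/-- The dual graph of the 2-complex `T^{T0}_E`: its nodes are the triangles and the edges, and
each side of a triangle is a link between this triangle and the edge to which the side belongs. -/
def incidenceGraph (T0 : Set T.Triangle) (E : Set (T.Edge Set.univ)) :
    Graph (T.CutTriangle T0 ⊕ T.CutEdge T0 E) (T.CutSide T0) :=
  Graph.ofEnds (Quot.lift
    (fun x => s(Sum.inl (⟨T.triangle x.1, x.2⟩ : T.CutTriangle T0),
      Sum.inr (T.cutEdge T0 E x))) (by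
    intro x y h
    have h1 : (⟨T.triangle x.1, x.2⟩ : T.CutTriangle T0) = ⟨T.triangle y.1, y.2⟩ :=
      Subtype.ext (triangle_of_side_eq h)
    have h2 : T.cutEdge T0 E x = T.cutEdge T0 E y := Quot.sound (Or.inl h)
    simp only [h1, h2]))

/-- The flag of `T^{T0}` with the edge reversed. -/
def CutFlag.flip {T : TetGluing.{u}} {T0 : Set T.Triangle} (x : T.CutFlag T0) : T.CutFlag T0 :=
  ⟨Flag.flip x.1, by rw [triangle_flip]; exact x.2⟩

theorem edge_flip {T : TetGluing.{u}} (S : Set T.Triangle) (x : T.Flag) :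
    T.edge S (Flag.flip x) = T.edge S x := by
  symm; exact Quot.sound (Or.inl ⟨Equiv.swap 0 1, Or.inr (by simp), rfl⟩)

/-- The graph of vertices and edges of `T^{T0}_E`. -/
def cutEdgeGraph (T0 : Set T.Triangle) (E : Set (T.Edge Set.univ)) :
    Graph (T.CutVertex T0 E) (T.CutEdge T0 E) :=
  Graph.ofEnds (Quot.lift
    (fun x => s(T.cutVertex T0 E x, T.cutVertex T0 E (CutFlag.flip x))) (by
    intro x y h
    rcases h with h | ⟨hE, h⟩
    · rcases corner_of_side_eq h with ⟨h1, h2⟩ | ⟨h1, h2⟩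
      · exact Sym2.eq_iff.2 (Or.inl ⟨Quot.sound (Or.inl h1), Quot.sound (Or.inl h2)⟩)
      · exact Sym2.eq_iff.2 (Or.inr ⟨Quot.sound (Or.inl h1), Quot.sound (Or.inl h2)⟩)
    · have hE' : T.edge Set.univ (CutFlag.flip x).1 ∉ E := by
        have := edge_flip Set.univ x.1
        simpa [CutFlag.flip, this] using hE
      rcases orEdge_of_edge_eq h with ⟨h1, h2⟩ | ⟨h1, h2⟩
      · exact Sym2.eq_iff.2
          (Or.inl ⟨Quot.sound (Or.inr ⟨hE, h1⟩), Quot.sound (Or.inr ⟨hE', h2⟩)⟩)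
      · exact Sym2.eq_iff.2
          (Or.inr ⟨Quot.sound (Or.inr ⟨hE, h1⟩), Quot.sound (Or.inr ⟨hE', h2⟩)⟩)))

end TetGluing

/-! ### Three-dimensional triangulations -/

/-- A closed oriented three-dimensional triangulation: finitely many tetrahedra, at least one,
glued along their faces into a connected complex, such that no face is glued to itself, the gluing
reverses the orientations (the labelling of each tetrahedron is taken positively oriented),
and no edge is identified with itself in the reverse direction. -/
structure Triangulation3 : Type (u + 1) extends TetGluing.{u} where
  finite_tet : Finite Tet
  nonempty_tet : Nonempty Tet
  mate_ne : ∀ f, toTetGluing.mate f ≠ f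
  sign_perm : ∀ k i, Equiv.Perm.sign (perm k i) = -1
  connected : ∀ k k', toTetGluing.dualGraph.JoinedBy Set.univ k k'
  edge_nondegenerate : ∀ x : toTetGluing.Flag,
    toTetGluing.orEdge Set.univ x ≠ toTetGluing.orEdge Set.univ (TetGluing.Flag.flip x)

namespace Triangulation3

open TetGluing

variable (T : Triangulation3.{u})

/-- `T0` is (the set of internal triangles of) a spanning tree of tetrahedra of `T`. -/
def IsSpanningTreeOfTets (T0 : Set T.Triangle) : Prop := T.dualGraph.IsSpanningTree T0

/-- `E` is a spanning tree of edges of `T`. -/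
def IsSpanningTreeOfEdges (E : Set (T.Edge Set.univ)) : Prop :=
  (T.edgeGraph Set.univ).IsSpanningTree E

/-- `T` is a triple-tree triangulation for the marked spanning trees `T0` of tetrahedra and `E` of
edges: the 2-complex `T^{T0}_E` is a tree of triangles, `Cut(E)` is a spanning tree of edges of it,
and `T` can be rooted on an oriented edge in `E` with a triangle of `T^{T0}` that contains it. -/
structure IsTripleTree (T0 : Set T.Triangle) (E : Set (T.Edge Set.univ)) : Prop where
  tets : T.IsSpanningTreeOfTets T0
  edges : T.IsSpanningTreeOfEdges E
  triangles : (T.incidenceGraph T0 E).IsTree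
  cut : (T.cutEdgeGraph T0 E).IsSpanningTree (T.cut T0 E)
  root : ∃ x : T.Flag, T.triangle x ∉ T0 ∧ T.edge Set.univ x ∈ E

variable {T}

/-- A local construction of `T` based on `T0`. At the step `s`, the two copies `A` and `B`, on the
boundary of the current complex, of a triangle of `T` are glued. The flag `flag s` has the face `A`
and the chosen edge shared by `A` and `B`; the flag `(flag s).glue` then has the face `B`. -/
structure LocalConstruction (T0 : Set T.Triangle) where
  /-- The number of steps. -/
  n : ℕ
  flag : Fin n → T.Flag
  triangle_injective : Function.Injective (fun s => T.triangle (flag s))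
  /-- Exactly the triangles not in `T0` are formed. -/
  range_triangle : Set.range (fun s => T.triangle (flag s)) = T0ᶜ
  /-- Before `A` and `B` are glued, the chosen edge is common to them, and the gluing identifies
  it with itself. -/
  shared : ∀ s, T.orEdge (T0 ∪ {f | ∃ r < s, T.triangle (flag r) = f}) (flag s)
    = T.orEdge (T0 ∪ {f | ∃ r < s, T.triangle (flag r) = f}) (Flag.glue (flag s))

namespace LocalConstruction

variable {T0 : Set T.Triangle} (L : LocalConstruction T0)

/-- The triangles that are glued just before the step `s` is carried out: those of the tree of
tetrahedra, and those formed in the previous steps. -/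
def glued (s : Fin L.n) : Set T.Triangle := T0 ∪ {f | ∃ r < s, T.triangle (L.flag r) = f}

/-- The critical set of edges of a local construction: the edges of `T` that are not formed by the
edge chosen at any step. -/
def critical : Set (T.Edge Set.univ) := {e | ∀ s, T.edge Set.univ (L.flag s) ≠ e}

/-- For a set `E0` of edges of the initial tree of tetrahedra, the set of its images in the complex
just before the step `s`. -/
def image (E0 : Set (T.Edge T0)) (s : Fin L.n) : Set (T.Edge (L.glued s)) :=
  {e | ∃ x : T.Flag, T.edge T0 x ∈ E0 ∧ T.edge (L.glued s) x = e}

/-- The local construction avoids `E0`: at each step, the chosen shared edge is not in the current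
image of `E0`, and any two edges that are identified by the gluing are either both
in the current image of `E0` or both not. -/
def Avoids (E0 : Set (T.Edge T0)) : Prop :=
  ∀ s, T.edge (L.glued s) (L.flag s) ∉ L.image E0 s ∧
    ∀ y : T.Flag, Flag.face y = Flag.face (L.flag s) →
      (T.edge (L.glued s) y ∈ L.image E0 s ↔ T.edge (L.glued s) (Flag.glue y) ∈ L.image E0 s)

/-- The local construction avoids some spanning tree of edges of the initial tree of tetrahedra
(all edges and vertices of which are on its boundary). -/
def IsTreeAvoiding : Prop :=
  ∃ E0 : Set (T.Edge T0), (T.edgeGraph T0).IsSpanningTree E0 ∧ L.Avoids E0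

end LocalConstruction

/-- The triple-tree triangulations. -/
def tripleTree : Set Triangulation3.{u} := {T | ∃ T0 E, T.IsTripleTree T0 E}

/-- The locally constructible triangulations. -/
def locallyConstructible : Set Triangulation3.{u} :=
  {T | ∃ T0 : Set T.Triangle, T.IsSpanningTreeOfTets T0 ∧ Nonempty (LocalConstruction T0)}

/-- The tree-avoiding locally constructible triangulations. -/
def treeAvoidingLocallyConstructible : Set Triangulation3.{u} :=
  {T | ∃ T0 : Set T.Triangle, T.IsSpanningTreeOfTets T0 ∧
    ∃ L : LocalConstruction T0, L.IsTreeAvoiding}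

end Triangulation3

/-!
Let `n` be the number of triangles not in `T0`; there are `n - 1` tetrahedra.

The tetrahedra around an edge of `T_S` form a chain or a cycle (`exists_other_end`). Hence the two
copies of a triangle share an edge on the boundary of `T_S` exactly if one of the sides of this
triangle is the only side, among the triangles outside `S`, on its edge of `T`
(`orEdge_eq_glue_iff`). So a local construction based on `T0` is the same as a collapse of the
2-complex `T^{T0}` onto the graph of its critical edges, in which the triangles are removed one by
one through a free edge. Moreover, a set of edges is avoided exactly if it is the preimage, in the
tree of tetrahedra, of a set `E` of edges of `T` that contains no chosen edge
(`LocalConstruction.Avoids.exists_eq_preimage`, `LocalConstruction.avoids_preimage`). The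
equivalence is thus a statement about `T^{T0}` and `E`. It is proved with chains and cochains
modulo 2, since a set of links is a spanning tree exactly if the coboundary, from functions on the
nodes to functions on these links, is onto and only the constants have coboundary zero.

*From local constructions to triple trees.* Let the preimage of `E` be a spanning tree on the
sphere `∂T0`. A chain of triangles whose boundary is supported on the preimage of `E` is a sum of
triangles with a boundary supported on a forest, so its boundary is zero: the triangles outside `T0`
are connected through the edges outside `E` (`dualConnected_of_isSpanningTree`). As `∂T0` has at
least `n + 2` vertices, `E` has at least `n + 1` sides on it, and at most `2n - 1` sides remain for
the connections; since the `n` chosen edges are different and outside `E`, all these bounds are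
equalities, the cut complex is a tree of triangles and `E` is the set of critical edges. A cochain
that is closed on all triangles and vanishes on `E` is zero, as it can be computed backwards along
the collapse (`LocalConstruction.eq_zero_of_closed`); this holds in the cut complex and shows that
`Cut(E)` connects its vertices, and the count of vertices (`card_cutVertex`) does the rest. By the
same triangular system, each function on `E` extends to a closed cochain of `T`; on `∂T0` this is
the coboundary of a potential (`LocalConstruction.eq_zero_of_closed_boundary`), which descends to
the vertices of `T` (`LocalConstruction.potential_glue`). So `E` is acyclic, and it is a spanning
tree of edges of `T`.

*From triple trees to local constructions.* Since `Cut(E)` is acyclic and the cut complex a tree of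
triangles, no nonzero chain of triangles has boundary zero outside `E`
(`IsTripleTree.chain_eq_zero`). So the Hall condition holds, and the triangles can be matched with
edges outside `E` that they contain (`IsTripleTree.exists_matching`). In a tree of triangles, any
set of matched triangles has one whose matched edge is free in this set
(`IsTripleTree.exists_free`); this gives the order of the collapse. Its critical edges are those of
`E` by counting, and the preimage of `E` is a spanning tree of `∂T0` by
`LocalConstruction.eq_zero_of_closed_boundary` and counting.

*Strictness.* Fold two faces of a single tetrahedron together along one edge, and the two others
along the opposite edge (`foldedTet`). The four other edges form a 4-cycle of the tetrahedron and
become one edge of the 3-sphere obtained, so an avoided set contains this cycle or none of its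
edges; in neither case is it a spanning tree (`not_isTreeAvoiding`).
-/

/-! ### Counting in spanning trees of multigraphs -/

section LinearAlgebra

variable {X ι : Type*} [Finite X]

/-- If the kernel of a linear map consists of constant functions, its rank is at least the number
of coordinates of the source minus one. -/
theorem card_le_finrank_range_add_one (f : (X → ZMod 2) →ₗ[ZMod 2] (ι → ZMod 2))
    (hf : ∀ φ, f φ = 0 → ∀ x y, φ x = φ y) :
    Nat.card X ≤ Module.finrank (ZMod 2) (LinearMap.range f) + 1 := by
  have := Fintype.ofFinite X
  have hk : Module.finrank (ZMod 2) (LinearMap.ker f) ≤ 1 := by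
    have hle : LinearMap.ker f ≤ Submodule.span (ZMod 2) {(fun _ => 1 : X → ZMod 2)} := by
      intro φ hφ
      rw [Submodule.mem_span_singleton]
      rcases isEmpty_or_nonempty X with hX | ⟨⟨x⟩⟩
      · exact ⟨0, funext fun x => hX.elim x⟩
      · exact ⟨φ x, funext fun y => by simpa using hf φ hφ x y⟩
    exact (Submodule.finrank_mono hle).trans ((finrank_span_le_card _).trans (by simp))
  have h := LinearMap.finrank_range_add_finrank_ker f
  rw [Module.finrank_fintype_fun_eq_card, ← Nat.card_eq_fintype_card] at h
  omega

variable [Finite ι]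

theorem card_le_card_add_one_of_ker (f : (X → ZMod 2) →ₗ[ZMod 2] (ι → ZMod 2))
    (hf : ∀ φ, f φ = 0 → ∀ x y, φ x = φ y) : Nat.card X ≤ Nat.card ι + 1 := by
  have := Fintype.ofFinite ι
  have h := card_le_finrank_range_add_one f hf
  have h2 := Submodule.finrank_le (LinearMap.range f)
  rw [Module.finrank_fintype_fun_eq_card, ← Nat.card_eq_fintype_card] at h2
  omega

theorem surjective_of_ker (f : (X → ZMod 2) →ₗ[ZMod 2] (ι → ZMod 2))
    (hf : ∀ φ, f φ = 0 → ∀ x y, φ x = φ y) (hc : Nat.card ι + 1 ≤ Nat.card X) :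
    Function.Surjective f := by
  have := Fintype.ofFinite ι
  have h := card_le_finrank_range_add_one f hf
  rw [← LinearMap.range_eq_top]
  apply Submodule.eq_top_of_finrank_eq
  have h2 := Submodule.finrank_le (LinearMap.range f)
  rw [Module.finrank_fintype_fun_eq_card, ← Nat.card_eq_fintype_card] at h2 ⊢
  omega

/-- Imposing `card ι` equalities between elements of `X` leaves at least `card X - card ι`
classes. -/
theorem card_le_card_add_card_of_factor {Q : Type*} [Finite Q] (π : X → Q) (a b : ι → X)
    (h : ∀ ψ : X → ZMod 2, (∀ i, ψ (a i) = ψ (b i)) → ∃ φ : Q → ZMod 2, ∀ x, ψ x = φ (π x)) :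
    Nat.card X ≤ Nat.card Q + Nat.card ι := by
  have := Fintype.ofFinite X
  have := Fintype.ofFinite Q
  have := Fintype.ofFinite ι
  let f : (X → ZMod 2) →ₗ[ZMod 2] (ι → ZMod 2) :=
    LinearMap.funLeft (ZMod 2) (ZMod 2) a - LinearMap.funLeft (ZMod 2) (ZMod 2) b
  let g : (Q → ZMod 2) →ₗ[ZMod 2] (X → ZMod 2) := LinearMap.funLeft (ZMod 2) (ZMod 2) π
  have hle : LinearMap.ker f ≤ LinearMap.range g := by
    intro ψ hψ
    obtain ⟨φ, hφ⟩ := h ψ (fun i => by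
      have := congrFun (show f ψ = 0 from hψ) i
      simpa [f, LinearMap.funLeft_apply, sub_eq_zero] using this)
    exact ⟨φ, funext fun x => (hφ x).symm⟩
  have h1 := Submodule.finrank_mono hle
  have h2 := LinearMap.finrank_range_le g
  have h3 := LinearMap.finrank_range_add_finrank_ker f
  have h4 := Submodule.finrank_le (LinearMap.range f)
  simp only [Module.finrank_fintype_fun_eq_card] at h2 h3 h4
  simp only [Nat.card_eq_fintype_card]
  omega

end LinearAlgebra

theorem zmod_two_add_eq_zero {a b : ZMod 2} : a + b = 0 ↔ a = b := by
  revert a b; decide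

namespace Graph

variable {V L : Type*} {ends : L → Sym2 V} {F : Set L}

theorem edgeSet_ofEnds : (ofEnds ends).edgeSet = Set.univ := by
  ext l
  induction h : ends l with
  | h u v =>
    simp only [Set.mem_univ, iff_true, edge_mem_iff_exists_isLink]
    exact ⟨u, v, h⟩

theorem JoinedBy.eq_of_forall {α : Type*} {G : Graph V L} {u v : V} (h : G.JoinedBy F u v)
    (φ : V → α) (hφ : ∀ l ∈ F, ∀ u v, G.IsLink l u v → φ u = φ v) : φ u = φ v := by
  induction h with
  | rel u v h => obtain ⟨l, hl, h⟩ := h; exact hφ l hl u v h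
  | refl => rfl
  | symm _ _ _ ih => exact ih.symm
  | trans _ _ _ _ _ ih ih' => exact ih.trans ih'

theorem IsSpanningTree.eq_of_forall {α : Type*} (h : (ofEnds ends).IsSpanningTree F)
    (φ : V → α) (hφ : ∀ l ∈ F, ∀ u v, ends l = s(u, v) → φ u = φ v) (u v : V) : φ u = φ v :=
  (h.joined u (Set.mem_univ _) v (Set.mem_univ _)).eq_of_forall φ hφ

/-- The sum of a function modulo 2 over the two ends of each link. -/
def coboundary (ends : L → Sym2 V) : (V → ZMod 2) →ₗ[ZMod 2] (L → ZMod 2) where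
  toFun φ l := Sym2.lift ⟨fun u v => φ u + φ v, fun _ _ => add_comm _ _⟩ (ends l)
  map_add' φ ψ := by
    ext l
    induction h : ends l with
    | h u v => simp [h]; ring
  map_smul' c φ := by
    ext l
    induction h : ends l with
    | h u v => simp [h]; ring

theorem coboundary_apply {l : L} {u v : V} (h : ends l = s(u, v)) (φ : V → ZMod 2) :
    coboundary ends φ l = φ u + φ v := by
  simp [coboundary, h]

/-- The links in `F` other than `l` leave the ends of `l` in two different components; the
indicator function of one of them has coboundary `l` on `F`. -/
theorem IsSpanningTree.exists_coboundary (h : (ofEnds ends).IsSpanningTree F) {l : L}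
    (hl : l ∈ F) : ∃ φ : V → ZMod 2, coboundary ends φ l = 1 ∧
      ∀ l' ∈ F, l' ≠ l → coboundary ends φ l' = 0 := by
  classical
  induction hul : ends l with
  | h u v =>
    have hn := h.acyclic l hl u v hul
    refine ⟨fun w => if (ofEnds ends).JoinedBy (F \ {l}) u w then 1 else 0, ?_, ?_⟩
    · rw [coboundary_apply hul]
      have : (ofEnds ends).JoinedBy (F \ {l}) u u := .refl _
      simp [this, hn]
    · intro l' hl' hne
      induction hul' : ends l' with
      | h u' v' =>
        rw [coboundary_apply hul', zmod_two_add_eq_zero]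
        have hj : (ofEnds ends).JoinedBy (F \ {l}) u' v' := .rel _ _ ⟨l', ⟨hl', hne⟩, hul'⟩
        congr 1
        exact propext ⟨fun h => .trans _ _ _ h hj, fun h => .trans _ _ _ h (.symm _ _ hj)⟩

/-- A nonempty set of links in a forest spans more nodes than it has links. -/
theorem IsSpanningTree.card_lt (h : (ofEnds ends).IsSpanningTree F) {F' : Finset L}
    (hF' : ↑F' ⊆ F) (hne : F'.Nonempty) {W : Finset V} (hW : ∀ l ∈ F', ∀ v ∈ ends l, v ∈ W) :
    F'.card < W.card := by
  classical
  -- the coboundary of functions supported on `W`, restricted to `F'`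
  let f : (W → ZMod 2) →ₗ[ZMod 2] (F' → ZMod 2) :=
    (LinearMap.funLeft (ZMod 2) (ZMod 2) (fun l : F' => (l : L))) ∘ₗ coboundary ends ∘ₗ
      (Function.ExtendByZero.linearMap (ZMod 2) (fun w : W => (w : V)))
  have hval : ∀ (φ : V → ZMod 2) (l : F'), f (fun w => φ w) l = coboundary ends φ l := by
    intro φ l
    induction hl : ends l with
    | h u v =>
      have hu : u ∈ W := hW l l.2 u (by simp [hl])
      have hv : v ∈ W := hW l l.2 v (by simp [hl])
      simp only [f, LinearMap.comp_apply, LinearMap.funLeft_apply, coboundary_apply hl,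
        Function.ExtendByZero.linearMap_apply]
      rw [Subtype.val_injective.extend_apply _ _ (⟨u, hu⟩ : W),
        Subtype.val_injective.extend_apply _ _ (⟨v, hv⟩ : W)]
  have hs : LinearMap.range f = ⊤ := by
    rw [eq_top_iff, ← (Pi.basisFun (ZMod 2) F').span_eq, Submodule.span_le]
    rintro _ ⟨l, rfl⟩
    obtain ⟨φ, h1, h2⟩ := h.exists_coboundary (hF' l.2)
    refine ⟨fun w => φ w, funext fun l' => ?_⟩
    rw [hval, Pi.basisFun_apply]
    by_cases hll : l' = l
    · subst hll; simp [h1]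
    · rw [h2 l' (hF' l'.2) (fun h => hll (Subtype.ext h)), Pi.single_eq_of_ne hll]
  have hk : 0 < Module.finrank (ZMod 2) (LinearMap.ker f) := by
    rw [Module.finrank_pos_iff, Submodule.nontrivial_iff_ne_bot]
    intro hbot
    obtain ⟨l, hl⟩ := hne
    induction hul : ends l with
    | h u v =>
      have hu : u ∈ W := hW l hl u (by simp [hul])
      have h1 : (fun _ => 1 : W → ZMod 2) ∈ LinearMap.ker f := by
        refine funext fun l' => ?_
        rw [hval (fun _ => 1)]
        induction hul' : ends l' with
        | h u v => rw [coboundary_apply hul']; exact zmod_two_add_eq_zero.2 rfl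
      rw [hbot, Submodule.mem_bot] at h1
      exact one_ne_zero (congrFun h1 ⟨u, hu⟩)
  have h3 := LinearMap.finrank_range_add_finrank_ker f
  rw [hs, finrank_top] at h3
  simp only [Module.finrank_fintype_fun_eq_card, Fintype.card_coe] at h3
  omega

/-- The coboundary restricted to the links in `F`. -/
def coboundaryOn (ends : L → Sym2 V) (F : Set L) : (V → ZMod 2) →ₗ[ZMod 2] (F → ZMod 2) :=
  LinearMap.funLeft (ZMod 2) (ZMod 2) (fun l : F => (l : L)) ∘ₗ coboundary ends

theorem coboundaryOn_ker {φ : V → ZMod 2} (h : coboundaryOn ends F φ = 0) :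
    ∀ l ∈ F, ∀ u v, ends l = s(u, v) → φ u = φ v := by
  intro l hl u v huv
  have := congrFun h ⟨l, hl⟩
  simpa [coboundaryOn, coboundary_apply huv, LinearMap.funLeft_apply, zmod_two_add_eq_zero]
    using this

variable [Finite V] [Finite L]

theorem card_le_of_connected
    (h : ∀ φ : V → ZMod 2, (∀ l ∈ F, ∀ u v, ends l = s(u, v) → φ u = φ v) → ∀ u v, φ u = φ v) :
    Nat.card V ≤ Nat.card F + 1 :=
  card_le_card_add_one_of_ker (coboundaryOn ends F) fun φ hφ => h φ (coboundaryOn_ker hφ)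

omit [Finite V] [Finite L] in
/-- Connectedness and acyclicity in terms of coboundaries. -/
theorem isSpanningTree_of_coboundary [Nonempty V]
    (h : ∀ φ : V → ZMod 2, (∀ l ∈ F, ∀ u v, ends l = s(u, v) → φ u = φ v) → ∀ u v, φ u = φ v)
    (hs : ∀ l ∈ F, ∃ φ, coboundary ends φ l = 1 ∧ ∀ l' ∈ F, l' ≠ l → coboundary ends φ l' = 0) :
    (ofEnds ends).IsSpanningTree F where
  subset l _ := by rw [edgeSet_ofEnds]; trivial
  nonempty := Set.univ_nonempty
  joined u _ v _ := by
    classical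
    have := h (fun w => if (ofEnds ends).JoinedBy F u w then 1 else 0) (by
      intro l hl a b hab
      have hj : (ofEnds ends).JoinedBy F a b := .rel _ _ ⟨l, hl, hab⟩
      congr 1
      exact propext ⟨fun h => .trans _ _ _ h hj, fun h => .trans _ _ _ h (.symm _ _ hj)⟩) u v
    have hu : (ofEnds ends).JoinedBy F u u := .refl _
    by_contra hv
    simp [hu, hv] at this
  acyclic l hl u v huv hj := by
    obtain ⟨φ, h1, h2⟩ := hs l hl
    rw [coboundary_apply huv] at h1
    have h3 : φ u = φ v := hj.eq_of_forall φ (by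
      rintro l' ⟨hl', hne⟩ a b hab
      have := h2 l' hl' hne
      rwa [coboundary_apply hab, zmod_two_add_eq_zero] at this)
    rw [h3, zmod_two_add_eq_zero.2 rfl] at h1
    exact zero_ne_one h1

/-- A connected set of links whose number is that of a spanning tree is a spanning tree. -/
theorem isSpanningTree_of_connected [Nonempty V] (hc : Nat.card F + 1 ≤ Nat.card V)
    (h : ∀ φ : V → ZMod 2, (∀ l ∈ F, ∀ u v, ends l = s(u, v) → φ u = φ v) → ∀ u v, φ u = φ v) :
    (ofEnds ends).IsSpanningTree F := by
  classical
  refine isSpanningTree_of_coboundary h fun l hl => ?_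
  obtain ⟨φ, hφ⟩ := surjective_of_ker (coboundaryOn ends F)
    (fun φ hφ => h φ (coboundaryOn_ker hφ)) hc (Pi.single ⟨l, hl⟩ 1)
  have hval : ∀ l' : F, coboundary ends φ l' = Pi.single (M := fun _ => ZMod 2) ⟨l, hl⟩ 1 l' :=
    fun l' => congrFun hφ l'
  refine ⟨φ, by rw [hval ⟨l, hl⟩, Pi.single_eq_same], fun l' hl' hne => ?_⟩
  rw [hval ⟨l', hl'⟩, Pi.single_eq_of_ne (fun h => hne (Subtype.ext_iff.1 h))]

theorem IsSpanningTree.card_add_one (h : (ofEnds ends).IsSpanningTree F) :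
    Nat.card F + 1 = Nat.card V := by
  classical
  have := Fintype.ofFinite V
  have := Fintype.ofFinite L
  refine le_antisymm ?_ (card_le_of_connected fun φ hφ => h.eq_of_forall φ hφ)
  rcases F.eq_empty_or_nonempty with rfl | hne
  · obtain ⟨v, -⟩ := h.nonempty
    simp only [Nat.card_eq_fintype_card, Fintype.card_eq_zero, zero_add]
    exact Fintype.card_pos_iff.2 ⟨v⟩
  · have := h.card_lt (F' := F.toFinset) (by simp) (by simpa using hne) (W := Finset.univ)
      (fun _ _ _ _ => Finset.mem_univ _)
    rw [Set.toFinset_card, Finset.card_univ] at this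
    simpa [Nat.card_eq_fintype_card] using this

theorem IsSpanningTree.exists_coboundary_eq (h : (ofEnds ends).IsSpanningTree F)
    (g : L → ZMod 2) : ∃ φ : V → ZMod 2, ∀ l ∈ F, coboundary ends φ l = g l := by
  obtain ⟨φ, hφ⟩ := surjective_of_ker (coboundaryOn ends F)
    (fun φ hφ => h.eq_of_forall φ (coboundaryOn_ker hφ)) h.card_add_one.le (fun l => g l)
  exact ⟨φ, fun l hl => congrFun hφ ⟨l, hl⟩⟩

end Graph

/-- If all fibres of a map have two elements, its source has twice as many elements as its
target. -/
theorem card_eq_two_mul {α β : Type*} [Finite α] [Finite β] (f : α → β)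
    (hs : Function.Surjective f)
    (h : ∀ x, ∃ y, y ≠ x ∧ f y = f x ∧ ∀ z, f z = f x → z = x ∨ z = y) :
    Nat.card α = 2 * Nat.card β := by
  classical
  have := Fintype.ofFinite α
  have := Fintype.ofFinite β
  simp only [Nat.card_eq_fintype_card, ← Finset.card_univ]
  rw [Finset.card_eq_sum_card_fiberwise (f := f) (t := Finset.univ) (fun _ _ => by simp),
    Finset.sum_const_nat (m := 2), mul_comm]
  intro b _
  obtain ⟨x, rfl⟩ := hs b
  obtain ⟨y, hne, hy, hz⟩ := h x
  rw [Finset.card_eq_two]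
  refine ⟨x, y, hne.symm, ?_⟩
  ext z
  simp only [Finset.mem_filter, Finset.mem_univ, true_and, Finset.mem_insert,
    Finset.mem_singleton]
  refine ⟨hz z, ?_⟩
  rintro (rfl | rfl)
  exacts [rfl, hy]

/-! ### Flags around an edge -/

theorem Quot.iff_of_eq {α : Type*} {r : α → α → Prop} (C : α → Prop)
    (h : ∀ a b, r a b → (C a ↔ C b)) {x y : α} (hxy : Quot.mk r x = Quot.mk r y) : C x ↔ C y :=
  (congrArg (Quot.lift C fun a b hab => propext (h a b hab)) hxy).to_iff

theorem Quot.eq_of_imp {α : Type*} {r r' : α → α → Prop} (h : ∀ a b, r a b → r' a b) {x y : α}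
    (hxy : Quot.mk r x = Quot.mk r y) : Quot.mk r' x = Quot.mk r' y :=
  congrArg (Quot.lift (Quot.mk r') fun a b hab => Quot.sound (h a b hab)) hxy

/-- Two involutions `a` and `b` of a finite set, of which `a` may be used only inside `S`, connect
each point `x` outside `S` to exactly one other point outside `S`: the first one met on the
alternating walk that starts from `x` with `b`. -/
theorem exists_end_of_involutive {X : Type*} [Finite X] {a b : X → X} (ha : Function.Involutive a)
    (hb : Function.Involutive b) {S : Set X} (hS : ∀ x ∈ S, a x ∈ S) {x : X} (hx : x ∉ S) :
    ∃ m, b ((a ∘ b)^[m] x) ∉ S ∧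
      Quot.mk (fun z z' => z' = b z ∨ z ∈ S ∧ z' = a z) (b ((a ∘ b)^[m] x)) = Quot.mk _ x ∧
      ∀ z ∉ S, Quot.mk (fun z z' => z' = b z ∨ z ∈ S ∧ z' = a z) z = Quot.mk _ x →
        z = x ∨ z = b ((a ∘ b)^[m] x) := by
  classical
  set r : X → X → Prop := fun z z' => z' = b z ∨ z ∈ S ∧ z' = a z
  have hw : ∀ j, (a ∘ b)^[j + 1] x = a (b ((a ∘ b)^[j] x)) :=
    fun j => Function.iterate_succ_apply' _ _ _
  have hex : ∃ m, b ((a ∘ b)^[m] x) ∉ S := by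
    obtain ⟨m, hm, hp⟩ := (ha.injective.comp hb.injective).mem_periodicPts x
    obtain ⟨m, rfl⟩ := Nat.exists_eq_succ_of_ne_zero hm.ne'
    refine ⟨m, fun h => hx ?_⟩
    have h2 := hS _ h
    rw [← hw] at h2
    have h3 : (a ∘ b)^[m + 1] x = x := hp
    rwa [h3] at h2
  have hlt : ∀ i < Nat.find hex, b ((a ∘ b)^[i] x) ∈ S :=
    fun i hi => not_not.1 (Nat.find_min hex hi)
  refine ⟨Nat.find hex, Nat.find_spec hex, ?_, ?_⟩
  · have h1 : ∀ j ≤ Nat.find hex, Quot.mk r ((a ∘ b)^[j] x) = Quot.mk r x := by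
      intro j
      induction j with
      | zero => intro _; rfl
      | succ j ih =>
        intro hj
        rw [← ih (by omega), hw]
        have hb1 : Quot.mk r ((a ∘ b)^[j] x) = Quot.mk r (b ((a ∘ b)^[j] x)) :=
          Quot.sound (Or.inl rfl)
        exact (hb1.trans (Quot.sound (Or.inr ⟨hlt j (by omega), rfl⟩))).symm
    rw [← h1 _ le_rfl]
    have hb1 : Quot.mk r ((a ∘ b)^[Nat.find hex] x) = Quot.mk r (b ((a ∘ b)^[Nat.find hex] x)) :=
      Quot.sound (Or.inl rfl)
    exact hb1.symm
  · intro z hz hzx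
    set C : X → Prop := fun z =>
      ∃ j ≤ Nat.find hex, z = (a ∘ b)^[j] x ∨ z = b ((a ∘ b)^[j] x) with hC
    have hCb : ∀ z, C z → C (b z) := by
      rintro z ⟨j, hj, rfl | rfl⟩
      · exact ⟨j, hj, Or.inr rfl⟩
      · exact ⟨j, hj, Or.inl (hb _)⟩
    have hCa : ∀ z ∈ S, C z → C (a z) := by
      rintro z hzS ⟨j, hj, rfl | rfl⟩
      · cases j with
        | zero => exact absurd hzS hx
        | succ j => exact ⟨j, by omega, Or.inr (by rw [hw, ha])⟩
      · rcases hj.lt_or_eq with hj | rfl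
        · exact ⟨j + 1, hj, Or.inl (hw j).symm⟩
        · exact absurd hzS (Nat.find_spec hex)
    have hCz : C z := by
      refine (Quot.iff_of_eq C ?_ hzx).2 ⟨0, Nat.zero_le _, Or.inl rfl⟩
      rintro z z' (rfl | ⟨hzS, rfl⟩)
      · exact ⟨hCb z, fun h => by simpa [hb z] using hCb _ h⟩
      · exact ⟨hCa z hzS, fun h => by simpa [ha z] using hCa _ (hS z hzS) h⟩
    obtain ⟨j, hj, rfl | rfl⟩ := hCz
    · cases j with
      | zero => exact Or.inl rfl
      | succ j => exact absurd (hS _ (hlt j (by omega))) (by rwa [← hw])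
    · rcases hj.lt_or_eq with hj | rfl
      · exact absurd (hlt j hj) hz
      · exact Or.inr rfl

namespace TetGluing

variable {T : TetGluing.{u}}

/-- The same edge of the same tetrahedron, with the other face that contains it. -/
def Flag.turn (x : T.Flag) : T.Flag := Flag.act x (Equiv.swap 2 3)

/-- The next edge around the face of a flag. -/
def Flag.rot (x : T.Flag) : T.Flag := Flag.act x (Equiv.swap 0 1 * Equiv.swap 1 2)

/-- The orientation of a flag relative to that of its tetrahedron. -/
def Flag.sign (x : T.Flag) : ℤˣ := Equiv.Perm.sign x.2

theorem act_act (x : T.Flag) (σ τ : Equiv.Perm (Fin 4)) :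
    Flag.act (Flag.act x σ) τ = Flag.act x (σ * τ) := by
  simp [Flag.act, mul_assoc]

theorem act_one (x : T.Flag) : Flag.act x 1 = x := by simp [Flag.act]

theorem sign_act (x : T.Flag) (τ : Equiv.Perm (Fin 4)) :
    Flag.sign (Flag.act x τ) = Flag.sign x * Equiv.Perm.sign τ := by
  simp [Flag.sign, Flag.act]

theorem sign_flip (x : T.Flag) : Flag.sign (Flag.flip x) = -Flag.sign x := by
  rw [Flag.flip, sign_act, Equiv.Perm.sign_swap (by decide), mul_neg_one]

theorem sign_turn (x : T.Flag) : Flag.sign (Flag.turn x) = -Flag.sign x := by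
  rw [Flag.turn, sign_act, Equiv.Perm.sign_swap (by decide), mul_neg_one]

theorem sign_rot (x : T.Flag) : Flag.sign (Flag.rot x) = Flag.sign x := by
  rw [Flag.rot, sign_act, Equiv.Perm.sign_mul, Equiv.Perm.sign_swap (by decide),
    Equiv.Perm.sign_swap (by decide), neg_mul_neg, one_mul, mul_one]

theorem turn_turn (x : T.Flag) : Flag.turn (Flag.turn x) = x := by
  simp [Flag.turn, act_act, act_one]

theorem rot_rot_rot (x : T.Flag) : Flag.rot (Flag.rot (Flag.rot x)) = x := by
  simp only [Flag.rot, act_act]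
  rw [show (Equiv.swap 0 1 * Equiv.swap 1 2 * (Equiv.swap 0 1 * Equiv.swap 1 2) *
    (Equiv.swap 0 1 * Equiv.swap 1 2) : Equiv.Perm (Fin 4)) = 1 by decide, act_one]

theorem glue_glue (x : T.Flag) : Flag.glue (Flag.glue x) = x := by
  obtain ⟨k, q⟩ := x
  simp only [Flag.glue, Equiv.Perm.mul_apply, T.adj_adj, T.perm_perm, inv_mul_cancel_left]

theorem face_glue (x : T.Flag) : Flag.face (Flag.glue x) = T.mate (Flag.face x) := rfl

theorem mate_mate (f : T.Tet × Fin 4) : T.mate (T.mate f) = f := by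
  obtain ⟨k, i⟩ := f
  simp [mate, T.adj_adj, T.perm_perm]

theorem flip_glue (x : T.Flag) : Flag.flip (Flag.glue x) = Flag.glue (Flag.flip x) :=
  (glue_act x swap01_three).symm

theorem triangle_rot (x : T.Flag) : T.triangle (Flag.rot x) = T.triangle x :=
  triangle_act x (by decide)

theorem rot_glue (x : T.Flag) : Flag.rot (Flag.glue x) = Flag.glue (Flag.rot x) :=
  (glue_act x (by decide)).symm

theorem face_act (x : T.Flag) {τ : Equiv.Perm (Fin 4)} (h : τ 3 = 3) :
    Flag.face (Flag.act x τ) = Flag.face x := by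
  simp [Flag.face, Flag.act, h]

/-- The triangle formed by a face of a tetrahedron. -/
def faceTriangle (f : T.Tet × Fin 4) : T.Triangle := Quot.mk _ f

theorem faceTriangle_mate (f : T.Tet × Fin 4) : faceTriangle (T.mate f) = faceTriangle f :=
  (Quot.sound rfl : (Quot.mk _ f : T.Triangle) = Quot.mk _ (T.mate f)).symm

theorem eq_or_mate_of_faceTriangle {f g : T.Tet × Fin 4} (h : faceTriangle f = faceTriangle g) :
    f = g ∨ f = T.mate g := by
  refine (Quot.iff_of_eq (fun f => f = g ∨ f = T.mate g) ?_ h).2 (Or.inl rfl)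
  rintro f _ rfl
  constructor
  · rintro (rfl | rfl)
    · exact Or.inr rfl
    · exact Or.inl (mate_mate _)
  · rintro (rfl | h)
    · exact Or.inr (mate_mate _).symm
    · exact Or.inl (by rw [← mate_mate f, h, mate_mate])

theorem exists_flag_face (f : T.Tet × Fin 4) : ∃ x : T.Flag, Flag.face x = f :=
  ⟨(f.1, Equiv.swap 3 f.2), by simp [Flag.face]⟩

theorem exists_triangle (t : T.Triangle) : ∃ x : T.Flag, T.triangle x = t := by
  induction t using Quot.ind with
  | mk f =>
    obtain ⟨x, rfl⟩ := exists_flag_face f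
    exact ⟨x, rfl⟩

theorem act_of_face_eq {x y : T.Flag} (h : Flag.face x = Flag.face y) :
    ∃ τ : Equiv.Perm (Fin 4), τ 3 = 3 ∧ x = Flag.act y τ := by
  obtain ⟨k, q⟩ := x
  obtain ⟨k', q'⟩ := y
  simp only [Flag.face, Prod.mk.injEq] at h
  obtain ⟨rfl, h⟩ := h
  exact ⟨q'⁻¹ * q, by simp [h], by simp [Flag.act]⟩

theorem side_glue (x : T.Flag) : T.side (Flag.glue x) = T.side x := by
  symm; exact Quot.sound (Or.inr ⟨Set.mem_univ _, rfl⟩)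

theorem side_flip (x : T.Flag) : T.side (Flag.flip x) = T.side x := by
  symm; exact Quot.sound (Or.inl ⟨Equiv.swap 0 1, by decide, rfl⟩)

theorem corner_glue (x : T.Flag) : T.corner (Flag.glue x) = T.corner x := by
  symm; exact Quot.sound (Or.inr ⟨Set.mem_univ _, rfl⟩)

theorem side_eq {x y : T.Flag} (h : T.side y = T.side x) :
    y = x ∨ y = Flag.glue x ∨ y = Flag.flip x ∨ y = Flag.glue (Flag.flip x) := by
  have hg : ∀ y : T.Flag, (y = x ∨ y = Flag.glue x ∨ y = Flag.flip x ∨ y = Flag.glue (Flag.flip x)) →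
      (Flag.glue y = x ∨ Flag.glue y = Flag.glue x ∨ Flag.glue y = Flag.flip x ∨
        Flag.glue y = Flag.glue (Flag.flip x)) := by
    rintro y (rfl | rfl | rfl | rfl) <;> simp [glue_glue]
  have hf : ∀ y : T.Flag, (y = x ∨ y = Flag.glue x ∨ y = Flag.flip x ∨ y = Flag.glue (Flag.flip x)) →
      (Flag.flip y = x ∨ Flag.flip y = Flag.glue x ∨ Flag.flip y = Flag.flip x ∨
        Flag.flip y = Flag.glue (Flag.flip x)) := by
    rintro y (rfl | rfl | rfl | rfl) <;> simp [flip_flip, flip_glue]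
  refine (Quot.iff_of_eq (fun y => y = x ∨ y = Flag.glue x ∨ y = Flag.flip x ∨
    y = Flag.glue (Flag.flip x)) ?_ h).2 (Or.inl rfl)
  rintro y _ (⟨τ, ⟨h3, h2⟩, rfl⟩ | ⟨-, rfl⟩)
  · have hτ : τ = 1 ∨ τ = Equiv.swap 0 1 := by revert τ; decide
    rcases hτ with rfl | rfl
    · rw [act_one]
    · exact ⟨hf y, fun h => TetGluing.flip_flip y ▸ hf _ h⟩
  · exact ⟨hg y, fun h => by simpa only [glue_glue] using hg _ h⟩

theorem edge_of_orEdge_eq {S : Set T.Triangle} {x y : T.Flag}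
    (h : T.orEdge S x = T.orEdge S y) : T.edge S x = T.edge S y :=
  Quot.eq_of_imp (fun _ _ => Or.imp_left fun ⟨τ, hτ, h⟩ => ⟨τ, Or.inl hτ, h⟩) h

theorem edge_eq_iff {S : Set T.Triangle} {x y : T.Flag} :
    T.edge S x = T.edge S y ↔
      T.orEdge S x = T.orEdge S y ∨ T.orEdge S (Flag.flip x) = T.orEdge S y := by
  refine ⟨fun h => (orEdge_of_edge_eq h).imp (·.1) (·.2), ?_⟩
  rintro (h | h)
  · exact edge_of_orEdge_eq h
  · rw [← edge_of_orEdge_eq h, edge_flip]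

theorem orEdge_mono {S S' : Set T.Triangle} (h : S ⊆ S') {x y : T.Flag}
    (hxy : T.orEdge S x = T.orEdge S y) : T.orEdge S' x = T.orEdge S' y :=
  Quot.eq_of_imp (fun _ _ => Or.imp_right (And.imp_left fun hx => h hx)) hxy

theorem edge_mono {S S' : Set T.Triangle} (h : S ⊆ S') {x y : T.Flag}
    (hxy : T.edge S x = T.edge S y) : T.edge S' x = T.edge S' y :=
  Quot.eq_of_imp (fun _ _ => Or.imp_right (And.imp_left fun hx => h hx)) hxy

theorem edge_of_side_eq {x y : T.Flag} (h : T.side x = T.side y) :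
    T.edge Set.univ x = T.edge Set.univ y := by
  have hτ : ∀ τ : Equiv.Perm (Fin 4), τ 3 = 3 ∧ τ 2 = 2 →
      (τ 0 = 0 ∧ τ 1 = 1) ∨ (τ 0 = 1 ∧ τ 1 = 0) := by decide
  exact Quot.eq_of_imp (fun _ _ => Or.imp_left fun ⟨τ, h, hx⟩ => ⟨τ, hτ τ h, hx⟩) h

theorem edge_glue {S : Set T.Triangle} {x : T.Flag} (h : T.triangle x ∈ S) :
    T.edge S (Flag.glue x) = T.edge S x :=
  edge_of_orEdge_eq (orEdge_glue h)

theorem orEdge_turn (S : Set T.Triangle) (x : T.Flag) :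
    T.orEdge S (Flag.turn x) = T.orEdge S x :=
  orEdge_act x (by decide) (by decide)

theorem edge_turn (S : Set T.Triangle) (x : T.Flag) : T.edge S (Flag.turn x) = T.edge S x :=
  edge_of_orEdge_eq (orEdge_turn S x)

theorem edge_act {S : Set T.Triangle} (x : T.Flag) {τ : Equiv.Perm (Fin 4)}
    (h : (τ 0 = 0 ∧ τ 1 = 1) ∨ (τ 0 = 1 ∧ τ 1 = 0)) :
    T.edge S (Flag.act x τ) = T.edge S x := by
  symm; exact Quot.sound (Or.inl ⟨τ, h, rfl⟩)

theorem vertex_act {S : Set T.Triangle} (x : T.Flag) {τ : Equiv.Perm (Fin 4)} (h : τ 0 = 0) :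
    T.vertex S (Flag.act x τ) = T.vertex S x := by
  symm; exact Quot.sound (Or.inl ⟨τ, h, rfl⟩)

theorem vertex_glue {S : Set T.Triangle} {x : T.Flag} (h : T.triangle x ∈ S) :
    T.vertex S (Flag.glue x) = T.vertex S x := by
  symm; exact Quot.sound (Or.inr ⟨h, rfl⟩)

theorem vertex_rot (S : Set T.Triangle) (x : T.Flag) :
    T.vertex S (Flag.rot x) = T.vertex S (Flag.flip x) := by
  rw [Flag.rot, Flag.flip, ← act_act]
  exact vertex_act _ (by decide)

theorem corner_rot (x : T.Flag) : T.corner (Flag.rot x) = T.corner (Flag.flip x) := by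
  rw [Flag.rot, Flag.flip, ← act_act]
  symm; exact Quot.sound (Or.inl ⟨_, by decide, rfl⟩)

instance [Finite T.Tet] : Finite T.Triangle := inferInstanceAs (Finite (Quot _))
instance [Finite T.Tet] (S : Set T.Triangle) : Finite (T.Vertex S) :=
  inferInstanceAs (Finite (Quot _))
instance [Finite T.Tet] (S : Set T.Triangle) : Finite (T.OrEdge S) :=
  inferInstanceAs (Finite (Quot _))
instance [Finite T.Tet] (S : Set T.Triangle) : Finite (T.Edge S) :=
  inferInstanceAs (Finite (Quot _))
instance [Finite T.Tet] (T0 : Set T.Triangle) : Finite (T.CutSide T0) :=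
  inferInstanceAs (Finite (Quot _))
instance [Finite T.Tet] (T0 : Set T.Triangle) (E : Set (T.Edge Set.univ)) :
    Finite (T.CutEdge T0 E) :=
  inferInstanceAs (Finite (Quot _))
instance [Finite T.Tet] (T0 : Set T.Triangle) (E : Set (T.Edge Set.univ)) :
    Finite (T.CutVertex T0 E) :=
  inferInstanceAs (Finite (Quot _))

end TetGluing

namespace Triangulation3

open TetGluing

variable {T : Triangulation3.{u}}

instance : Finite T.Tet := T.finite_tet
instance : Nonempty T.Tet := T.nonempty_tet

theorem sign_glue (x : T.Flag) : Flag.sign (Flag.glue x) = -Flag.sign x := by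
  simp [Flag.sign, Flag.glue, T.sign_perm]

theorem sign_eq_one_or (x : T.Flag) : Flag.sign x = 1 ∨ Flag.sign x = -1 :=
  Int.units_eq_one_or _

theorem neg_ne_one {a : ℤˣ} (h : a = 1) : -a ≠ 1 := by rw [h]; decide

/-- The tetrahedra around an edge of `T_S` form a chain (or a cycle): a flag whose triangle is on
the boundary is one end of this chain, and there is exactly one other end. -/
theorem exists_other_end {S : Set T.Triangle} {x : T.Flag} (hx : T.triangle x ∉ S) :
    ∃ y : T.Flag, T.triangle y ∉ S ∧ T.orEdge S y = T.orEdge S x ∧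
      Flag.sign y = -Flag.sign x ∧
      ∀ z : T.Flag, T.triangle z ∉ S → T.orEdge S z = T.orEdge S x → z = x ∨ z = y := by
  have h := exists_end_of_involutive (X := T.Flag) (a := Flag.glue) (b := Flag.turn)
    (fun x => glue_glue x) (fun x => turn_turn x) (S := {x | T.triangle x ∈ S})
    (fun x hx => by rw [Set.mem_ofPred_eq, triangle_glue]; exact hx) (x := x) hx
  obtain ⟨m, h1, h2, h3⟩ := h
  refine ⟨_, h1, ?_, ?_, fun z hz hzx => h3 z hz ?_⟩
  · refine Quot.eq_of_imp ?_ h2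
    rintro z z' (rfl | ⟨hz, rfl⟩)
    · exact Or.inl ⟨Equiv.swap 2 3, by decide, rfl⟩
    · exact Or.inr ⟨hz, rfl⟩
  · rw [sign_turn, neg_inj]
    clear h1 h2 h3
    induction m with
    | zero => rfl
    | succ m ih =>
      rw [Function.iterate_succ_apply', Function.comp_apply, sign_glue, sign_turn, neg_neg, ih]
  · refine congrArg (Quot.lift (Quot.mk _) ?_) hzx
    rintro z z' (⟨τ, ⟨h0, h1⟩, rfl⟩ | ⟨hz, rfl⟩)
    · have hτ : τ = 1 ∨ τ = Equiv.swap 2 3 := by revert τ; decide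
      rcases hτ with rfl | rfl
      · rw [act_one]
      · exact Quot.sound (Or.inl rfl)
    · exact Quot.sound (Or.inr ⟨hz, rfl⟩)

theorem glue_ne (x : T.Flag) : Flag.glue x ≠ x :=
  fun h => T.mate_ne (Flag.face x) (by rw [← face_glue, h])

/-- The two copies of a triangle share one of its sides in `T_S` exactly if no other side of a
triangle outside `S` lies on the same edge of `T`: gluing them collapses the triangle. -/
theorem orEdge_eq_glue_iff {S : Set T.Triangle} {x : T.Flag} (hx : T.triangle x ∉ S) :
    T.orEdge S x = T.orEdge S (Flag.glue x) ↔
      ∀ y : T.Flag, T.triangle y ∉ S → T.edge Set.univ y = T.edge Set.univ x →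
        T.side y = T.side x := by
  obtain ⟨y0, hy0, hy0x, hsign, hy0u⟩ := exists_other_end hx
  constructor
  · intro h y hy hyx
    have hends : ∀ z : T.Flag, T.triangle z ∉ S → T.orEdge S z = T.orEdge S x →
        z = x ∨ z = Flag.glue x := by
      have : Flag.glue x = y0 :=
        (hy0u _ (by rwa [triangle_glue]) h.symm).resolve_left (glue_ne x)
      rwa [this]
    have hglue : ∀ z : T.Flag, T.orEdge S z = T.orEdge S x →
        T.orEdge S (Flag.glue z) = T.orEdge S x := by
      intro z hz
      by_cases hzS : T.triangle z ∈ S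
      · rw [orEdge_glue hzS, hz]
      · rcases hends z hzS hz with rfl | rfl
        · exact h.symm
        · rw [glue_glue]
    have huniv : ∀ z : T.Flag, T.orEdge Set.univ z = T.orEdge Set.univ x →
        T.orEdge S z = T.orEdge S x := by
      intro z hz
      refine (Quot.iff_of_eq (fun z => T.orEdge S z = T.orEdge S x) ?_ hz).2 rfl
      rintro z z' (⟨τ, ⟨h0, h1⟩, rfl⟩ | ⟨-, rfl⟩)
      · rw [orEdge_act z h0 h1]
      · exact ⟨hglue z, fun h => by simpa only [glue_glue] using hglue _ h⟩
    rcases edge_eq_iff.1 hyx with hyx | hyx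
    · rcases hends y hy (huniv y hyx) with rfl | rfl
      · rfl
      · exact side_glue x
    · rw [← side_flip]
      rcases hends _ (by rwa [triangle_flip]) (huniv _ hyx) with h | h
      · rw [h]
      · rw [h, side_glue]
  · intro h
    have huniv := orEdge_mono (Set.subset_univ S) hy0x
    have hne := T.edge_nondegenerate x
    rcases side_eq (h y0 hy0 (edge_of_orEdge_eq huniv)) with rfl | rfl | rfl | rfl
    · exact absurd hsign (by rcases sign_eq_one_or y0 with h | h <;> rw [h] <;> decide)
    · exact hy0x.symm
    · exact absurd huniv.symm hne
    · rw [orEdge_glue (Set.mem_univ _)] at huniv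
      exact absurd huniv.symm hne

/-! ### Standard flags -/

/-- A flag is standard if its face is the chosen one among the two faces that form its triangle,
and if it is positively oriented. Each triangle has three standard flags, one for each of its
sides and one for each of its corners. -/
def IsStd (x : T.Flag) : Prop := Flag.face x = Quot.out (T.triangle x) ∧ Flag.sign x = 1

open Classical in
/-- The given flag, moved to the chosen face of its triangle. -/
noncomputable def front (x : T.Flag) : T.Flag :=
  if Flag.face x = Quot.out (T.triangle x) then x else Flag.glue x

theorem out_triangle (x : T.Flag) :
    Quot.out (T.triangle x) = Flag.face x ∨ Quot.out (T.triangle x) = T.mate (Flag.face x) :=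
  eq_or_mate_of_faceTriangle (Quot.out_eq (T.triangle x))

theorem front_eq (x : T.Flag) : front x = x ∨ front x = Flag.glue x := by
  unfold front
  split_ifs
  exacts [Or.inl rfl, Or.inr rfl]

theorem triangle_front (x : T.Flag) : T.triangle (front x) = T.triangle x := by
  rcases front_eq x with h | h <;> rw [h]
  exact triangle_glue x

theorem face_front (x : T.Flag) : Flag.face (front x) = Quot.out (T.triangle x) := by
  unfold front
  split_ifs with h
  · exact h
  · rw [face_glue, (out_triangle x).resolve_left (Ne.symm h)]

theorem front_glue (x : T.Flag) : front (Flag.glue x) = front x := by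
  unfold front
  rw [triangle_glue, face_glue, glue_glue]
  rcases out_triangle x with h | h <;> rw [h]
  · rw [if_neg (T.mate_ne _), if_pos rfl]
  · rw [if_pos rfl, if_neg (T.mate_ne _).symm]

theorem front_act (x : T.Flag) {τ : Equiv.Perm (Fin 4)} (h : τ 3 = 3) :
    front (Flag.act x τ) = Flag.act (front x) τ := by
  unfold front
  rw [triangle_act x h, face_act x h, glue_act x h]
  split_ifs <;> rfl

theorem front_flip (x : T.Flag) : front (Flag.flip x) = Flag.flip (front x) :=
  front_act x swap01_three

theorem IsStd.front {x : T.Flag} (h : IsStd x) : front x = x := if_pos h.1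

theorem IsStd.act {x : T.Flag} (h : IsStd x) {τ : Equiv.Perm (Fin 4)} (h3 : τ 3 = 3)
    (hs : Equiv.Perm.sign τ = 1) : IsStd (Flag.act x τ) := by
  refine ⟨?_, by rw [sign_act, h.2, hs, one_mul]⟩
  rw [face_act x h3, triangle_act x h3, h.1]

theorem IsStd.rot {x : T.Flag} (h : IsStd x) : IsStd (Flag.rot x) :=
  h.act (by decide) (by decide)

open Classical in
/-- The standard flag with the same side. -/
noncomputable def sideFlag (x : T.Flag) : T.Flag :=
  if Flag.sign (front x) = 1 then front x else Flag.flip (front x)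

open Classical in
/-- The standard flag with the same corner. -/
noncomputable def cornerFlag (x : T.Flag) : T.Flag :=
  if Flag.sign (front x) = 1 then front x else Flag.act (front x) (Equiv.swap 1 2)

theorem isStd_of_front {x y : T.Flag} {τ : Equiv.Perm (Fin 4)} (h3 : τ 3 = 3)
    (hy : y = Flag.act (front x) τ) (hs : Flag.sign y = 1) : IsStd y := by
  subst hy
  exact ⟨by rw [face_act _ h3, triangle_act _ h3, face_front, triangle_front], hs⟩

theorem isStd_sideFlag (x : T.Flag) : IsStd (sideFlag x) := by
  unfold sideFlag
  split_ifs with h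
  · exact isStd_of_front rfl (act_one _).symm h
  · refine isStd_of_front swap01_three rfl ?_
    rw [sign_flip, (sign_eq_one_or _).resolve_left h, neg_neg]

theorem isStd_cornerFlag (x : T.Flag) : IsStd (cornerFlag x) := by
  unfold cornerFlag
  split_ifs with h
  · exact isStd_of_front rfl (act_one _).symm h
  · refine isStd_of_front (by decide) rfl ?_
    rw [sign_act, (sign_eq_one_or _).resolve_left h]
    decide

theorem IsStd.sideFlag {x : T.Flag} (h : IsStd x) : sideFlag x = x := by
  unfold Triangulation3.sideFlag
  rw [h.front, if_pos h.2]

theorem IsStd.cornerFlag {x : T.Flag} (h : IsStd x) : cornerFlag x = x := by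
  unfold Triangulation3.cornerFlag
  rw [h.front, if_pos h.2]

theorem side_front (x : T.Flag) : T.side (front x) = T.side x := by
  rcases front_eq x with h | h <;> rw [h]
  exact side_glue x

theorem corner_front (x : T.Flag) : T.corner (front x) = T.corner x := by
  rcases front_eq x with h | h <;> rw [h]
  exact corner_glue x

theorem side_sideFlag (x : T.Flag) : T.side (sideFlag x) = T.side x := by
  unfold sideFlag
  split_ifs
  · exact side_front x
  · rw [side_flip, side_front]

theorem triangle_sideFlag (x : T.Flag) : T.triangle (sideFlag x) = T.triangle x :=
  triangle_of_side_eq (side_sideFlag x)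

theorem triangle_cornerFlag (x : T.Flag) : T.triangle (cornerFlag x) = T.triangle x := by
  unfold cornerFlag
  split_ifs
  · exact triangle_front x
  · rw [triangle_act _ (by decide), triangle_front]

theorem corner_cornerFlag (x : T.Flag) : T.corner (cornerFlag x) = T.corner x := by
  unfold cornerFlag
  split_ifs
  · exact corner_front x
  · rw [← corner_front x]
    symm; exact Quot.sound (Or.inl ⟨Equiv.swap 1 2, by decide, rfl⟩)

theorem sideFlag_eq {x y : T.Flag} (h : T.side x = T.side y) : sideFlag x = sideFlag y := by
  have hf : ∀ x : T.Flag, sideFlag (Flag.flip x) = sideFlag x := by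
    intro x
    unfold sideFlag
    rw [front_flip, sign_flip, TetGluing.flip_flip]
    rcases sign_eq_one_or (front x) with h | h <;> rw [h] <;> simp
  have hg : ∀ x : T.Flag, sideFlag (Flag.glue x) = sideFlag x := by
    intro x
    unfold sideFlag
    rw [front_glue]
  rcases side_eq h with rfl | rfl | rfl | rfl
  · rfl
  · exact hg y
  · exact hf y
  · rw [hg, hf]

theorem cornerFlag_eq {x y : T.Flag} (h : T.corner x = T.corner y) :
    cornerFlag x = cornerFlag y := by
  refine congrArg (Quot.lift cornerFlag ?_) h
  rintro x _ (⟨τ, ⟨h3, h0⟩, rfl⟩ | ⟨-, rfl⟩)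
  · have hτ : τ = 1 ∨ τ = Equiv.swap 1 2 := by revert τ; decide
    rcases hτ with rfl | rfl
    · rw [act_one]
    · unfold cornerFlag
      rw [front_act _ (by decide), sign_act, act_act]
      rcases sign_eq_one_or (front x) with h | h <;> rw [h] <;>
        simp [act_one]
  · unfold cornerFlag
    rw [front_glue]

theorem IsStd.eq_of_side {x y : T.Flag} (hx : IsStd x) (hy : IsStd y)
    (h : T.side x = T.side y) : x = y := by
  rw [← hx.sideFlag, sideFlag_eq h, hy.sideFlag]

end Triangulation3

namespace Triangulation3

open TetGluing

variable {T : Triangulation3.{u}} {T0 : Set T.Triangle}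

/-! ### Counting triangles, sides and edges -/

/-- The standard flags of the triangles outside `T0` whose edge belongs to `X`: they correspond to
the sides of these triangles that lie on an edge in `X`. -/
abbrev StdFlag (T0 : Set T.Triangle) (X : Set (T.Edge Set.univ)) : Type u :=
  {x : T.Flag // IsStd x ∧ T.triangle x ∉ T0 ∧ T.edge Set.univ x ∈ X}

theorem card_triangle : Nat.card T.Tet * 4 = 2 * Nat.card T.Triangle := by
  have h := card_eq_two_mul (faceTriangle (T := T.toTetGluing)) (fun t => Quot.exists_rep t)
    (fun f => ⟨T.mate f, T.mate_ne f, faceTriangle_mate f,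
      fun g hg => eq_or_mate_of_faceTriangle hg⟩)
  simpa using h

theorem card_cutTriangle (h0 : T.IsSpanningTreeOfTets T0) :
    Nat.card (T.CutTriangle T0) = Nat.card T.Tet + 1 := by
  have h1 := T.card_triangle
  have h2 : Nat.card T0 + 1 = Nat.card T.Tet := h0.card_add_one
  have h3 : Nat.card T.Triangle = Nat.card T0 + Nat.card (T.CutTriangle T0) := by
    classical
    rw [← Nat.card_sum]
    exact Nat.card_congr (Equiv.Set.sumCompl T0).symm
  omega

theorem card_boundaryFace :
    Nat.card {f : T.Tet × Fin 4 // faceTriangle f ∉ T0}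
      = 2 * Nat.card (T.CutTriangle T0) := by
  refine card_eq_two_mul (fun f => (⟨faceTriangle f.1, f.2⟩ : T.CutTriangle T0)) ?_ ?_
  · rintro ⟨t, ht⟩
    obtain ⟨f, rfl⟩ := Quot.exists_rep t
    exact ⟨⟨f, ht⟩, rfl⟩
  · rintro ⟨f, hf⟩
    refine ⟨⟨T.mate f, by rwa [faceTriangle_mate]⟩, fun h => T.mate_ne f (congrArg Subtype.val h),
      Subtype.ext (faceTriangle_mate f), ?_⟩
    rintro ⟨g, hg⟩ h
    exact (eq_or_mate_of_faceTriangle (congrArg Subtype.val h)).imp Subtype.ext Subtype.ext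

theorem exists_isStd (t : T.Triangle) : ∃ x : T.Flag, IsStd x ∧ T.triangle x = t := by
  obtain ⟨x, rfl⟩ := exists_triangle t
  exact ⟨sideFlag x, isStd_sideFlag x, triangle_sideFlag x⟩

theorem IsStd.eq_or_of_triangle {x y : T.Flag} (hx : IsStd x) (hy : IsStd y)
    (h : T.triangle y = T.triangle x) :
    y = x ∨ y = Flag.rot x ∨ y = Flag.rot (Flag.rot x) := by
  obtain ⟨τ, h3, rfl⟩ := act_of_face_eq (x := y) (y := x) (by rw [hx.1, hy.1, h])
  have hs : Equiv.Perm.sign τ = 1 := by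
    have := hy.2
    rwa [sign_act, hx.2, one_mul] at this
  have hτ : τ = 1 ∨ τ = Equiv.swap 0 1 * Equiv.swap 1 2 ∨
      τ = Equiv.swap 0 1 * Equiv.swap 1 2 * (Equiv.swap 0 1 * Equiv.swap 1 2) := by
    clear hy h
    revert τ; decide
  rcases hτ with rfl | rfl | rfl
  · exact Or.inl (act_one x)
  · exact Or.inr (Or.inl rfl)
  · exact Or.inr (Or.inr (act_act _ _ _).symm)

theorem rot_ne (x : T.Flag) : Flag.rot x ≠ x := by
  intro h
  have h2 := congrArg Prod.snd h
  simp only [Flag.rot, Flag.act, mul_eq_left] at h2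
  exact absurd h2 (by decide)

theorem card_stdFlag_univ : Nat.card (StdFlag T0 Set.univ) = 3 * Nat.card (T.CutTriangle T0) := by
  choose f hf hft using T.exists_isStd
  let g : T.CutTriangle T0 × Fin 3 → T.Flag := fun p =>
    ![f p.1, Flag.rot (f p.1), Flag.rot (Flag.rot (f p.1))] p.2
  have hg : ∀ p, IsStd (g p) ∧ T.triangle (g p) = p.1 := by
    rintro ⟨t, i⟩
    fin_cases i
    · exact ⟨hf _, hft _⟩
    · exact ⟨(hf _).rot, (triangle_rot _).trans (hft _)⟩
    · exact ⟨(hf _).rot.rot, ((triangle_rot _).trans (triangle_rot _)).trans (hft _)⟩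
  rw [← Nat.card_eq_of_bijective (fun p => (⟨g p, (hg p).1, by rw [(hg p).2]; exact p.1.2,
    Set.mem_univ _⟩ : StdFlag T0 Set.univ)), Nat.card_prod, mul_comm]
  · simp
  · constructor
    · rintro ⟨t, i⟩ ⟨t', j⟩ h
      have h1 : g (t, i) = g (t', j) := congrArg Subtype.val h
      obtain rfl : t = t' := Subtype.ext (by rw [← (hg (t, i)).2, h1, (hg (t', j)).2])
      have e1 := rot_ne (f t)
      have e2 := rot_ne (Flag.rot (f t))
      have e3 : Flag.rot (Flag.rot (f t)) ≠ f t := fun h =>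
        rot_ne (f t) (by conv_rhs => rw [← rot_rot_rot (f t), h])
      fin_cases i <;> fin_cases j <;> simp [g, e1, e2, e3, e1.symm, e2.symm, e3.symm] at h1 ⊢
    · rintro ⟨x, hx, hxt, -⟩
      rcases (hf (T.triangle x)).eq_or_of_triangle hx (hft _).symm with h | h | h
      · exact ⟨(⟨_, hxt⟩, 0), Subtype.ext h.symm⟩
      · exact ⟨(⟨_, hxt⟩, 1), Subtype.ext h.symm⟩
      · exact ⟨(⟨_, hxt⟩, 2), Subtype.ext h.symm⟩

theorem card_stdFlag_add (X : Set (T.Edge Set.univ)) :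
    Nat.card (StdFlag T0 X) + Nat.card (StdFlag T0 Xᶜ) = 3 * Nat.card (T.CutTriangle T0) := by
  classical
  rw [← card_stdFlag_univ, ← Nat.card_sum]
  have e : StdFlag T0 Set.univ ≃ {x : StdFlag T0 Set.univ // T.edge Set.univ x.1 ∈ X} ⊕
      {x : StdFlag T0 Set.univ // T.edge Set.univ x.1 ∉ X} :=
    (Equiv.sumCompl (fun x : StdFlag T0 Set.univ => T.edge Set.univ x.1 ∈ X)).symm
  refine Nat.card_congr (Equiv.trans (Equiv.sumCongr ?_ ?_) e.symm)
  · exact ⟨fun x => ⟨⟨x.1, x.2.1, x.2.2.1, Set.mem_univ _⟩, x.2.2.2⟩,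
      fun x => ⟨x.1.1, x.1.2.1, x.1.2.2.1, x.2⟩, fun _ => rfl, fun _ => rfl⟩
  · exact ⟨fun x => ⟨⟨x.1, x.2.1, x.2.2.1, Set.mem_univ _⟩, x.2.2.2⟩,
      fun x => ⟨x.1.1, x.1.2.1, x.1.2.2.1, x.2⟩, fun _ => rfl, fun _ => rfl⟩

/-- Each boundary edge of `T_S` lies on exactly two boundary triangles. -/
theorem exists_edge_pair {S : Set T.Triangle} {x : T.Flag} (hx : T.triangle x ∉ S)
    (hs : Flag.sign x = 1) :
    ∃ y : T.Flag, y ≠ x ∧ Flag.sign y = 1 ∧ T.triangle y ∉ S ∧ T.edge S y = T.edge S x ∧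
      ∀ z : T.Flag, Flag.sign z = 1 → T.triangle z ∉ S → T.edge S z = T.edge S x →
        z = x ∨ z = y := by
  obtain ⟨y, hy, hyx, hys, hyu⟩ := exists_other_end hx
  have hne : Flag.flip y ≠ x := by
    intro h
    have h1 := orEdge_mono (Set.subset_univ S) hyx
    rw [← h] at h1
    exact T.edge_nondegenerate y h1
  refine ⟨Flag.flip y, hne, by rw [sign_flip, hys, hs, neg_neg], by rwa [triangle_flip],
    by rw [edge_flip, edge_of_orEdge_eq hyx], ?_⟩
  intro z hz hzS hzx
  rcases edge_eq_iff.1 hzx with h | h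
  · refine Or.inl ((hyu z hzS h).resolve_right ?_)
    rintro rfl
    rw [hys] at hz
    exact neg_ne_one hs hz
  · rcases hyu _ (by rwa [triangle_flip]) h with h | h
    · rw [← h, sign_flip] at hs
      exact absurd hs (neg_ne_one hz)
    · exact Or.inr (by rw [← h, TetGluing.flip_flip])

/-! ### The tree of tetrahedra and its boundary -/

/-- A nonempty set of faces, closed under the gluing, of triangles of the tree of tetrahedra has
some tetrahedron on which it has exactly one face. -/
theorem exists_leaf (h0 : T.IsSpanningTreeOfTets T0) {Φ : Set (T.Tet × Fin 4)}
    (hne : Φ.Nonempty) (hm : ∀ f ∈ Φ, T.mate f ∈ Φ)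
    (hT : ∀ f ∈ Φ, faceTriangle f ∈ T0) :
    ∃ f ∈ Φ, ∀ g ∈ Φ, g.1 = f.1 → g = f := by
  classical
  by_contra! hcon
  have := Fintype.ofFinite T.Tet
  let Φ' : Finset (T.Tet × Fin 4) := Φ.toFinset
  have hmem : ∀ f, f ∈ Φ' ↔ f ∈ Φ := fun f => Set.mem_toFinset
  have hlt := h0.card_lt (F' := Φ'.image faceTriangle)
    (W := Φ'.image Prod.fst) (by
      intro t ht
      obtain ⟨f, hf, rfl⟩ := Finset.mem_image.1 (Finset.mem_coe.1 ht)
      exact hT f ((hmem f).1 hf)) (by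
      obtain ⟨f, hf⟩ := hne
      exact ⟨_, Finset.mem_image_of_mem _ ((hmem f).2 hf)⟩) (by
      intro t ht k hk
      obtain ⟨f, hf, rfl⟩ := Finset.mem_image.1 ht
      rw [hmem] at hf
      rcases Sym2.mem_iff.1 hk with rfl | rfl
      · exact Finset.mem_image_of_mem _ ((hmem f).2 hf)
      · exact Finset.mem_image.2 ⟨T.mate f, (hmem _).2 (hm f hf), rfl⟩)
  have h1 := Finset.card_le_mul_card_image (f := faceTriangle) Φ' 2 (by
    intro t ht
    obtain ⟨f, hf, rfl⟩ := Finset.mem_image.1 ht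
    refine (Finset.card_le_card (t := {f, T.mate f}) ?_).trans Finset.card_le_two
    intro g hg
    rw [Finset.mem_filter] at hg
    simpa using eq_or_mate_of_faceTriangle hg.2)
  have h2 := Finset.mul_card_image_le_card (f := Prod.fst) Φ' 2 (by
    intro k hk
    obtain ⟨f, hf, rfl⟩ := Finset.mem_image.1 hk
    obtain ⟨g, hg, hgf, hne⟩ := hcon f ((hmem f).1 hf)
    rw [← Finset.card_pair hne]
    refine Finset.card_le_card ?_
    intro x hx
    rcases Finset.mem_insert.1 hx with rfl | hx
    · exact Finset.mem_filter.2 ⟨(hmem _).2 hg, hgf⟩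
    · rw [Finset.mem_singleton] at hx
      subst hx
      exact Finset.mem_filter.2 ⟨hf, rfl⟩)
  omega

/-- Every edge of the tree of tetrahedra is on its boundary: otherwise each tetrahedron around it
would have two faces in the tree that contain it. -/
theorem exists_boundary_flag (h0 : T.IsSpanningTreeOfTets T0) (x : T.Flag) :
    ∃ y : T.Flag, T.triangle y ∉ T0 ∧ T.orEdge T0 y = T.orEdge T0 x := by
  by_contra! hcon
  have hin : ∀ z : T.Flag, T.orEdge T0 z = T.orEdge T0 x → T.triangle z ∈ T0 :=
    fun z hz => by_contra fun h => hcon z h hz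
  obtain ⟨f, ⟨z, rfl, hz⟩, hu⟩ := exists_leaf h0
    (Φ := {f | ∃ z : T.Flag, Flag.face z = f ∧ T.orEdge T0 z = T.orEdge T0 x})
    ⟨_, x, rfl, rfl⟩
    (by
      rintro _ ⟨z, rfl, hz⟩
      exact ⟨Flag.glue z, rfl, by rw [orEdge_glue (hin z hz), hz]⟩)
    (by
      rintro _ ⟨z, rfl, hz⟩
      exact hin z hz)
  have := congrArg Prod.snd (hu _ ⟨Flag.turn z, rfl, by rw [orEdge_turn, hz]⟩ rfl)
  simp only [Flag.face, Flag.turn, Flag.act, Equiv.Perm.mul_apply, Equiv.swap_apply_right,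
    EmbeddingLike.apply_eq_iff_eq] at this
  exact absurd this (by decide)

/-- The flags of the tree of tetrahedra are connected by the permutations of the vertices of each
tetrahedron and by the gluings along the triangles in `T0`. -/
theorem eq_of_invariant (h0 : T.IsSpanningTreeOfTets T0) {α : Type*} (f : T.Flag → α)
    (h1 : ∀ x, f (Flag.flip x) = f x) (h2 : ∀ x, f (Flag.act x (Equiv.swap 1 2)) = f x)
    (h3 : ∀ x, f (Flag.turn x) = f x) (h4 : ∀ x, T.triangle x ∈ T0 → f (Flag.glue x) = f x)
    (x y : T.Flag) : f x = f y := by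
  have hact : ∀ (τ : Equiv.Perm (Fin 4)) (x : T.Flag), f (Flag.act x τ) = f x := by
    intro τ
    have hτ : τ ∈ Submonoid.closure
        (Set.range fun i : Fin 3 => Equiv.swap i.castSucc i.succ) := by
      rw [Equiv.Perm.mclosure_swap_castSucc_succ]
      trivial
    induction hτ using Submonoid.closure_induction with
    | mem τ hτ =>
      obtain ⟨i, rfl⟩ := hτ
      fin_cases i
      exacts [h1, h2, h3]
    | one => intro x; rw [act_one]
    | mul σ τ _ _ hσ hτ => intro x; rw [← act_act, hτ, hσ]
  have hperm : ∀ (k : T.Tet) (q q' : Equiv.Perm (Fin 4)), f (k, q) = f (k, q') := by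
    intro k q q'
    have := hact (q'⁻¹ * q) (k, q')
    rwa [Flag.act, mul_inv_cancel_left] at this
  have htet : ∀ k k' : T.Tet, f (k, 1) = f (k', 1) := by
    refine h0.eq_of_forall (fun k => f (k, 1)) ?_
    intro t ht k k' hk
    obtain ⟨x, rfl⟩ := exists_triangle t
    have hx := h4 x ht
    obtain ⟨k0, q⟩ := x
    have hk : s(k0, T.adj k0 (q 3)) = s(k, k') := hk
    rw [hperm k0 q 1, Flag.glue, hperm _ _ 1] at hx
    rcases Sym2.eq_iff.1 hk with ⟨rfl, rfl⟩ | ⟨rfl, rfl⟩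
    · exact hx.symm
    · exact hx
  obtain ⟨k, q⟩ := x
  obtain ⟨k', q'⟩ := y
  rw [hperm k q 1, hperm k' q' 1, htet]

/-- The boundary of the tree of tetrahedra is connected through its edges. -/
theorem eq_of_boundary (h0 : T.IsSpanningTreeOfTets T0) {α : Type*} (H : T.Edge T0 → α)
    (hH : ∀ x, T.triangle x ∉ T0 → H (T.edge T0 (Flag.rot x)) = H (T.edge T0 x)) (x y : T.Flag) :
    H (T.edge T0 x) = H (T.edge T0 y) := by
  -- it is enough that `H` is constant on the sides of the interior triangles too; a tetrahedron
  -- with only one face that violates this cannot exist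
  have hrot : ∀ x, H (T.edge T0 (Flag.rot x)) = H (T.edge T0 x) := by
    by_contra! hcon
    obtain ⟨x0, hx0⟩ := hcon
    have hin : ∀ x, H (T.edge T0 (Flag.rot x)) ≠ H (T.edge T0 x) → T.triangle x ∈ T0 :=
      fun x hx => by_contra fun h => hx (hH x h)
    obtain ⟨f, ⟨z, rfl, hz⟩, hu⟩ := exists_leaf h0
      (Φ := {f | ∃ z : T.Flag, Flag.face z = f ∧ H (T.edge T0 (Flag.rot z)) ≠ H (T.edge T0 z)})
      ⟨_, x0, rfl, hx0⟩
      (by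
        rintro _ ⟨z, rfl, hz⟩
        have hzT := hin z hz
        refine ⟨Flag.glue z, rfl, ?_⟩
        rwa [rot_glue, edge_glue (by rwa [triangle_rot]), edge_glue hzT])
      (by
        rintro _ ⟨z, rfl, hz⟩
        exact hin z hz)
    have hgood : ∀ σ : Equiv.Perm (Fin 4), σ 3 ≠ 3 →
        H (T.edge T0 (Flag.rot (Flag.act z σ))) = H (T.edge T0 (Flag.act z σ)) := by
      intro σ hσ
      by_contra h
      have := congrArg Prod.snd (hu _ ⟨Flag.act z σ, rfl, h⟩ rfl)
      simp only [Flag.face, Flag.act, Equiv.Perm.mul_apply,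
        EmbeddingLike.apply_eq_iff_eq] at this
      exact hσ this
    -- the faces opposite to the vertices `z 2` and `z 0` link the edges of the face of `z`
    have e1 : ∀ σ τ : Equiv.Perm (Fin 4),
        (σ 0 = τ 0 ∧ σ 1 = τ 1) ∨ (σ 0 = τ 1 ∧ σ 1 = τ 0) →
        T.edge T0 (Flag.act z σ) = T.edge T0 (Flag.act z τ) := by
      intro σ τ h
      rw [← edge_act (Flag.act z τ) (τ := τ⁻¹ * σ), act_act, mul_inv_cancel_left]
      simpa [Equiv.Perm.inv_eq_iff_eq, Equiv.symm_apply_eq] using h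
    have g1 := hgood (Equiv.swap 2 3) (by decide)
    have g2 := hgood (Equiv.swap 0 1 * Equiv.swap 1 2 * Equiv.swap 2 3) (by decide)
    have g3 := hgood (Equiv.swap 0 1 * Equiv.swap 1 2 * Equiv.swap 2 3 *
      (Equiv.swap 0 1 * Equiv.swap 1 2)) (by decide)
    simp only [Flag.rot, act_act] at g1 g2 g3 hz
    rw [← act_one z, act_act] at hz
    apply hz
    rw [e1 (1 * _) (Equiv.swap 0 1 * Equiv.swap 1 2 * Equiv.swap 2 3) (by decide), ← g2, ← g3,
      e1 _ (Equiv.swap 2 3 * (Equiv.swap 0 1 * Equiv.swap 1 2)) (by decide), g1,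
      e1 _ 1 (by decide)]
  refine eq_of_invariant h0 (fun x => H (T.edge T0 x)) ?_ ?_ ?_ ?_ x y
  · intro x; rw [edge_flip]
  · intro x
    have h : T.edge T0 (Flag.act x (Equiv.swap 1 2)) = T.edge T0 (Flag.rot (Flag.rot x)) := by
      simp only [Flag.rot, act_act]
      rw [← edge_act (Flag.act x (Equiv.swap 1 2)) (τ := Equiv.swap 0 1) (by decide), act_act]
      congr 2
      decide
    show H (T.edge T0 (Flag.act x (Equiv.swap 1 2))) = _
    rw [h, hrot, hrot]
  · intro x; rw [edge_turn]
  · intro x hx; rw [edge_glue hx]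

/-- Gluing tetrahedra along a tree identifies three pairs of vertices for each triangle, which leaves
at least `4 (n - 1) - 3 (n - 2) = n + 2` vertices, where `n` is the number of triangles outside
`T0`. -/
theorem card_cutTriangle_add_two_le (h0 : T.IsSpanningTreeOfTets T0) :
    Nat.card (T.CutTriangle T0) + 2 ≤ Nat.card (T.Vertex T0) := by
  have h2 : Nat.card T0 + 1 = Nat.card T.Tet := h0.card_add_one
  have h := card_le_card_add_card_of_factor (X := T.Tet × Fin 4) (ι := T0 × Fin 3)
    (Q := T.Vertex T0) (fun p => T.vertex T0 (p.1, Equiv.swap 0 p.2))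
    (fun i => ((Quot.out i.1.1).1, (Quot.out i.1.1).2.succAbove i.2))
    (fun i => (T.adj (Quot.out i.1.1).1 (Quot.out i.1.1).2,
      T.perm (Quot.out i.1.1).1 (Quot.out i.1.1).2 ((Quot.out i.1.1).2.succAbove i.2))) (by
    intro ψ hψ
    have hout : ∀ t ∈ T0, ∀ j ≠ (Quot.out t).2, ψ ((Quot.out t).1, j) =
        ψ (T.adj (Quot.out t).1 (Quot.out t).2, T.perm (Quot.out t).1 (Quot.out t).2 j) := by
      intro t ht j hj
      obtain ⟨i, rfl⟩ := Fin.exists_succAbove_eq hj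
      exact hψ (⟨t, ht⟩, i)
    have hglue : ∀ x : T.Flag, T.triangle x ∈ T0 →
        ψ (x.1, x.2 0) = ψ (T.adj x.1 (x.2 3), T.perm x.1 (x.2 3) (x.2 0)) := by
      have hstd : ∀ x : T.Flag, T.triangle x ∈ T0 → Flag.face x = Quot.out (T.triangle x) →
          ψ (x.1, x.2 0) = ψ (T.adj x.1 (x.2 3), T.perm x.1 (x.2 3) (x.2 0)) := by
        intro x hx h
        have := hout _ hx (x.2 0)
        rw [← h] at this
        exact this (by simp [Flag.face])
      intro x hx
      rcases out_triangle x with h | h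
      · exact hstd x hx h.symm
      · have := hstd (Flag.glue x) (by rwa [triangle_glue]) (by rw [triangle_glue, h, face_glue])
        rw [← Equiv.Perm.mul_apply] at this
        have hgg := glue_glue x
        have h1 := congrArg Prod.fst hgg
        have h2 := congrArg Prod.snd hgg
        simp only [Flag.glue] at h1 h2 this
        rw [h1, h2] at this
        exact this.symm
    refine ⟨Quot.lift (fun x => ψ (x.1, x.2 0)) ?_, fun p => ?_⟩
    · rintro x _ (⟨τ, h, rfl⟩ | ⟨hx, rfl⟩)
      · have h : τ 0 = 0 := h
        simp [Flag.act, h]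
      · exact hglue x hx
    · simp [vertex])
  simp only [Nat.card_prod, Nat.card_fin] at h
  rw [card_cutTriangle h0]
  omega

/-- The edge of the closed complex that contains a given edge of `T_S`. -/
def toEdge (S : Set T.Triangle) : T.Edge S → T.Edge Set.univ :=
  Quot.lift (T.edge Set.univ) fun _ _ h =>
    edge_mono (Set.subset_univ S) (Quot.sound h : T.edge S _ = T.edge S _)

theorem toEdge_edge (S : Set T.Triangle) (x : T.Flag) :
    toEdge S (T.edge S x) = T.edge Set.univ x := rfl

theorem exists_flag_of_edge (h0 : T.IsSpanningTreeOfTets T0) (e : T.Edge T0) :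
    ∃ x : T.Flag, Flag.sign x = 1 ∧ T.triangle x ∉ T0 ∧ T.edge T0 x = e := by
  obtain ⟨x, rfl⟩ := Quot.exists_rep e
  obtain ⟨y, hy, hyx⟩ := exists_boundary_flag h0 x
  rcases sign_eq_one_or y with h | h
  · exact ⟨y, h, hy, edge_of_orEdge_eq hyx⟩
  · exact ⟨Flag.flip y, by rw [sign_flip, h, neg_neg], by rwa [triangle_flip],
      (edge_flip _ _).trans (edge_of_orEdge_eq hyx)⟩

/-- An edge of `T` on which `m` sides of triangles outside `T0` lie corresponds to `m` edges of the
tree of tetrahedra. -/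
theorem card_preimage_toEdge (h0 : T.IsSpanningTreeOfTets T0) (X : Set (T.Edge Set.univ)) :
    Nat.card (toEdge T0 ⁻¹' X) = Nat.card (StdFlag T0 X) := by
  let B := {x : T.Flag // Flag.sign x = 1 ∧ T.triangle x ∉ T0 ∧ T.edge Set.univ x ∈ X}
  have h1 : Nat.card B = 2 * Nat.card (toEdge T0 ⁻¹' X) := by
    refine card_eq_two_mul (fun x : B => (⟨T.edge T0 x.1, x.2.2.2⟩ : toEdge T0 ⁻¹' X)) ?_ ?_
    · rintro ⟨e, he⟩
      obtain ⟨x, hs, hx, rfl⟩ := exists_flag_of_edge h0 e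
      exact ⟨⟨x, hs, hx, he⟩, rfl⟩
    · rintro ⟨x, hs, hx, hX⟩
      obtain ⟨y, hne, hys, hy, hyx, hu⟩ := exists_edge_pair hx hs
      refine ⟨⟨y, hys, hy, ?_⟩, fun h => hne (congrArg Subtype.val h), Subtype.ext hyx, ?_⟩
      · rwa [← edge_mono (Set.subset_univ _) hyx] at hX
      · rintro ⟨z, hzs, hz, hzX⟩ h
        exact (hu z hzs hz (congrArg Subtype.val h)).imp Subtype.ext Subtype.ext
  have h2 : Nat.card B = 2 * Nat.card (StdFlag T0 X) := by
    refine card_eq_two_mul (fun x : B => (⟨sideFlag x.1, isStd_sideFlag _,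
      by rw [triangle_sideFlag]; exact x.2.2.1,
      by rw [edge_of_side_eq (side_sideFlag _)]; exact x.2.2.2⟩ : StdFlag T0 X)) ?_ ?_
    · rintro ⟨x, hs, hx⟩
      exact ⟨⟨x, hs.2, hx⟩, Subtype.ext hs.sideFlag⟩
    · rintro ⟨x, hs, hx, hX⟩
      have hside : T.side (Flag.glue (Flag.flip x)) = T.side x := by rw [side_glue, side_flip]
      refine ⟨⟨Flag.glue (Flag.flip x), by rw [sign_glue, sign_flip, hs, neg_neg],
        by rwa [triangle_of_side_eq hside], by rwa [edge_of_side_eq hside]⟩, ?_,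
        Subtype.ext (sideFlag_eq hside), ?_⟩
      · intro h
        have h : Flag.glue (Flag.flip x) = x := congrArg Subtype.val h
        have h' := T.orEdge_glue (S := Set.univ) (x := Flag.flip x) (Set.mem_univ _)
        rw [h] at h'
        exact T.edge_nondegenerate x h'
      · rintro ⟨z, hzs, hz, hzX⟩ h
        have h : sideFlag z = sideFlag x := congrArg Subtype.val h
        have h : T.side z = T.side x := by rw [← side_sideFlag, h, side_sideFlag]
        rcases side_eq h with rfl | rfl | rfl | rfl
        · exact Or.inl rfl
        · rw [sign_glue] at hzs; exact absurd hzs (neg_ne_one hs)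
        · rw [sign_flip] at hzs; exact absurd hzs (neg_ne_one hs)
        · exact Or.inr rfl
  omega

end Triangulation3

namespace Triangulation3

open TetGluing

variable {T : Triangulation3.{u}} {T0 : Set T.Triangle} {E : Set (T.Edge Set.univ)}

/-! ### Chains and cochains modulo 2 -/

/-- A sum over orbits of length three, on each of which `h` is constant and `g` has sum zero. -/
theorem sum_mul_eq_zero_of_rot {X : Type*} {r : X → X} (hr : ∀ x, r (r (r x)) = x) {A : Finset X}
    (hA : ∀ x ∈ A, r x ∈ A) {h g : X → ZMod 2} (hh : ∀ x ∈ A, h (r x) = h x)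
    (hg : ∀ x ∈ A, g x + g (r x) + g (r (r x)) = 0) : ∑ x ∈ A, h x * g x = 0 := by
  have hshift : ∀ f : X → ZMod 2, ∑ x ∈ A, f (r x) = ∑ x ∈ A, f x := fun f =>
    Finset.sum_nbij' r (fun x => r (r x)) hA (fun x hx => hA _ (hA x hx)) (fun x _ => hr x)
      (fun x _ => hr x) (fun _ _ => rfl)
  have h1 : ∑ x ∈ A, h x * g (r x) = ∑ x ∈ A, h x * g x := by
    rw [← hshift (fun x => h x * g x)]
    exact Finset.sum_congr rfl fun x hx => by rw [hh x hx]
  have h2 : ∑ x ∈ A, h x * g (r (r x)) = ∑ x ∈ A, h x * g x := by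
    rw [← h1, ← hshift (fun x => h x * g (r x))]
    exact Finset.sum_congr rfl fun x hx => by rw [hh x hx]
  have h3 : ∑ x ∈ A, h x * g x + ∑ x ∈ A, h x * g (r x) + ∑ x ∈ A, h x * g (r (r x)) = 0 := by
    rw [← Finset.sum_add_distrib, ← Finset.sum_add_distrib]
    exact Finset.sum_eq_zero fun x hx => by rw [← mul_add, ← mul_add, hg x hx, mul_zero]
  rw [h1, h2] at h3
  generalize ∑ x ∈ A, h x * g x = a at h3
  revert a; decide

/-- The positively oriented flags on the boundary of `T_S`. -/
noncomputable def positiveBoundary (S : Set T.Triangle) : Finset T.Flag :=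
  (Set.toFinite {x : T.Flag | Flag.sign x = 1 ∧ T.triangle x ∉ S}).toFinset

theorem mem_positiveBoundary {S : Set T.Triangle} {x : T.Flag} :
    x ∈ positiveBoundary S ↔ Flag.sign x = 1 ∧ T.triangle x ∉ S :=
  Set.Finite.mem_toFinset _

open Classical in
/-- The coefficient of each edge in the boundary of a chain of boundary triangles of `T_S`, the
chain being given by the coefficient of the face of each flag. -/
noncomputable def edgeSum (S : Set T.Triangle) :
    (T.Flag → ZMod 2) →ₗ[ZMod 2] (T.Edge S → ZMod 2) where
  toFun h e := ∑ x ∈ positiveBoundary S with T.edge S x = e, h x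
  map_add' h h' := by ext e; simp [Finset.sum_add_distrib]
  map_smul' c h := by ext e; simp [Finset.mul_sum]

theorem exists_edgeSum_eq {S : Set T.Triangle} {x : T.Flag} (hs : Flag.sign x = 1)
    (hx : T.triangle x ∉ S) :
    ∃ y : T.Flag, Flag.sign y = 1 ∧ T.triangle y ∉ S ∧ T.edge S y = T.edge S x ∧
      (∀ h : T.Flag → ZMod 2, edgeSum S h (T.edge S x) = h x + h y) ∧
      ∀ z : T.Flag, Flag.sign z = 1 → T.triangle z ∉ S → T.edge S z = T.edge S x →
        z = x ∨ z = y := by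
  classical
  obtain ⟨y, hne, hys, hy, hyx, hu⟩ := exists_edge_pair hx hs
  refine ⟨y, hys, hy, hyx, fun h => ?_, hu⟩
  rw [← Finset.sum_pair hne.symm]
  refine Finset.sum_congr ?_ fun _ _ => rfl
  ext z
  simp only [Finset.mem_filter, mem_positiveBoundary, Finset.mem_insert, Finset.mem_singleton]
  refine ⟨fun hz => hu z hz.1.1 hz.1.2 hz.2, ?_⟩
  rintro (rfl | rfl)
  exacts [⟨⟨hs, hx⟩, rfl⟩, ⟨⟨hys, hy⟩, hyx⟩]

theorem sum_mul_edge {S : Set T.Triangle} [Fintype (T.Edge S)] (h : T.Flag → ZMod 2)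
    (g : T.Edge S → ZMod 2) :
    ∑ x ∈ positiveBoundary S, h x * g (T.edge S x) = ∑ e, edgeSum S h e * g e := by
  classical
  rw [← Finset.sum_fiberwise (positiveBoundary S) (T.edge S)]
  refine Finset.sum_congr rfl fun e _ => ?_
  simp only [edgeSum, LinearMap.coe_mk, AddHom.coe_mk, Finset.sum_mul]
  refine Finset.sum_congr (by congr) fun x hx => ?_
  rw [(Finset.mem_filter.1 hx).2]

/-- The boundary of a chain of triangles is orthogonal to the cochains that vanish on the boundary
of each triangle. -/
theorem sum_edgeSum_mul {S : Set T.Triangle} [Fintype (T.Edge S)] {h : T.Flag → ZMod 2}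
    (hh : ∀ x, h (Flag.rot x) = h x) {g : T.Edge S → ZMod 2}
    (hg : ∀ x : T.Flag, T.triangle x ∉ S → g (T.edge S x) + g (T.edge S (Flag.rot x)) +
      g (T.edge S (Flag.rot (Flag.rot x))) = 0) :
    ∑ e, edgeSum S h e * g e = 0 := by
  rw [← sum_mul_edge]
  refine sum_mul_eq_zero_of_rot (g := fun x => g (T.edge S x)) rot_rot_rot ?_
    (fun x _ => hh x) ?_
  · intro x hx
    rw [mem_positiveBoundary] at hx ⊢
    rwa [sign_rot, triangle_rot]
  · intro x hx
    exact hg x (mem_positiveBoundary.1 hx).2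

theorem edgeGraph_eq (S : Set T.Triangle) : ∃ ends : T.Edge S → Sym2 (T.Vertex S),
    T.edgeGraph S = Graph.ofEnds ends ∧
      ∀ x, ends (T.edge S x) = s(T.vertex S x, T.vertex S (Flag.flip x)) :=
  ⟨_, rfl, fun _ => rfl⟩

theorem cutEdgeGraph_eq (T0 : Set T.Triangle) (E : Set (T.Edge Set.univ)) :
    ∃ ends : T.CutEdge T0 E → Sym2 (T.CutVertex T0 E),
      T.cutEdgeGraph T0 E = Graph.ofEnds ends ∧ ∀ x, ends (T.cutEdge T0 E x)
        = s(T.cutVertex T0 E x, T.cutVertex T0 E (CutFlag.flip x)) :=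
  ⟨_, rfl, fun _ => rfl⟩

/-- The side of a triangle of `T^{T0}` that contains a flag. -/
def cutSide (x : T.CutFlag T0) : T.CutSide T0 := Quot.mk _ x

theorem incidenceGraph_eq (T0 : Set T.Triangle) (E : Set (T.Edge Set.univ)) :
    ∃ ends : T.CutSide T0 → Sym2 (T.CutTriangle T0 ⊕ T.CutEdge T0 E),
      T.incidenceGraph T0 E = Graph.ofEnds ends ∧ ∀ x : T.CutFlag T0, ends (cutSide x)
        = s(Sum.inl ⟨T.triangle x.1, x.2⟩, Sum.inr (T.cutEdge T0 E x)) :=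
  ⟨_, rfl, fun _ => rfl⟩

/-- The coboundary of a function on three vertices vanishes on the boundary of their triangle. -/
theorem closed_of_add {V : Type*} (φ : V → ZMod 2) (a b c : V) :
    φ a + φ b + (φ b + φ c) + (φ c + φ a) = 0 := by
  generalize φ a = x
  generalize φ b = y
  generalize φ c = z
  revert x y z; decide

/-! ### The 2-complex cut along a set of edges -/

theorem cutEdge_eq_iff {x y : T.CutFlag T0} : T.cutEdge T0 E x = T.cutEdge T0 E y ↔
    T.side x.1 = T.side y.1 ∨
      (T.edge Set.univ x.1 ∉ E ∧ T.edge Set.univ x.1 = T.edge Set.univ y.1) := by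
  refine ⟨fun h => ?_, fun h => Quot.sound h⟩
  refine (Quot.iff_of_eq (fun z : T.CutFlag T0 => T.side x.1 = T.side z.1 ∨
    (T.edge Set.univ x.1 ∉ E ∧ T.edge Set.univ x.1 = T.edge Set.univ z.1)) ?_ h).1 (Or.inl rfl)
  rintro a b (hab | ⟨ha, hab⟩)
  · rw [hab, edge_of_side_eq hab]
  · constructor
    · rintro (h | ⟨h1, h2⟩)
      · have := edge_of_side_eq h
        exact Or.inr ⟨by rwa [this], this.trans hab⟩
      · exact Or.inr ⟨h1, h2.trans hab⟩
    · rintro (h | ⟨h1, h2⟩)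
      · have := (edge_of_side_eq h).trans hab.symm
        exact Or.inr ⟨by rwa [this], this⟩
      · exact Or.inr ⟨h1, h2.trans hab.symm⟩

theorem cutSide_eq_iff {x y : T.CutFlag T0} :
    cutSide x = cutSide y ↔ T.side x.1 = T.side y.1 := by
  refine ⟨fun h => ?_, fun h => Quot.sound h⟩
  exact congrArg (Quot.lift (fun x : T.CutFlag T0 => T.side x.1) fun _ _ h => h) h

theorem edge_of_cutEdge_eq {x y : T.CutFlag T0} (h : T.cutEdge T0 E x = T.cutEdge T0 E y) :
    T.edge Set.univ x.1 = T.edge Set.univ y.1 :=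
  (cutEdge_eq_iff.1 h).elim edge_of_side_eq (·.2)

theorem mem_cut_iff {x : T.CutFlag T0} :
    T.cutEdge T0 E x ∈ T.cut T0 E ↔ T.edge Set.univ x.1 ∈ E := by
  refine ⟨?_, fun h => ⟨x, h, rfl⟩⟩
  rintro ⟨y, hy, h⟩
  rwa [← edge_of_cutEdge_eq h]

theorem card_cutSide : Nat.card (T.CutSide T0) = 3 * Nat.card (T.CutTriangle T0) := by
  rw [← card_stdFlag_univ]
  symm
  refine Nat.card_eq_of_bijective
    (fun x : StdFlag T0 Set.univ => (cutSide ⟨x.1, x.2.2.1⟩ : T.CutSide T0)) ⟨?_, ?_⟩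
  · rintro ⟨x, hx, hx'⟩ ⟨y, hy, hy'⟩ h
    exact Subtype.ext (hx.eq_of_side hy (cutSide_eq_iff.1 h))
  · intro c
    obtain ⟨⟨x, hx⟩, rfl⟩ := Quot.exists_rep c
    exact ⟨⟨sideFlag x, isStd_sideFlag x, by rwa [triangle_sideFlag], Set.mem_univ _⟩,
      cutSide_eq_iff.2 (side_sideFlag x)⟩

theorem card_cut : Nat.card (T.cut T0 E) = Nat.card (StdFlag T0 E) := by
  symm
  refine Nat.card_eq_of_bijective (fun x : StdFlag T0 E =>
    (⟨T.cutEdge T0 E ⟨x.1, x.2.2.1⟩, _, x.2.2.2, rfl⟩ : T.cut T0 E)) ⟨?_, ?_⟩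
  · rintro ⟨x, hx, hxT, hxE⟩ ⟨y, hy, hy'⟩ h
    refine Subtype.ext (hx.eq_of_side hy ?_)
    exact (cutEdge_eq_iff.1 (congrArg Subtype.val h)).resolve_right fun h => h.1 hxE
  · rintro ⟨_, ⟨x, hx⟩, hxE, rfl⟩
    refine ⟨⟨sideFlag x, isStd_sideFlag x, by rwa [triangle_sideFlag],
      by rwa [edge_of_side_eq (side_sideFlag x)]⟩, Subtype.ext ?_⟩
    exact cutEdge_eq_iff.2 (Or.inl (side_sideFlag x))

theorem card_cutEdge : Nat.card (T.CutEdge T0 E)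
    = Nat.card (T.cut T0 E) + Nat.card ↥(T.cut T0 E)ᶜ := by
  classical
  rw [← Nat.card_sum]
  exact Nat.card_congr (Equiv.Set.sumCompl (T.cut T0 E)).symm

/-- The triangles outside `T0` are connected through the edges outside `E`. -/
def DualConnected (T0 : Set T.Triangle) (E : Set (T.Edge Set.univ)) : Prop :=
  ∀ h : T.CutTriangle T0 → ZMod 2,
    (∀ x y : T.CutFlag T0, T.edge Set.univ x.1 ∉ E → T.edge Set.univ x.1 = T.edge Set.univ y.1 →
      h ⟨T.triangle x.1, x.2⟩ = h ⟨T.triangle y.1, y.2⟩) → ∀ t t', h t = h t'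

theorem dualConnected_of_isTree (hD : (T.incidenceGraph T0 E).IsTree) : DualConnected T0 E := by
  intro h hh t t'
  let φ : T.CutTriangle T0 ⊕ T.CutEdge T0 E → ZMod 2 :=
    Sum.elim h (Quot.lift (fun x : T.CutFlag T0 => h ⟨T.triangle x.1, x.2⟩) (by
      rintro x y (hxy | ⟨hE, hxy⟩)
      · congr 2
        exact triangle_of_side_eq hxy
      · exact hh x y hE hxy))
  refine hD.eq_of_forall φ ?_ (Sum.inl t) (Sum.inl t')
  intro l _ u v huv
  obtain ⟨x, rfl⟩ := Quot.exists_rep l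
  rcases Sym2.eq_iff.1 huv with ⟨rfl, rfl⟩ | ⟨rfl, rfl⟩ <;> rfl

theorem exists_cutFlag (t : T.CutTriangle T0) :
    ∃ x : T.CutFlag T0, (⟨T.triangle x.1, x.2⟩ : T.CutTriangle T0) = t := by
  obtain ⟨t, ht⟩ := t
  obtain ⟨x, rfl⟩ := exists_triangle t
  exact ⟨⟨x, ht⟩, rfl⟩

theorem DualConnected.eq_of_link (hD : DualConnected T0 E)
    {ends : T.CutSide T0 → Sym2 (T.CutTriangle T0 ⊕ T.CutEdge T0 E)}
    (hends : ∀ x : T.CutFlag T0, ends (cutSide x)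
        = s(Sum.inl ⟨T.triangle x.1, x.2⟩, Sum.inr (T.cutEdge T0 E x)))
    (φ : T.CutTriangle T0 ⊕ T.CutEdge T0 E → ZMod 2)
    (hφ : ∀ l ∈ Set.univ, ∀ u v, ends l = s(u, v) → φ u = φ v) (u v) : φ u = φ v := by
  have hlink : ∀ x : T.CutFlag T0,
      φ (Sum.inl ⟨T.triangle x.1, x.2⟩) = φ (Sum.inr (T.cutEdge T0 E x)) :=
    fun x => hφ _ trivial _ _ (hends x)
  have hconst := hD (fun t => φ (Sum.inl t)) (by
    intro x y hE hxy
    show φ (Sum.inl _) = φ (Sum.inl _)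
    rw [hlink x, hlink y, cutEdge_eq_iff.2 (Or.inr ⟨hE, hxy⟩)])
  have hall : ∀ u, ∃ t, φ u = φ (Sum.inl t) := by
    rintro (t | c)
    · exact ⟨t, rfl⟩
    · obtain ⟨x, rfl⟩ := Quot.exists_rep c
      exact ⟨_, (hlink x).symm⟩
  obtain ⟨t, ht⟩ := hall u
  obtain ⟨t', ht'⟩ := hall v
  rw [ht, ht']
  exact hconst t t'

theorem DualConnected.card_le (hD : DualConnected T0 E) :
    Nat.card (T.CutTriangle T0) + Nat.card (T.CutEdge T0 E)
      ≤ 3 * Nat.card (T.CutTriangle T0) + 1 := by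
  obtain ⟨ends, -, hends⟩ := incidenceGraph_eq T0 E
  have h := Graph.card_le_of_connected (F := Set.univ) (hD.eq_of_link hends)
  rwa [Nat.card_sum, Nat.card_congr (Equiv.Set.univ _), card_cutSide] at h

theorem DualConnected.isTree (hD : DualConnected T0 E) [Nonempty (T.CutTriangle T0)]
    (hc : 3 * Nat.card (T.CutTriangle T0) + 1
      ≤ Nat.card (T.CutTriangle T0) + Nat.card (T.CutEdge T0 E)) :
    (T.incidenceGraph T0 E).IsTree := by
  obtain ⟨ends, hG, hends⟩ := incidenceGraph_eq T0 E
  rw [Graph.IsTree, hG, Graph.edgeSet_ofEnds]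
  refine Graph.isSpanningTree_of_connected ?_ (hD.eq_of_link hends)
  rwa [Nat.card_sum, Nat.card_congr (Equiv.Set.univ _), card_cutSide]

theorem card_of_isTree (hD : (T.incidenceGraph T0 E).IsTree) :
    3 * Nat.card (T.CutTriangle T0) + 1
      = Nat.card (T.CutTriangle T0) + Nat.card (T.CutEdge T0 E) := by
  obtain ⟨ends, hG, hends⟩ := incidenceGraph_eq T0 E
  rw [Graph.IsTree, hG, Graph.edgeSet_ofEnds] at hD
  have := hD.card_add_one
  rwa [Nat.card_sum, Nat.card_congr (Equiv.Set.univ _), card_cutSide] at this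

/-- Each side on an edge outside `E` identifies two corners of its triangle with the ends of this
edge; no other identifications of corners are made in `T^{T0}_E`. -/
theorem card_cutVertex : 3 * Nat.card (T.CutTriangle T0) + 2 * Nat.card ↥(T.cut T0 E)ᶜ
    ≤ Nat.card (T.CutVertex T0 E) + 2 * Nat.card (StdFlag T0 Eᶜ) := by
  -- the oriented edges outside `E`
  let O : Type u := {o : T.OrEdge Set.univ // ∃ y : T.CutFlag T0,
    T.edge Set.univ y.1 ∉ E ∧ T.orEdge Set.univ y.1 = o}
  have hO : 2 * Nat.card ↥(T.cut T0 E)ᶜ ≤ Nat.card O := by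
    have hout : ∀ c : ↥(T.cut T0 E)ᶜ, T.cutEdge T0 E (Quot.out c.1) = c.1 :=
      fun c => Quot.out_eq c.1
    have hE : ∀ c : ↥(T.cut T0 E)ᶜ, T.edge Set.univ (Quot.out c.1).1 ∉ E := by
      intro c hc
      apply c.2
      rw [← hout c]
      exact mem_cut_iff.2 hc
    have hinj : ∀ c c' : ↥(T.cut T0 E)ᶜ, T.edge Set.univ (Quot.out c.1).1 =
        T.edge Set.univ (Quot.out c'.1).1 → c = c' := by
      intro c c' h
      apply Subtype.ext
      rw [← hout c, ← hout c']
      exact cutEdge_eq_iff.2 (Or.inr ⟨hE c, h⟩)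
    rw [mul_comm, show 2 = Nat.card Bool by simp, ← Nat.card_prod]
    refine Nat.card_le_card_of_injective (fun p : ↥(T.cut T0 E)ᶜ × Bool =>
      (⟨T.orEdge Set.univ (bif p.2 then Quot.out p.1.1 else CutFlag.flip (Quot.out p.1.1)).1,
        _, by
          rcases p with ⟨c, _ | _⟩
          · show T.edge Set.univ (Flag.flip _) ∉ E
            rw [edge_flip]
            exact hE c
          · exact hE c, rfl⟩ : O)) ?_
    rintro ⟨c, b⟩ ⟨c', b'⟩ h
    have h := congrArg Subtype.val h
    have hcc : c = c' := by
      apply hinj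
      have h := edge_of_orEdge_eq h
      rcases b with _ | _ <;> rcases b' with _ | _ <;>
        simpa [CutFlag.flip, edge_flip] using h
    subst hcc
    have hne := T.edge_nondegenerate (Quot.out c.1).1
    rcases b with _ | _ <;> rcases b' with _ | _
    · rfl
    · exact absurd h.symm hne
    · exact absurd h hne
    · rfl
  have hX := card_le_card_add_card_of_factor (X := StdFlag T0 Set.univ ⊕ O)
    (Q := T.CutVertex T0 E) (ι := StdFlag T0 Eᶜ ⊕ StdFlag T0 Eᶜ)
    (Sum.elim (fun x => T.cutVertex T0 E ⟨x.1, x.2.2.1⟩) fun o => T.cutVertex T0 E o.2.choose)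
    (Sum.elim (fun x => Sum.inl ⟨x.1, x.2.1, x.2.2.1, trivial⟩)
      fun x => Sum.inl ⟨Flag.rot x.1, x.2.1.rot, by rw [triangle_rot]; exact x.2.2.1, trivial⟩)
    (Sum.elim (fun x => Sum.inr ⟨T.orEdge Set.univ x.1, ⟨x.1, x.2.2.1⟩, x.2.2.2, rfl⟩)
      fun x => Sum.inr ⟨T.orEdge Set.univ (Flag.flip x.1), CutFlag.flip ⟨x.1, x.2.2.1⟩,
        by show T.edge Set.univ (Flag.flip x.1) ∉ E; rw [edge_flip]; exact x.2.2.2, rfl⟩)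
    (by
      intro ψ hψ
      have h1 : ∀ x : StdFlag T0 Eᶜ, ψ (Sum.inl ⟨x.1, x.2.1, x.2.2.1, trivial⟩) =
          ψ (Sum.inr ⟨T.orEdge Set.univ x.1, ⟨x.1, x.2.2.1⟩, x.2.2.2, rfl⟩) :=
        fun x => hψ (Sum.inl x)
      have h2 : ∀ x : StdFlag T0 Eᶜ,
          ψ (Sum.inl ⟨Flag.rot x.1, x.2.1.rot, by rw [triangle_rot]; exact x.2.2.1, trivial⟩) =
          ψ (Sum.inr ⟨T.orEdge Set.univ (Flag.flip x.1), CutFlag.flip ⟨x.1, x.2.2.1⟩,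
            by show T.edge Set.univ (Flag.flip x.1) ∉ E; rw [edge_flip]; exact x.2.2.2, rfl⟩) :=
        fun x => hψ (Sum.inr x)
      have hedge : ∀ (y : T.CutFlag T0) (hy : T.edge Set.univ y.1 ∉ E),
          ψ (Sum.inl ⟨cornerFlag y.1, isStd_cornerFlag _,
            by rw [triangle_cornerFlag]; exact y.2, trivial⟩) =
          ψ (Sum.inr ⟨T.orEdge Set.univ y.1, y, hy, rfl⟩) := by
        rintro ⟨y, hyT⟩ hy
        have hp := isStd_sideFlag y
        have hpT : T.triangle (sideFlag y) ∉ T0 := by rwa [triangle_sideFlag]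
        have hpE : T.edge Set.univ (sideFlag y) ∈ Eᶜ := by
          rw [edge_of_side_eq (side_sideFlag y)]; exact hy
        have h1 := h1 ⟨sideFlag y, hp, hpT, hpE⟩
        have h2 := h2 ⟨sideFlag y, hp, hpT, hpE⟩
        have hc1 : cornerFlag (sideFlag y) = sideFlag y := hp.cornerFlag
        have hc2 : cornerFlag (Flag.flip (sideFlag y)) = Flag.rot (sideFlag y) := by
          rw [cornerFlag_eq (corner_rot _).symm, hp.rot.cornerFlag]
        have hcg : ∀ z : T.Flag, cornerFlag (Flag.glue z) = cornerFlag z :=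
          fun z => cornerFlag_eq (corner_glue z)
        have hog : ∀ z : T.Flag, T.orEdge Set.univ (Flag.glue z) = T.orEdge Set.univ z :=
          fun z => orEdge_glue (Set.mem_univ _)
        rcases side_eq (side_sideFlag y).symm with h | h | h | h
        · convert h1 using 4
          · exact (congrArg cornerFlag h).trans hc1
          · exact congrArg _ h
        · convert h1 using 4
          · exact ((congrArg cornerFlag h).trans (hcg _)).trans hc1
          · exact (congrArg _ h).trans (hog _)
        · convert h2 using 4
          · exact (congrArg cornerFlag h).trans hc2
          · exact congrArg _ h
        · convert h2 using 4
          · exact ((congrArg cornerFlag h).trans (hcg _)).trans hc2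
          · exact (congrArg _ h).trans (hog _)
      refine ⟨Quot.lift (fun y : T.CutFlag T0 => ψ (Sum.inl ⟨cornerFlag y.1, isStd_cornerFlag _,
            by rw [triangle_cornerFlag]; exact y.2, trivial⟩)) ?_, ?_⟩
      · rintro y z (h | ⟨hE, h⟩)
        · simp only [cornerFlag_eq h]
        · have hE' : T.edge Set.univ z.1 ∉ E := by rwa [← edge_of_orEdge_eq h]
          simp only [hedge y hE, hedge z hE', h]
      · rintro (x | o)
        · show ψ _ = ψ _
          congr 2
          exact Subtype.ext x.2.1.cornerFlag.symm
        · have := hedge o.2.choose o.2.choose_spec.1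
          refine Eq.trans ?_ this.symm
          congr 2
          exact Subtype.ext o.2.choose_spec.2.symm)
  rw [Nat.card_sum, Nat.card_sum, card_stdFlag_univ] at hX
  omega

end Triangulation3

namespace Triangulation3

open TetGluing

variable {T : Triangulation3.{u}} {T0 : Set T.Triangle} {E : Set (T.Edge Set.univ)}

/-! ### Local constructions as collapses -/

theorem side_rot_ne (x : T.Flag) : T.side (Flag.rot x) ≠ T.side x := by
  intro h
  have hs := sign_rot x
  have h1 : ∀ a : ℤˣ, -a ≠ a := by decide
  rcases side_eq h with h | h | h | h
  · exact rot_ne x h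
  · rw [h, sign_glue] at hs
    exact h1 _ hs
  · rw [h, sign_flip] at hs
    exact h1 _ hs
  · have hf := congrArg Flag.face h
    rw [face_glue, Flag.rot, Flag.flip, face_act _ (by decide), face_act _ (by decide)] at hf
    exact T.mate_ne _ hf.symm

namespace LocalConstruction

variable (L : LocalConstruction T0)

theorem triangle_flag_notMem (s : Fin L.n) : T.triangle (L.flag s) ∉ T0 := by
  have : T.triangle (L.flag s) ∈ T0ᶜ := by rw [← L.range_triangle]; exact ⟨s, rfl⟩
  exact this

theorem exists_step {t : T.Triangle} (ht : t ∉ T0) : ∃ s, T.triangle (L.flag s) = t := by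
  have : t ∈ Set.range (fun s => T.triangle (L.flag s)) := by rw [L.range_triangle]; exact ht
  exact this

theorem step_notMem_glued {s r : Fin L.n} (h : s ≤ r) : T.triangle (L.flag r) ∉ L.glued s := by
  rintro (h0 | ⟨q, hq, hqr⟩)
  · exact L.triangle_flag_notMem r h0
  · have := L.triangle_injective hqr
    omega

theorem card_eq : L.n = Nat.card (T.CutTriangle T0) := by
  rw [← Nat.card_fin L.n]
  refine Nat.card_eq_of_bijective (fun s => (⟨T.triangle (L.flag s), L.triangle_flag_notMem s⟩ :
    T.CutTriangle T0)) ⟨fun s r h => L.triangle_injective (congrArg Subtype.val h), ?_⟩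
  rintro ⟨t, ht⟩
  obtain ⟨s, hs⟩ := L.exists_step ht
  exact ⟨s, Subtype.ext hs⟩

/-- The chosen edge of a step is free: all other sides on it belong to triangles formed before. -/
theorem lt_of_edge_eq {s r : Fin L.n} {y : T.Flag} (hy : T.triangle y = T.triangle (L.flag r))
    (he : T.edge Set.univ y = T.edge Set.univ (L.flag s))
    (hne : T.side y ≠ T.side (L.flag s)) : r < s := by
  by_contra! h
  refine hne ((orEdge_eq_glue_iff (L.step_notMem_glued le_rfl)).1 (L.shared s) y ?_ he)
  rw [hy]
  exact L.step_notMem_glued h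

theorem edge_injective : Function.Injective fun s => T.edge Set.univ (L.flag s) := by
  intro s r h
  by_contra hne
  have hside : T.side (L.flag r) ≠ T.side (L.flag s) :=
    fun h => hne (L.triangle_injective (triangle_of_side_eq h)).symm
  exact lt_asymm (L.lt_of_edge_eq rfl h hside.symm) (L.lt_of_edge_eq rfl h.symm hside)

/-- A cochain that vanishes outside the chosen edges and is closed on each triangle is zero, since
it can be computed backwards along the construction. -/
theorem eq_zero_of_closed (hE : L.critical ⊆ E) (g : T.Flag → ZMod 2)
    (hg : ∀ x, T.triangle x ∉ T0 → T.edge Set.univ x ∈ E → g x = 0)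
    (hgg : ∀ x y, T.triangle x ∉ T0 → T.triangle y ∉ T0 → T.edge Set.univ x ∉ E →
      T.edge Set.univ x = T.edge Set.univ y → g x = g y)
    (hc : ∀ s, g (L.flag s) + g (Flag.rot (L.flag s)) + g (Flag.rot (Flag.rot (L.flag s))) = 0)
    {x : T.Flag} (hx : T.triangle x ∉ T0) : g x = 0 := by
  have hred : ∀ x, T.triangle x ∉ T0 → T.edge Set.univ x ∈ E ∨
      ∃ r, T.edge Set.univ x = T.edge Set.univ (L.flag r) ∧ g x = g (L.flag r) := by
    intro x hx
    by_cases hxE : T.edge Set.univ x ∈ E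
    · exact Or.inl hxE
    · have hcrit : T.edge Set.univ x ∉ L.critical := fun h => hxE (hE h)
      simp only [critical, Set.mem_ofPred_eq, not_forall, not_not] at hcrit
      obtain ⟨r, hr⟩ := hcrit
      exact Or.inr ⟨r, hr.symm, hgg _ _ hx (L.triangle_flag_notMem r) hxE hr.symm⟩
  have hstep : ∀ s, g (L.flag s) = 0 := by
    intro s
    induction s using WellFoundedGT.induction with
    | ind s ih =>
      have hother : ∀ y, T.triangle y = T.triangle (L.flag s) → T.side y ≠ T.side (L.flag s) →
          g y = 0 := by
        intro y hy hne
        have hyT : T.triangle y ∉ T0 := by rw [hy]; exact L.triangle_flag_notMem s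
        rcases hred y hyT with h | ⟨r, hr, hgr⟩
        · exact hg y hyT h
        · rw [hgr]
          refine ih r (L.lt_of_edge_eq hy hr fun h => hne ?_)
          rw [h, L.triangle_injective ((triangle_of_side_eq h).symm.trans hy)]
      have h := hc s
      rw [hother (Flag.rot (L.flag s)) (triangle_rot _) (side_rot_ne _),
        hother (Flag.rot (Flag.rot (L.flag s))) (by rw [triangle_rot, triangle_rot]), add_zero,
        add_zero] at h
      · exact h
      · intro h
        have := side_rot_ne (Flag.rot (Flag.rot (L.flag s)))
        rw [rot_rot_rot, h] at this
        exact this rfl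
  rcases hred x hx with h | ⟨r, -, h⟩
  · exact hg x hx h
  · rw [h, hstep]

theorem card_compl_critical : Nat.card ↥(L.critical)ᶜ = L.n := by
  rw [← Nat.card_fin L.n]
  symm
  refine Nat.card_eq_of_bijective (fun s => (⟨T.edge Set.univ (L.flag s), fun h => h s rfl⟩ :
    ↥(L.critical)ᶜ)) ⟨fun s r h => L.edge_injective (congrArg Subtype.val h), ?_⟩
  rintro ⟨e, he⟩
  simp only [critical, Set.mem_compl_iff, Set.mem_ofPred_eq, not_forall, not_not] at he
  obtain ⟨s, hs⟩ := he
  exact ⟨s, Subtype.ext hs⟩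

/-- The closedness on the triangles is a triangular system of equations for the values on the chosen
edges, so that any values on the critical edges extend to a closed cochain. -/
theorem exists_closed_extension (g0 : T.Edge Set.univ → ZMod 2) :
    ∃ g : T.Edge Set.univ → ZMod 2, (∀ e ∈ L.critical, g e = g0 e) ∧
      ∀ s, g (T.edge Set.univ (L.flag s)) + g (T.edge Set.univ (Flag.rot (L.flag s))) +
        g (T.edge Set.univ (Flag.rot (Flag.rot (L.flag s)))) = 0 := by
  classical
  have := Fintype.ofFinite ↥(L.critical)ᶜ
  let D : (T.Edge Set.univ → ZMod 2) →ₗ[ZMod 2] (Fin L.n → ZMod 2) :=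
    LinearMap.funLeft _ _ (fun s => T.edge Set.univ (L.flag s)) +
    LinearMap.funLeft _ _ (fun s => T.edge Set.univ (Flag.rot (L.flag s))) +
    LinearMap.funLeft _ _ (fun s => T.edge Set.univ (Flag.rot (Flag.rot (L.flag s))))
  let ext : (↥(L.critical)ᶜ → ZMod 2) →ₗ[ZMod 2] (T.Edge Set.univ → ZMod 2) :=
    Function.ExtendByZero.linearMap (ZMod 2) Subtype.val
  have hext : ∀ g, ∀ e ∈ L.critical, ext g e = 0 := by
    intro g e he
    refine Function.extend_apply' _ _ _ ?_
    rintro ⟨a, rfl⟩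
    exact a.2 he
  have hinj : Function.Injective (D ∘ₗ ext) := by
    rw [← LinearMap.ker_eq_bot, LinearMap.ker_eq_bot']
    intro g hg
    have h0 := fun x hx => L.eq_zero_of_closed subset_rfl (fun x => ext g (T.edge Set.univ x))
      (fun x _ h => hext g _ h) (fun x y _ _ _ h => by rw [h]) (fun s => congrFun hg s)
      (x := x) hx
    ext ⟨e, he⟩
    have he' := he
    simp only [critical, Set.mem_compl_iff, Set.mem_ofPred_eq, not_forall, not_not] at he'
    obtain ⟨s, rfl⟩ := he'
    have := h0 _ (L.triangle_flag_notMem s)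
    simp only [ext, Function.ExtendByZero.linearMap_apply] at this
    rwa [Subtype.val_injective.extend_apply g _ (⟨_, he⟩ : ↥(L.critical)ᶜ)] at this
  have hsurj : Function.Surjective (D ∘ₗ ext) := by
    rw [← LinearMap.injective_iff_surjective_of_finrank_eq_finrank]
    · exact hinj
    · rw [Module.finrank_fintype_fun_eq_card, Module.finrank_fintype_fun_eq_card,
        ← Nat.card_eq_fintype_card, L.card_compl_critical, Fintype.card_fin]
  obtain ⟨g1, hg1⟩ := hsurj (D g0)
  refine ⟨g0 + ext g1, fun e he => by simp [hext g1 e he], fun s => ?_⟩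
  have h : D (g0 + ext g1) s = 0 := by
    rw [map_add, ← LinearMap.comp_apply, hg1]
    exact zmod_two_add_eq_zero.2 rfl
  exact h

/-! ### Avoided sets of edges -/

/-- An avoided set of edges is the preimage of a set of edges of `T`. -/
theorem Avoids.exists_eq_preimage {L : LocalConstruction T0} {E0 : Set (T.Edge T0)}
    (h : L.Avoids E0) : ∃ E : Set (T.Edge Set.univ), E0 = toEdge T0 ⁻¹' E ∧
      ∀ s, T.edge Set.univ (L.flag s) ∉ E := by
  -- if the identifications made in `S` respect `E0`, then so do all identifications in `T_S`
  have key : ∀ S : Set T.Triangle, (∀ z, T.triangle z ∈ S → T.triangle z ∉ T0 →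
      (T.edge T0 z ∈ E0 ↔ T.edge T0 (Flag.glue z) ∈ E0)) →
      ∀ x y, T.edge S x = T.edge S y → (T.edge T0 x ∈ E0 ↔ T.edge T0 y ∈ E0) := by
    intro S hS x y hxy
    refine Quot.iff_of_eq (fun z => T.edge T0 z ∈ E0) ?_ hxy
    rintro z z' (⟨τ, hτ, rfl⟩ | ⟨hz, rfl⟩)
    · rw [edge_act z hτ]
    · by_cases hz0 : T.triangle z ∈ T0
      · rw [edge_glue hz0]
      · exact hS z hz hz0
  have himage : ∀ s, (∀ z, T.triangle z ∈ L.glued s → T.triangle z ∉ T0 →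
      (T.edge T0 z ∈ E0 ↔ T.edge T0 (Flag.glue z) ∈ E0)) →
      ∀ y, T.edge (L.glued s) y ∈ L.image E0 s ↔ T.edge T0 y ∈ E0 := by
    intro s hs y
    constructor
    · rintro ⟨x, hx, hxy⟩
      exact (key _ hs x y hxy).1 hx
    · exact fun hy => ⟨y, hy, rfl⟩
  have hglue : ∀ s : Fin L.n, ∀ y, T.triangle y = T.triangle (L.flag s) →
      (T.edge T0 y ∈ E0 ↔ T.edge T0 (Flag.glue y) ∈ E0) := by
    intro s
    induction s using WellFoundedLT.induction with
    | ind s ih =>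
      have hs := himage s (by
        rintro z (hz | ⟨r, hr, hrz⟩) hz0
        · exact absurd hz hz0
        · exact ih r hr z hrz.symm)
      have hface : ∀ y, Flag.face y = Flag.face (L.flag s) →
          (T.edge T0 y ∈ E0 ↔ T.edge T0 (Flag.glue y) ∈ E0) := by
        intro y hy
        rw [← hs, ← hs]
        exact (h s).2 y hy
      intro y hy
      rcases eq_or_mate_of_faceTriangle hy with hf | hf
      · exact hface y hf
      · have := hface (Flag.glue y) (by rw [face_glue, hf, mate_mate])
        rw [glue_glue] at this
        exact this.symm
  have hall : ∀ z, T.triangle z ∉ T0 →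
      (T.edge T0 z ∈ E0 ↔ T.edge T0 (Flag.glue z) ∈ E0) := by
    intro z hz
    obtain ⟨s, hs⟩ := L.exists_step hz
    exact hglue s z hs.symm
  have hsat := key Set.univ fun z _ => hall z
  have hiff : ∀ x, T.edge T0 x ∈ E0 ↔ T.edge Set.univ x ∈ toEdge T0 '' E0 := by
    intro x
    refine ⟨fun hx => ⟨_, hx, rfl⟩, ?_⟩
    rintro ⟨e, he, hex⟩
    obtain ⟨y, rfl⟩ := Quot.exists_rep e
    exact (hsat y x hex).1 he
  refine ⟨toEdge T0 '' E0, ?_, fun s hs => ?_⟩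
  · ext e
    obtain ⟨x, rfl⟩ := Quot.exists_rep e
    exact hiff x
  · refine (h s).1 ((himage s (fun z _ => hall z) _).2 ((hiff _).2 hs))

/-- Since the preimage of `E` has the image of `E` in each intermediate complex, only the chosen edges
matter. -/
theorem avoids_preimage (hE : ∀ s, T.edge Set.univ (L.flag s) ∉ E) :
    L.Avoids (toEdge T0 ⁻¹' E) := by
  have himage : ∀ s y, T.edge (L.glued s) y ∈ L.image (toEdge T0 ⁻¹' E) s ↔
      T.edge Set.univ y ∈ E := by
    intro s y
    constructor
    · rintro ⟨x, hx, hxy⟩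
      rw [← edge_mono (Set.subset_univ _) hxy]
      exact hx
    · exact fun hy => ⟨y, hy, rfl⟩
  intro s
  rw [himage]
  refine ⟨hE s, fun y _ => ?_⟩
  rw [himage, himage, edge_glue (Set.mem_univ _)]

end LocalConstruction

/-! ### Duality on the boundary of the tree of tetrahedra -/

/-- If the edges over `E` form a forest on the boundary of the tree of tetrahedra, the complement
of `E` connects all triangles: a chain of triangles whose boundary is supported on a forest has
boundary zero. -/
theorem dualConnected_of_isSpanningTree (h0 : T.IsSpanningTreeOfTets T0)
    (hE : (T.edgeGraph T0).IsSpanningTree (toEdge T0 ⁻¹' E)) : DualConnected T0 E := by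
  classical
  have := Fintype.ofFinite (T.Edge T0)
  obtain ⟨ends, hG, hends⟩ := T.edgeGraph_eq T0
  rw [hG] at hE
  intro h hh
  let h' : T.Flag → ZMod 2 := fun x =>
    if hx : T.triangle x ∉ T0 then h ⟨T.triangle x, hx⟩ else 0
  have hh' : ∀ x y, T.triangle x = T.triangle y → h' x = h' y := by
    intro x y hxy
    simp only [h', hxy]
  have hpair : ∀ x y, T.triangle x ∉ T0 → T.triangle y ∉ T0 → T.edge Set.univ x ∉ E →
      T.edge T0 x = T.edge T0 y → h' x = h' y := by
    intro x y hx hy hxE hxy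
    simp only [h', dif_pos hx, dif_pos hy]
    exact hh ⟨x, hx⟩ ⟨y, hy⟩ hxE (edge_mono (Set.subset_univ _) hxy)
  have hsum : edgeSum T0 h' = 0 := by
    have hnot : ∀ e, e ∉ toEdge T0 ⁻¹' E → edgeSum T0 h' e = 0 := by
      intro e he
      obtain ⟨x, hs, hx, rfl⟩ := exists_flag_of_edge h0 e
      obtain ⟨y, -, hy, hyx, hsum, -⟩ := exists_edgeSum_eq hs hx
      rw [hsum, zmod_two_add_eq_zero]
      exact hpair x y hx hy he hyx.symm
    ext e
    by_cases he : e ∈ toEdge T0 ⁻¹' E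
    · obtain ⟨φ, h1, h2⟩ := hE.exists_coboundary he
      have hz := sum_edgeSum_mul (S := T0) (h := h') (g := Graph.coboundary ends φ)
        (fun x => hh' _ _ (triangle_rot x)) (by
          intro x _
          rw [Graph.coboundary_apply (hends _), Graph.coboundary_apply (hends _),
            Graph.coboundary_apply (hends _), ← vertex_rot, ← vertex_rot, ← vertex_rot,
            rot_rot_rot]
          exact closed_of_add φ _ _ _)
      rw [Finset.sum_eq_single e] at hz
      · simpa [h1] using hz
      · intro e' _ hne
        by_cases he' : e' ∈ toEdge T0 ⁻¹' E
        · rw [h2 e' he' hne, mul_zero]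
        · rw [hnot e' he', zero_mul]
      · simp
    · exact hnot e he
  have hpair' : ∀ x y, T.triangle x ∉ T0 → T.triangle y ∉ T0 → Flag.sign x = 1 →
      Flag.sign y = 1 → T.edge T0 x = T.edge T0 y → h' x = h' y := by
    intro x y hx hy hxs hys hxy
    obtain ⟨z, -, hz, hzx, hxz, hu⟩ := exists_edgeSum_eq hxs hx
    rcases hu y hys hy hxy.symm with rfl | rfl
    · rfl
    · rw [← zmod_two_add_eq_zero, ← hxz, hsum]
      rfl
  -- one of the two faces on each edge; both have the same coefficient
  choose rep hrs hrT hre using exists_flag_of_edge h0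
  have hH : ∀ x, T.triangle x ∉ T0 → h' (rep (T.edge T0 x)) = h' x := by
    intro x hx
    rcases sign_eq_one_or x with hs | hs
    · exact hpair' _ _ (hrT _) hx (hrs _) hs (hre _)
    · rw [← hh' (Flag.flip x) x (triangle_flip x)]
      refine hpair' _ _ (hrT _) (by rwa [triangle_flip]) (hrs _)
        (by rw [sign_flip, hs, neg_neg]) ?_
      rw [hre, edge_flip]
  have hconst := eq_of_boundary h0 (fun e => h' (rep e)) (by
    intro x hx
    rw [hH x hx, hH _ (by rwa [triangle_rot])]
    exact hh' _ _ (triangle_rot x))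
  have hval : ∀ t : T.CutTriangle T0, ∃ x, T.triangle x ∉ T0 ∧ h t = h' x := by
    intro t
    obtain ⟨x, rfl⟩ := exists_cutFlag t
    exact ⟨x.1, x.2, by simp only [h', dif_pos x.2]⟩
  intro t t'
  obtain ⟨x, hx, hxt⟩ := hval t
  obtain ⟨y, hy, hyt⟩ := hval t'
  rw [hxt, hyt, ← hH x hx, ← hH y hy]
  exact hconst x y

/-- Gluing the boundary of the tree of tetrahedra along a local construction connects the two
copies of each triangle through edges that are not over `E`, so that the edges not over `E` connect
the whole boundary; they are too few to do so with a cycle. Hence a cochain that is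
closed on the boundary triangles is determined by its values on the edges over `E`. -/
theorem LocalConstruction.eq_zero_of_closed_boundary (h0 : T.IsSpanningTreeOfTets T0)
    (L : LocalConstruction T0) (hLE : ∀ s, T.edge Set.univ (L.flag s) ∉ E)
    (hD : DualConnected T0 E)
    (hc : Nat.card (StdFlag T0 Eᶜ) + 1 ≤ 2 * Nat.card (T.CutTriangle T0))
    (g : T.Edge T0 → ZMod 2) (hgE : ∀ e ∈ toEdge T0 ⁻¹' E, g e = 0)
    (hg : ∀ x : T.Flag, T.triangle x ∉ T0 → g (T.edge T0 x) + g (T.edge T0 (Flag.rot x)) +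
      g (T.edge T0 (Flag.rot (Flag.rot x))) = 0) (e : T.Edge T0) : g e = 0 := by
  classical
  have := Fintype.ofFinite (T.Edge T0)
  let B := {f : T.Tet × Fin 4 // faceTriangle f ∉ T0}
  let ext : (B → ZMod 2) →ₗ[ZMod 2] (T.Flag → ZMod 2) :=
    LinearMap.funLeft _ _ Flag.face ∘ₗ Function.ExtendByZero.linearMap (ZMod 2) Subtype.val
  have hext : ∀ (h : B → ZMod 2) (x : T.Flag) (hx : T.triangle x ∉ T0),
      ext h x = h ⟨Flag.face x, hx⟩ := fun h x hx =>
    Subtype.val_injective.extend_apply h _ (⟨Flag.face x, hx⟩ : B)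
  have hface : ∀ (h : B → ZMod 2) (x y : T.Flag), Flag.face x = Flag.face y →
      ext h x = ext h y := by
    intro h x y hxy
    show Function.extend _ _ _ (Flag.face x) = Function.extend _ _ _ (Flag.face y)
    rw [hxy]
  let f : (B → ZMod 2) →ₗ[ZMod 2] (↥(toEdge T0 ⁻¹' Eᶜ) → ZMod 2) :=
    LinearMap.funLeft _ _ Subtype.val ∘ₗ edgeSum T0 ∘ₗ ext
  have hker : ∀ h, f h = 0 → ∀ a b, h a = h b := by
    intro h hh
    set h' := ext h with hh'
    have hface : ∀ x y, Flag.face x = Flag.face y → h' x = h' y := hface h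
    have hflip : ∀ x, h' (Flag.flip x) = h' x := fun x => hface _ _ (face_act x swap01_three)
    -- the two faces on an edge of the tree of tetrahedra
    have hpair : ∀ x y, T.triangle x ∉ T0 → T.triangle y ∉ T0 → T.edge Set.univ x ∉ E →
        T.edge T0 x = T.edge T0 y → h' x = h' y := by
      have hpos : ∀ x y, T.triangle x ∉ T0 → T.triangle y ∉ T0 → Flag.sign x = 1 →
          Flag.sign y = 1 → T.edge Set.univ x ∉ E → T.edge T0 x = T.edge T0 y → h' x = h' y := by
        intro x y hx hy hxs hys hxE hxy
        obtain ⟨z, -, hz, hzx, hxz, hu⟩ := exists_edgeSum_eq hxs hx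
        rcases hu y hys hy hxy.symm with rfl | rfl
        · rfl
        · rw [← zmod_two_add_eq_zero, ← hxz]
          exact congrFun hh ⟨T.edge T0 x, hxE⟩
      have hposflag : ∀ x, T.triangle x ∉ T0 → ∃ x', T.triangle x' ∉ T0 ∧ Flag.sign x' = 1 ∧
          (∀ S, T.edge S x' = T.edge S x) ∧ h' x' = h' x := by
        intro x hx
        rcases sign_eq_one_or x with hs | hs
        · exact ⟨x, hx, hs, fun _ => rfl, rfl⟩
        · exact ⟨Flag.flip x, by rwa [triangle_flip], by rw [sign_flip, hs, neg_neg],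
            fun S => edge_flip S x, hflip x⟩
      intro x y hx hy hxE hxy
      obtain ⟨x', hx', hxs, hxe, hxh⟩ := hposflag x hx
      obtain ⟨y', hy', hys, hye, hyh⟩ := hposflag y hy
      rw [← hxh, ← hyh]
      exact hpos x' y' hx' hy' hxs hys (by rwa [hxe]) (by rw [hxe, hye, hxy])
    -- the faces on an edge of `T_S`, if the two copies of each triangle in `S` have equal values
    have key : ∀ S : Set T.Triangle, (∀ z, T.triangle z ∈ S → T.triangle z ∉ T0 →
        h' (Flag.glue z) = h' z) → ∀ x y, T.triangle x ∉ T0 → T.triangle y ∉ T0 →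
        T.edge Set.univ x ∉ E → T.orEdge S x = T.orEdge S y → h' x = h' y := by
      choose rep hrT hre using exists_boundary_flag h0
      intro S hS x y hx hy hxE hxy
      have hH : ∀ z, T.triangle z ∉ T0 → T.edge Set.univ z ∉ E → h' (rep z) = h' z := by
        intro z hz hzE
        exact (hpair _ _ hz (hrT z) hzE (edge_of_orEdge_eq (hre z)).symm).symm
      have hC := (Quot.iff_of_eq
        (fun z => T.edge Set.univ z ∉ E → h' (rep z) = h' (rep x)) ?_ hxy).1 (fun _ => rfl)
      · have hyE : T.edge Set.univ y ∉ E := by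
          rwa [← edge_mono (Set.subset_univ S) (edge_of_orEdge_eq hxy)]
        rw [← hH x hx hxE, ← hC hyE, hH y hy hyE]
      · rintro z z' hstep
        have hzz : T.edge Set.univ z = T.edge Set.univ z' :=
          edge_mono (Set.subset_univ S) (edge_of_orEdge_eq (Quot.sound hstep))
        rw [← hzz]
        refine forall_congr' fun hzE => ?_
        suffices h' (rep z) = h' (rep z') by rw [this]
        have hrz : T.edge Set.univ (rep z) ∉ E := by
          rwa [edge_mono (Set.subset_univ T0) (edge_of_orEdge_eq (hre z))]
        by_cases ho : T.orEdge T0 z = T.orEdge T0 z'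
        · refine hpair _ _ (hrT z) (hrT z') hrz (edge_of_orEdge_eq ?_)
          rw [hre, hre, ho]
        · rcases hstep with ⟨τ, ⟨h1, h2⟩, rfl⟩ | ⟨hz, rfl⟩
          · exact absurd (orEdge_act z h1 h2).symm ho
          · by_cases hz0 : T.triangle z ∈ T0
            · exact absurd (orEdge_glue hz0).symm ho
            · rw [hH z hz0 hzE, hH _ (by rwa [triangle_glue]) (by rwa [← hzz]), hS z hz hz0]
    have hstep : ∀ s, ∀ y, T.triangle y = T.triangle (L.flag s) →
        h' (Flag.glue y) = h' y := by
      intro s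
      induction s using WellFoundedLT.induction with
      | ind s ih =>
        have hs := key (L.glued s) (by
            rintro z (hz | ⟨r, hr, hrz⟩) hz0
            · exact absurd hz hz0
            · exact ih r hr z hrz.symm) _ _ (L.triangle_flag_notMem s)
          (by rw [triangle_glue]; exact L.triangle_flag_notMem s) (hLE s) (L.shared s)
        intro y hy
        rcases eq_or_mate_of_faceTriangle hy with hf | hf
        · rw [hface y _ hf, hs]
          exact hface _ _ (by rw [face_glue, face_glue, hf])
        · rw [hface y (Flag.glue (L.flag s)) hf, ← hs]
          exact hface _ _ (by rw [face_glue, hf, mate_mate])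
    have hglue : ∀ z, T.triangle z ∉ T0 → h' (Flag.glue z) = h' z := by
      intro z hz
      obtain ⟨s, hs⟩ := L.exists_step hz
      exact hstep s z hs.symm
    have htri : ∀ x y, T.triangle x ∉ T0 → T.triangle x = T.triangle y → h' x = h' y := by
      intro x y hx hxy
      rcases eq_or_mate_of_faceTriangle hxy with hf | hf
      · exact hface x y hf
      · rw [← hglue x hx]
        exact hface _ _ (by rw [face_glue, hf, mate_mate])
    choose rep hrep using fun t : T.CutTriangle T0 => exists_cutFlag t
    have hrep' : ∀ x (hx : T.triangle x ∉ T0), h' (rep ⟨T.triangle x, hx⟩).1 = h' x :=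
      fun x hx => htri _ _ (rep _).2 (congrArg Subtype.val (hrep ⟨T.triangle x, hx⟩))
    have hconst := hD (fun t => h' (rep t).1) (by
      rintro ⟨x, hx⟩ ⟨y, hy⟩ hxE hxy
      show h' (rep ⟨T.triangle x, hx⟩).1 = h' (rep ⟨T.triangle y, hy⟩).1
      rw [hrep' x hx, hrep' y hy]
      rcases edge_eq_iff.1 hxy with ho | ho
      · exact key Set.univ (fun z _ => hglue z) x y hx hy hxE ho
      · rw [← hflip x]
        refine key Set.univ (fun z _ => hglue z) _ y (by rwa [triangle_flip]) hy ?_ ho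
        rwa [edge_flip])
    rintro ⟨a, ha⟩ ⟨b, hb⟩
    obtain ⟨x, rfl⟩ := exists_flag_face a
    obtain ⟨y, rfl⟩ := exists_flag_face b
    have hx : T.triangle x ∉ T0 := ha
    have hy : T.triangle y ∉ T0 := hb
    rw [← hext h x hx, ← hext h y hy, ← hh', ← hrep' x hx, ← hrep' y hy]
    exact hconst _ _
  by_cases he : e ∈ toEdge T0 ⁻¹' E
  · exact hgE e he
  have hsurj := surjective_of_ker f hker (by
    rw [card_preimage_toEdge h0, card_boundaryFace]
    exact hc)
  -- a chain whose boundary outside `E` is the edge `e` alone, paired with the closed cochain `g`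
  obtain ⟨h, hh⟩ := hsurj (Pi.single ⟨e, he⟩ 1)
  have hval : ∀ e' : ↥(toEdge T0 ⁻¹' Eᶜ),
      edgeSum T0 (ext h) e' = Pi.single (M := fun _ => ZMod 2) ⟨e, he⟩ 1 e' := congrFun hh
  have hz := sum_edgeSum_mul (S := T0) (h := ext h) (g := g)
    (fun x => hface h _ _ (face_act x (by decide))) hg
  rw [Finset.sum_eq_single e] at hz
  · rwa [hval ⟨e, he⟩, Pi.single_eq_same, one_mul] at hz
  · intro e' _ hne
    by_cases he' : e' ∈ toEdge T0 ⁻¹' E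
    · rw [hgE e' he', mul_zero]
    · rw [hval ⟨e', he'⟩, Pi.single_eq_of_ne (fun h => hne (Subtype.ext_iff.1 h)), zero_mul]
  · simp

end Triangulation3

namespace Triangulation3

open TetGluing

variable {T : Triangulation3.{u}} {T0 : Set T.Triangle} {E : Set (T.Edge Set.univ)}

/-! ### From tree-avoiding local constructions to triple trees -/

theorem nonempty_cutTriangle (h0 : T.IsSpanningTreeOfTets T0) :
    Nonempty (T.CutTriangle T0) := by
  have h := card_cutTriangle h0
  exact (Nat.card_pos_iff.1 (by omega)).1

theorem exists_cutFlag_edge (h0 : T.IsSpanningTreeOfTets T0) (e : T.Edge Set.univ) :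
    ∃ x : T.CutFlag T0, T.edge Set.univ x.1 = e := by
  obtain ⟨x, rfl⟩ := Quot.exists_rep e
  obtain ⟨y, hy, hyx⟩ := exists_boundary_flag h0 x
  exact ⟨⟨y, hy⟩, edge_mono (Set.subset_univ _) (edge_of_orEdge_eq hyx)⟩

theorem closed_rot {g : T.Edge Set.univ → ZMod 2} {x : T.Flag}
    (h : g (T.edge Set.univ x) + g (T.edge Set.univ (Flag.rot x)) +
      g (T.edge Set.univ (Flag.rot (Flag.rot x))) = 0) :
    g (T.edge Set.univ (Flag.rot x)) + g (T.edge Set.univ (Flag.rot (Flag.rot x))) +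
      g (T.edge Set.univ (Flag.rot (Flag.rot (Flag.rot x)))) = 0 := by
  rw [rot_rot_rot, ← h]
  ring

theorem closed_glue {g : T.Edge Set.univ → ZMod 2} {x : T.Flag}
    (h : g (T.edge Set.univ x) + g (T.edge Set.univ (Flag.rot x)) +
      g (T.edge Set.univ (Flag.rot (Flag.rot x))) = 0) :
    g (T.edge Set.univ (Flag.glue x)) + g (T.edge Set.univ (Flag.rot (Flag.glue x))) +
      g (T.edge Set.univ (Flag.rot (Flag.rot (Flag.glue x)))) = 0 := by
  rwa [rot_glue, rot_glue, edge_glue (Set.mem_univ _), edge_glue (Set.mem_univ _),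
    edge_glue (Set.mem_univ _)]

theorem closed_flip {g : T.Edge Set.univ → ZMod 2} {x : T.Flag}
    (h : g (T.edge Set.univ x) + g (T.edge Set.univ (Flag.rot x)) +
      g (T.edge Set.univ (Flag.rot (Flag.rot x))) = 0) :
    g (T.edge Set.univ (Flag.flip x)) + g (T.edge Set.univ (Flag.rot (Flag.flip x))) +
      g (T.edge Set.univ (Flag.rot (Flag.rot (Flag.flip x)))) = 0 := by
  have h1 : Flag.rot (Flag.flip x) = Flag.flip (Flag.rot (Flag.rot x)) := by
    simp only [Flag.rot, Flag.flip, act_act]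
    congr 1
    decide
  have h2 : Flag.rot (Flag.rot (Flag.flip x)) = Flag.flip (Flag.rot x) := by
    rw [h1]
    simp only [Flag.rot, Flag.flip, act_act]
    congr 1
    decide
  rw [h2, h1, edge_flip, edge_flip, edge_flip, ← h]
  ring

/-- Whether a cochain is closed on a triangle can be tested on any flag of this triangle. -/
theorem closed_of_triangle_eq {g : T.Edge Set.univ → ZMod 2} {x y : T.Flag}
    (hxy : T.triangle y = T.triangle x)
    (h : g (T.edge Set.univ x) + g (T.edge Set.univ (Flag.rot x)) +
      g (T.edge Set.univ (Flag.rot (Flag.rot x))) = 0) :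
    g (T.edge Set.univ y) + g (T.edge Set.univ (Flag.rot y)) +
      g (T.edge Set.univ (Flag.rot (Flag.rot y))) = 0 := by
  have hside : ∀ {x y : T.Flag}, T.side y = T.side x →
      g (T.edge Set.univ x) + g (T.edge Set.univ (Flag.rot x)) +
        g (T.edge Set.univ (Flag.rot (Flag.rot x))) = 0 →
      g (T.edge Set.univ y) + g (T.edge Set.univ (Flag.rot y)) +
        g (T.edge Set.univ (Flag.rot (Flag.rot y))) = 0 := by
    intro x y hxy h
    rcases side_eq hxy with rfl | rfl | rfl | rfl
    exacts [h, closed_glue h, closed_flip h, closed_glue (closed_flip h)]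
  refine hside (side_sideFlag y).symm ?_
  have h' := hside (side_sideFlag x) h
  rcases (isStd_sideFlag x).eq_or_of_triangle (isStd_sideFlag y)
    (by rw [triangle_sideFlag, triangle_sideFlag, hxy]) with h | h | h <;> rw [h]
  exacts [h', closed_rot h', closed_rot (closed_rot h')]

/-- A potential on the vertices of the tree of tetrahedra, of a cochain of `T`, takes the same
value on vertices that are identified in `T`: in each step, this holds for the ends of the chosen
edge, and hence for the third vertex as well. -/
theorem LocalConstruction.potential_glue (L : LocalConstruction T0) (φ : T.Vertex T0 → ZMod 2)
    (g : T.Edge Set.univ → ZMod 2)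
    (hφ : ∀ x, φ (T.vertex T0 x) + φ (T.vertex T0 (Flag.flip x)) = g (T.edge Set.univ x))
    (x : T.Flag) : φ (T.vertex T0 (Flag.glue x)) = φ (T.vertex T0 x) := by
  have hflip : ∀ x, φ (T.vertex T0 (Flag.glue x)) = φ (T.vertex T0 x) →
      φ (T.vertex T0 (Flag.glue (Flag.flip x))) = φ (T.vertex T0 (Flag.flip x)) := by
    intro x hx
    have h1 := hφ x
    have h2 := hφ (Flag.glue x)
    rw [edge_glue (Set.mem_univ _), ← h1, hx, flip_glue] at h2
    exact add_left_cancel h2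
  have hact : ∀ x, φ (T.vertex T0 (Flag.glue x)) = φ (T.vertex T0 x) →
      ∀ τ : Equiv.Perm (Fin 4), τ 3 = 3 →
        φ (T.vertex T0 (Flag.glue (Flag.act x τ))) = φ (T.vertex T0 (Flag.act x τ)) := by
    have hrot : ∀ x, φ (T.vertex T0 (Flag.glue x)) = φ (T.vertex T0 x) →
        φ (T.vertex T0 (Flag.glue (Flag.rot x))) = φ (T.vertex T0 (Flag.rot x)) := by
      intro x hx
      rw [← rot_glue, vertex_rot, vertex_rot, flip_glue]
      exact hflip x hx
    have hfix : ∀ x, φ (T.vertex T0 (Flag.glue x)) = φ (T.vertex T0 x) →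
        ∀ τ : Equiv.Perm (Fin 4), τ 3 = 3 → τ 0 = 0 →
          φ (T.vertex T0 (Flag.glue (Flag.act x τ))) = φ (T.vertex T0 (Flag.act x τ)) := by
      intro x hx τ h3 h0
      rw [glue_act x h3, vertex_act _ h0, vertex_act _ h0, hx]
    intro x hx τ h3
    have hτ : ∀ τ : Equiv.Perm (Fin 4), τ 3 = 3 → τ = 1 ∨ τ = Equiv.swap 1 2 ∨
        τ = Equiv.swap 0 1 * Equiv.swap 1 2 ∨
        τ = Equiv.swap 0 1 * Equiv.swap 1 2 * Equiv.swap 1 2 ∨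
        τ = Equiv.swap 0 1 * Equiv.swap 1 2 * (Equiv.swap 0 1 * Equiv.swap 1 2) ∨
        τ = Equiv.swap 0 1 * Equiv.swap 1 2 * (Equiv.swap 0 1 * Equiv.swap 1 2) *
          Equiv.swap 1 2 := by decide
    rcases hτ τ h3 with rfl | rfl | rfl | rfl | rfl | rfl
    · rwa [act_one]
    · exact hfix x hx _ (by decide) (by decide)
    · exact hrot x hx
    · rw [← act_act]
      exact hfix _ (hrot x hx) _ (by decide) (by decide)
    · rw [← act_act]
      exact hrot _ (hrot x hx)
    · rw [← act_act, ← act_act]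
      exact hfix _ (hrot _ (hrot x hx)) _ (by decide) (by decide)
  have hstep : ∀ s, ∀ y, T.triangle y = T.triangle (L.flag s) →
      φ (T.vertex T0 (Flag.glue y)) = φ (T.vertex T0 y) := by
    intro s
    induction s using WellFoundedLT.induction with
    | ind s ih =>
      have hs : φ (T.vertex T0 (L.flag s)) = φ (T.vertex T0 (Flag.glue (L.flag s))) := by
        refine congrArg (Quot.lift (fun x => φ (T.vertex T0 x)) ?_) (L.shared s)
        rintro z z' (⟨τ, ⟨h0, -⟩, rfl⟩ | ⟨hz, rfl⟩)
        · rw [vertex_act z h0]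
        · rcases hz with hz | ⟨r, hr, hrz⟩
          · rw [vertex_glue hz]
          · exact (ih r hr z hrz.symm).symm
      intro y hy
      rcases eq_or_mate_of_faceTriangle hy with hf | hf
      · obtain ⟨τ, h3, rfl⟩ := act_of_face_eq hf
        exact hact _ hs.symm τ h3
      · obtain ⟨τ, h3, rfl⟩ := act_of_face_eq (y := Flag.glue (L.flag s)) hf
        exact hact _ (by rw [glue_glue]; exact hs) τ h3
  by_cases hx : T.triangle x ∈ T0
  · rw [vertex_glue hx]
  · obtain ⟨s, hs⟩ := L.exists_step hx
    exact hstep s x hs.symm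

/-- The critical edges form a spanning tree: every cochain on them is the coboundary of a potential
on the vertices of `T`. -/
theorem LocalConstruction.isSpanningTreeOfEdges_critical (h0 : T.IsSpanningTreeOfTets T0)
    (L : LocalConstruction T0)
    (hE : (T.edgeGraph T0).IsSpanningTree (toEdge T0 ⁻¹' L.critical))
    (hD : DualConnected T0 L.critical)
    (hc : Nat.card (StdFlag T0 L.criticalᶜ) + 1 ≤ 2 * Nat.card (T.CutTriangle T0)) :
    T.IsSpanningTreeOfEdges L.critical := by
  classical
  obtain ⟨ends, hG, hends⟩ := T.edgeGraph_eq Set.univ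
  obtain ⟨ends0, hG0, hends0⟩ := T.edgeGraph_eq T0
  rw [hG0] at hE
  rw [IsSpanningTreeOfEdges, hG]
  have : Nonempty (T.Vertex Set.univ) := ⟨T.vertex _ (Classical.arbitrary T.Tet, 1)⟩
  refine Graph.isSpanningTree_of_coboundary ?_ ?_
  -- a path in the spanning tree of `∂T0` maps to a path in the critical edges
  · intro φ hφ
    let π : T.Vertex T0 → T.Vertex Set.univ := Quot.lift (T.vertex Set.univ) fun _ _ h =>
      Quot.sound (h.imp_right (And.imp_left fun _ => Set.mem_univ _))
    have h := hE.eq_of_forall (fun v => φ (π v)) (by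
      intro e he u v huv
      obtain ⟨x, rfl⟩ := Quot.exists_rep e
      have hx := hφ _ he _ _ (hends x)
      have huv : s(T.vertex T0 x, T.vertex T0 (Flag.flip x)) = s(u, v) :=
        (hends0 x).symm.trans huv
      rcases Sym2.eq_iff.1 huv with ⟨rfl, rfl⟩ | ⟨rfl, rfl⟩
      · exact hx
      · exact hx.symm)
    intro u v
    obtain ⟨x, rfl⟩ := Quot.exists_rep u
    obtain ⟨y, rfl⟩ := Quot.exists_rep v
    exact h (T.vertex T0 x) (T.vertex T0 y)
  -- the potential of a closed cochain that is 1 on `e` and 0 on all other critical edges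
  · intro e he
    obtain ⟨g, hg1, hg2⟩ := L.exists_closed_extension (Pi.single e 1)
    have hgc : ∀ x, T.triangle x ∉ T0 → g (T.edge Set.univ x) +
        g (T.edge Set.univ (Flag.rot x)) + g (T.edge Set.univ (Flag.rot (Flag.rot x))) = 0 := by
      intro x hx
      obtain ⟨s, hs⟩ := L.exists_step hx
      exact closed_of_triangle_eq hs.symm (hg2 s)
    obtain ⟨φ, hφ⟩ := hE.exists_coboundary_eq (fun e => g (toEdge T0 e))
    have hδ : ∀ x, Graph.coboundary ends0 φ (T.edge T0 x)
        = φ (T.vertex T0 x) + φ (T.vertex T0 (Flag.flip x)) :=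
      fun x => Graph.coboundary_apply (hends0 x) φ
    have hzero := L.eq_zero_of_closed_boundary h0 (E := L.critical) (fun s h => h s rfl) hD hc
      (fun e => Graph.coboundary ends0 φ e + g (toEdge T0 e))
      (fun e he => zmod_two_add_eq_zero.2 (hφ e he)) (by
        intro x hx
        have h1 := closed_of_add φ (T.vertex T0 x) (T.vertex T0 (Flag.rot x))
          (T.vertex T0 (Flag.rot (Flag.rot x)))
        have h2 := hgc x hx
        simp only [hδ, toEdge_edge, ← vertex_rot, rot_rot_rot]
        linear_combination h1 + h2)
    have hφg : ∀ x, φ (T.vertex T0 x) + φ (T.vertex T0 (Flag.flip x))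
        = g (T.edge Set.univ x) := by
      intro x
      rw [← hδ, ← zmod_two_add_eq_zero]
      exact hzero (T.edge T0 x)
    let ψ : T.Vertex Set.univ → ZMod 2 := Quot.lift (fun x => φ (T.vertex T0 x)) (by
      rintro x _ (⟨τ, h, rfl⟩ | ⟨-, rfl⟩)
      · rw [vertex_act x h]
      · exact (L.potential_glue φ g hφg x).symm)
    have hψg : ∀ e, Graph.coboundary ends ψ e = g e := by
      intro e
      obtain ⟨x, rfl⟩ := Quot.exists_rep e
      exact (Graph.coboundary_apply (hends x) ψ).trans (hφg x)
    refine ⟨ψ, by rw [hψg, hg1 e he, Pi.single_eq_same], fun e' he' hne => ?_⟩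
    rw [hψg, hg1 e' he', Pi.single_eq_of_ne hne]

/-- The copies of the critical edges form a spanning tree of the 2-complex cut along them. -/
theorem LocalConstruction.isSpanningTree_cut (L : LocalConstruction T0)
    [Nonempty (T.CutTriangle T0)] (hD : DualConnected T0 L.critical)
    (hc : Nat.card (T.cut T0 L.critical) + 1 ≤ Nat.card (T.CutVertex T0 L.critical)) :
    (T.cutEdgeGraph T0 L.critical).IsSpanningTree (T.cut T0 L.critical) := by
  classical
  obtain ⟨ends, hG, hends⟩ := cutEdgeGraph_eq T0 L.critical
  rw [hG]
  obtain ⟨x0, -⟩ := exists_cutFlag (Classical.arbitrary (T.CutTriangle T0))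
  have : Nonempty (T.CutVertex T0 L.critical) := ⟨T.cutVertex T0 _ x0⟩
  refine Graph.isSpanningTree_of_connected hc fun φ hφ => ?_
  let f : T.CutFlag T0 → ZMod 2 := fun x => φ (T.cutVertex T0 L.critical x)
  have hcorner : ∀ x y : T.CutFlag T0, T.corner x.1 = T.corner y.1 → f x = f y :=
    fun x y h => congrArg φ (Quot.sound (Or.inl h))
  -- the coboundary of `φ`, as a function on the sides, is closed and vanishes on the critical edges
  let g : T.Flag → ZMod 2 := fun x => if hx : T.triangle x ∉ T0 then
    f ⟨x, hx⟩ + f (CutFlag.flip ⟨x, hx⟩) else 0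
  have hgx : ∀ x (hx : T.triangle x ∉ T0), g x = f ⟨x, hx⟩ + f (CutFlag.flip ⟨x, hx⟩) :=
    fun x hx => dif_pos hx
  have hgδ : ∀ x (hx : T.triangle x ∉ T0),
      g x = Graph.coboundary ends φ (T.cutEdge T0 L.critical ⟨x, hx⟩) := by
    intro x hx
    rw [hgx x hx, Graph.coboundary_apply (hends _)]
  have hrotf : ∀ x (hx : T.triangle x ∉ T0), f (CutFlag.flip ⟨x, hx⟩)
      = f ⟨Flag.rot x, by rwa [triangle_rot]⟩ :=
    fun x hx => hcorner _ _ (corner_rot x).symm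
  have hg0 : ∀ x, T.triangle x ∉ T0 → g x = 0 := by
    intro x hx
    refine L.eq_zero_of_closed subset_rfl g ?_ ?_ ?_ hx
    · intro x hx hxE
      rw [hgx x hx, zmod_two_add_eq_zero]
      exact hφ _ (mem_cut_iff.2 hxE) _ _ (hends ⟨x, hx⟩)
    · intro x y hx hy hxE hxy
      rw [hgδ x hx, hgδ y hy, (cutEdge_eq_iff (x := ⟨x, hx⟩) (y := ⟨y, hy⟩)).2 (Or.inr ⟨hxE, hxy⟩)]
    · intro s
      have hx := L.triangle_flag_notMem s
      have hx1 : T.triangle (Flag.rot (L.flag s)) ∉ T0 := by rwa [triangle_rot]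
      have hx2 : T.triangle (Flag.rot (Flag.rot (L.flag s))) ∉ T0 := by rwa [triangle_rot]
      rw [hgx _ hx, hgx _ hx1, hgx _ hx2, hrotf _ hx, hrotf _ hx1, hrotf _ hx2]
      simp only [rot_rot_rot]
      exact closed_of_add f _ _ _
  have hflip : ∀ x : T.CutFlag T0, f x = f (CutFlag.flip x) := by
    intro x
    rw [← zmod_two_add_eq_zero, ← hg0 x.1 x.2, hgx x.1 x.2]
  have htri : ∀ x y : T.CutFlag T0, T.triangle x.1 = T.triangle y.1 → f x = f y := by
    have hrot : ∀ x (hx : T.triangle x ∉ T0) (hx' : T.triangle (Flag.rot x) ∉ T0),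
        f ⟨Flag.rot x, hx'⟩ = f ⟨x, hx⟩ := fun x hx hx' => by rw [hflip ⟨x, hx⟩, hrotf]
    have hstd : ∀ x : T.CutFlag T0, f x = f ⟨cornerFlag x.1, by
        rw [triangle_cornerFlag]; exact x.2⟩ :=
      fun x => hcorner _ _ (corner_cornerFlag x.1).symm
    have key : ∀ x y (hx : T.triangle x ∉ T0) (hy : T.triangle y ∉ T0), IsStd x → IsStd y →
        T.triangle y = T.triangle x → f ⟨x, hx⟩ = f ⟨y, hy⟩ := by
      intro x y hx hy hxs hys h
      have hx' : T.triangle (Flag.rot x) ∉ T0 := by rwa [triangle_rot]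
      rcases hxs.eq_or_of_triangle hys h with rfl | rfl | rfl
      · rfl
      · rw [hrot x hx]
      · rw [hrot _ hx', hrot x hx]
    intro x y hxy
    rw [hstd x, hstd y]
    exact key _ _ _ _ (isStd_cornerFlag _) (isStd_cornerFlag _)
      (by rw [triangle_cornerFlag, triangle_cornerFlag, hxy])
  choose rep hrep using fun t : T.CutTriangle T0 => exists_cutFlag t
  have hrep' : ∀ x : T.CutFlag T0, f (rep ⟨T.triangle x.1, x.2⟩) = f x :=
    fun x => htri _ _ (congrArg Subtype.val (hrep ⟨T.triangle x.1, x.2⟩))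
  have hconst := hD (fun t => f (rep t)) (by
    intro x y hxE hxy
    show f (rep _) = f (rep _)
    rw [hrep', hrep']
    rcases edge_eq_iff.1 hxy with h | h
    · exact congrArg φ (Quot.sound (Or.inr ⟨hxE, h⟩))
    · rw [hflip x]
      refine congrArg φ (Quot.sound (Or.inr ⟨?_, h⟩))
      show T.edge Set.univ (Flag.flip x.1) ∉ _
      rwa [edge_flip])
  intro u v
  obtain ⟨x, rfl⟩ := Quot.exists_rep u
  obtain ⟨y, rfl⟩ := Quot.exists_rep v
  show f x = f y
  rw [← hrep' x, ← hrep' y]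
  exact hconst _ _

/-- Let `n` be the number of triangles outside `T0`, `m` that of edges of `T` outside the avoided set
`E`, and `c` the number of sides on `E`. Then `c + 1` is the number of vertices of the tree of
tetrahedra, at least `n + 2`; the connectedness of the dual graph, with `3n` links, gives
`n + m + c ≤ 3n + 1`; and the chosen edges give `n ≤ m`. Hence `m = n` and `c = n + 1`. -/
theorem LocalConstruction.IsTreeAvoiding.isTripleTree (h0 : T.IsSpanningTreeOfTets T0)
    {L : LocalConstruction T0} (hL : L.IsTreeAvoiding) : T.IsTripleTree T0 L.critical := by
  classical
  have := nonempty_cutTriangle h0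
  obtain ⟨E0, hE0, hav⟩ := hL
  obtain ⟨E, rfl, hLE⟩ := hav.exists_eq_preimage
  have hD := dualConnected_of_isSpanningTree h0 hE0
  have c0 := card_preimage_toEdge h0 E
  have c1 : Nat.card (toEdge T0 ⁻¹' E) + 1 = Nat.card (T.Vertex T0) := hE0.card_add_one
  have c2 := card_cutTriangle_add_two_le h0
  have c3 := hD.card_le
  have c4 := T.card_cutEdge (T0 := T0) (E := E)
  have c5 := T.card_cut (T0 := T0) (E := E)
  have c6 := T.card_stdFlag_add (T0 := T0) E
  have c7 := L.card_eq
  have c8 := T.card_cutVertex (T0 := T0) (E := E)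
  let f : Fin L.n → ↥(T.cut T0 E)ᶜ := fun s =>
    ⟨T.cutEdge T0 E ⟨L.flag s, L.triangle_flag_notMem s⟩, fun h => hLE s (mem_cut_iff.1 h)⟩
  have hf : Function.Injective f := by
    intro s r h
    exact L.edge_injective (edge_of_cutEdge_eq (congrArg Subtype.val h))
  have c9 := Nat.card_le_card_of_injective f hf
  rw [Nat.card_fin] at c9
  have hfs : Function.Surjective f :=
    (hf.bijective_of_nat_card_le (by rw [Nat.card_fin]; omega)).2
  obtain rfl : E = L.critical := by
    ext e
    constructor
    · rintro he s rfl
      exact hLE s he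
    · intro he
      by_contra heE
      obtain ⟨x, rfl⟩ := exists_cutFlag_edge h0 e
      obtain ⟨s, hs⟩ := hfs ⟨T.cutEdge T0 E x, fun h => heE (mem_cut_iff.1 h)⟩
      exact he s (edge_of_cutEdge_eq (congrArg Subtype.val hs))
  have hne : (toEdge T0 ⁻¹' L.critical).Nonempty := by
    have : 0 < Nat.card (toEdge T0 ⁻¹' L.critical) := by omega
    obtain ⟨⟨e, he⟩⟩ := (Nat.card_pos_iff.1 this).1
    exact ⟨e, he⟩
  refine ⟨h0, L.isSpanningTreeOfEdges_critical h0 hE0 hD (by omega), hD.isTree (by omega),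
    L.isSpanningTree_cut hD (by omega), ?_⟩
  obtain ⟨e, he⟩ := hne
  obtain ⟨x, -, hx, rfl⟩ := exists_flag_of_edge h0 e
  exact ⟨x, hx, he⟩

end Triangulation3

/-! ### From triple trees to tree-avoiding local constructions -/

/-- If every nonempty finite set has an element with no `r`-predecessor in it, then each finite set
can be enumerated in an order that extends `r`. -/
theorem exists_enumeration {α : Type*} [DecidableEq α] {r : α → α → Prop}
    (h : ∀ R : Finset α, R.Nonempty → ∃ t ∈ R, ∀ t' ∈ R, ¬ r t' t) (R : Finset α) :
    ∃ l : List α, l.Nodup ∧ (∀ t, t ∈ l ↔ t ∈ R) ∧ l.Pairwise fun a b => ¬ r b a := by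
  induction hn : R.card generalizing R with
  | zero =>
    obtain rfl := Finset.card_eq_zero.1 hn
    exact ⟨[], by simp⟩
  | succ n ih =>
    obtain ⟨t, ht, htr⟩ := h R (Finset.card_pos.1 (by omega))
    obtain ⟨l, hl1, hl2, hl3⟩ := ih (R.erase t) (by rw [Finset.card_erase_of_mem ht]; omega)
    refine ⟨t :: l, List.nodup_cons.2 ⟨by simp [hl2], hl1⟩, fun t' => ?_,
      List.pairwise_cons.2 ⟨fun t' ht' => htr t' (Finset.mem_of_mem_erase ((hl2 t').1 ht')), hl3⟩⟩
    rw [List.mem_cons, hl2, Finset.mem_erase]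
    by_cases htt : t' = t
    · simp [htt, ht]
    · simp [htt]

namespace Triangulation3

open TetGluing

variable {T : Triangulation3.{u}} {T0 : Set T.Triangle} {E : Set (T.Edge Set.univ)}

/-- A side of a triangle outside `T0`, as a flag of `T^{T0}`. -/
def stdCutFlag (x : StdFlag T0 Set.univ) : T.CutFlag T0 := ⟨x.1, x.2.2.1⟩

/-- The triangle of a side. -/
def stdTriangle (x : StdFlag T0 Set.univ) : T.CutTriangle T0 := ⟨T.triangle x.1, x.2.2.1⟩

/-- The next side around the same triangle. -/
def stdRot (x : StdFlag T0 Set.univ) : StdFlag T0 Set.univ :=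
  ⟨Flag.rot x.1, x.2.1.rot, by rw [triangle_rot]; exact x.2.2.1, trivial⟩

theorem stdTriangle_rot (x : StdFlag T0 Set.univ) : stdTriangle (stdRot x) = stdTriangle x :=
  Subtype.ext (triangle_rot x.1)

theorem exists_std_cutFlag (y : T.CutFlag T0) : ∃ x : StdFlag T0 Set.univ,
    T.side x.1 = T.side y.1 :=
  ⟨⟨sideFlag y.1, isStd_sideFlag _, by rw [triangle_sideFlag]; exact y.2, trivial⟩,
    side_sideFlag y.1⟩

open Classical in
/-- A chain of triangles without boundary outside `Cut(E)` has boundary zero, since `Cut(E)` is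
acyclic; hence none of its triangles lies on `Cut(E)`, and each edge is on no or at least two of
its sides. A tree of triangles has no such chain. -/
theorem IsTripleTree.chain_eq_zero (hT : T.IsTripleTree T0 E) [Fintype (StdFlag T0 Set.univ)]
    (h : T.CutTriangle T0 → ZMod 2)
    (hh : ∀ c ∉ T.cut T0 E, ∑ x : StdFlag T0 Set.univ with T.cutEdge T0 E (stdCutFlag x) = c,
      h (stdTriangle x) = 0) : h = 0 := by
  have := Fintype.ofFinite (T.CutEdge T0 E)
  -- a side on `Cut(E)` is detected by a coboundary that vanishes on the rest of `Cut(E)`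
  have hcut : ∀ x : StdFlag T0 Set.univ, T.cutEdge T0 E (stdCutFlag x) ∈ T.cut T0 E →
      h (stdTriangle x) = 0 := by
    intro x0 hx0
    obtain ⟨ends, hG, hends⟩ := cutEdgeGraph_eq T0 E
    have hcutT := hT.cut
    rw [hG] at hcutT
    obtain ⟨φ, h1, h2⟩ := hcutT.exists_coboundary hx0
    have hδ : ∀ x : StdFlag T0 Set.univ, Graph.coboundary ends φ (T.cutEdge T0 E (stdCutFlag x)) =
        φ (T.cutVertex T0 E (stdCutFlag x)) + φ (T.cutVertex T0 E (stdCutFlag (stdRot x))) := by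
      intro x
      rw [Graph.coboundary_apply (hends _)]
      congr 2
      exact Quot.sound (Or.inl (corner_rot x.1).symm)
    have hz := sum_mul_eq_zero_of_rot (X := StdFlag T0 Set.univ) (r := stdRot)
      (A := Finset.univ) (fun x => Subtype.ext (rot_rot_rot x.1)) (fun _ _ => Finset.mem_univ _)
      (h := fun x => h (stdTriangle x))
      (g := fun x => Graph.coboundary ends φ (T.cutEdge T0 E (stdCutFlag x)))
      (fun x _ => by rw [stdTriangle_rot]) (fun x _ => by
        have : stdRot (stdRot (stdRot x)) = x := Subtype.ext (rot_rot_rot x.1)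
        rw [hδ, hδ, hδ, this]
        exact closed_of_add φ _ _ _)
    rw [← Finset.sum_fiberwise _ (fun x => T.cutEdge T0 E (stdCutFlag x)),
      Finset.sum_eq_single (T.cutEdge T0 E (stdCutFlag x0)), Finset.sum_eq_single x0] at hz
    · rwa [h1, mul_one] at hz
    · intro x hx hne
      refine absurd (Subtype.ext (x.2.1.eq_of_side x0.2.1 ?_)) hne
      refine (cutEdge_eq_iff.1 (Finset.mem_filter.1 hx).2).resolve_right fun hxE => hxE.1 ?_
      rw [hxE.2]
      exact mem_cut_iff.1 hx0
    · simp
    · intro c _ hne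
      have hc : ∑ x : StdFlag T0 Set.univ with T.cutEdge T0 E (stdCutFlag x) = c,
          h (stdTriangle x) * Graph.coboundary ends φ (T.cutEdge T0 E (stdCutFlag x)) =
          (∑ x : StdFlag T0 Set.univ with T.cutEdge T0 E (stdCutFlag x) = c,
            h (stdTriangle x)) * Graph.coboundary ends φ c := by
        rw [Finset.sum_mul]
        exact Finset.sum_congr rfl fun x hx => by rw [(Finset.mem_filter.1 hx).2]
      rw [hc]
      by_cases hcc : c ∈ T.cut T0 E
      · rw [h2 c hcc hne, mul_zero]
      · rw [hh c hcc, zero_mul]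
    · simp
  by_contra hne
  obtain ⟨t0, ht0⟩ := Function.ne_iff.1 hne
  let A : Finset (StdFlag T0 Set.univ) := Finset.univ.filter fun x => h (stdTriangle x) ≠ 0
  have hA : ∀ x, x ∈ A ↔ h (stdTriangle x) ≠ 0 := fun x => by simp [A]
  have hAne : A.Nonempty := by
    obtain ⟨y, rfl⟩ := exists_cutFlag t0
    obtain ⟨x, hx⟩ := exists_std_cutFlag y
    refine ⟨x, (hA x).2 ?_⟩
    have : stdTriangle x = ⟨T.triangle y.1, y.2⟩ := Subtype.ext (triangle_of_side_eq hx)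
    rwa [this]
  -- the `a` sides in `A` link at most `a / 3` triangles and `a / 2` edges, too few for a forest
  obtain ⟨ends, hG, hends⟩ := incidenceGraph_eq T0 E
  have htree := hT.triangles
  rw [Graph.IsTree, hG, Graph.edgeSet_ofEnds] at htree
  have hlt := htree.card_lt
    (F' := A.image fun x => cutSide (stdCutFlag x)) (Set.subset_univ _)
    (hAne.image _) (W := (A.image fun x => Sum.inl (stdTriangle x)) ∪
      A.image fun x => Sum.inr (T.cutEdge T0 E (stdCutFlag x))) (by
      intro l hl v hv
      obtain ⟨x, hx, rfl⟩ := Finset.mem_image.1 hl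
      rw [hends, Sym2.mem_iff] at hv
      rcases hv with rfl | rfl
      · exact Finset.mem_union_left _ (Finset.mem_image.2 ⟨x, hx, rfl⟩)
      · exact Finset.mem_union_right _ (Finset.mem_image.2 ⟨x, hx, rfl⟩))
  rw [Finset.card_image_of_injective _ (fun x y hxy =>
    Subtype.ext (x.2.1.eq_of_side y.2.1 (cutSide_eq_iff.1 hxy)))] at hlt
  have h3 := Finset.mul_card_image_le_card
    (f := fun x => (Sum.inl (stdTriangle x) : T.CutTriangle T0 ⊕ T.CutEdge T0 E)) A 3 (by
    intro t ht
    obtain ⟨x, hx, rfl⟩ := Finset.mem_image.1 ht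
    have e1 : stdRot x ≠ x := fun h => rot_ne x.1 (congrArg Subtype.val h)
    have e2 : stdRot (stdRot x) ≠ stdRot x := fun h => rot_ne _ (congrArg Subtype.val h)
    have e3 : stdRot (stdRot x) ≠ x := fun h => by
      have h' := congrArg Flag.rot (congrArg Subtype.val h)
      exact rot_ne x.1 (h'.symm.trans (rot_rot_rot x.1))
    rw [← Finset.card_eq_three.2 ⟨x, stdRot x, stdRot (stdRot x), e1.symm, e3.symm, e2.symm, rfl⟩]
    refine Finset.card_le_card ?_
    intro y hy
    have hyt : stdTriangle y = stdTriangle x := by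
      simp only [Finset.mem_insert, Finset.mem_singleton] at hy
      rcases hy with rfl | rfl | rfl
      · rfl
      · exact stdTriangle_rot x
      · rw [stdTriangle_rot, stdTriangle_rot]
    refine Finset.mem_filter.2 ⟨(hA y).2 ?_, by rw [hyt]⟩
    rw [hyt]
    exact (hA x).1 hx)
  have h2 := Finset.mul_card_image_le_card
    (f := fun x => (Sum.inr (T.cutEdge T0 E (stdCutFlag x)) : T.CutTriangle T0 ⊕ T.CutEdge T0 E))
    A 2 (by
    intro c hc
    obtain ⟨x, hx, rfl⟩ := Finset.mem_image.1 hc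
    have hxc : T.cutEdge T0 E (stdCutFlag x) ∉ T.cut T0 E := fun h => (hA x).1 hx (hcut x h)
    by_contra! hlt
    -- if `x` were the only side on its edge, the boundary would not vanish there
    apply (hA x).1 hx
    rw [← hh _ hxc, Finset.sum_eq_single x]
    · intro y hy hne
      by_contra hy0
      have hsub : ({x, y} : Finset _) ⊆ A.filter fun y =>
          (Sum.inr (T.cutEdge T0 E (stdCutFlag y)) : T.CutTriangle T0 ⊕ T.CutEdge T0 E) =
            Sum.inr (T.cutEdge T0 E (stdCutFlag x)) := by
        intro z hz
        rcases Finset.mem_insert.1 hz with rfl | hz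
        · exact Finset.mem_filter.2 ⟨hx, rfl⟩
        · rw [Finset.mem_singleton] at hz
          subst hz
          exact Finset.mem_filter.2 ⟨(hA z).2 hy0, congrArg _ (Finset.mem_filter.1 hy).2⟩
      have := Finset.card_le_card hsub
      rw [Finset.card_pair (Ne.symm hne)] at this
      omega
    · simp)
  have h4 := Finset.card_union_le (A.image fun x =>
      (Sum.inl (stdTriangle x) : T.CutTriangle T0 ⊕ T.CutEdge T0 E))
    (A.image fun x => Sum.inr (T.cutEdge T0 E (stdCutFlag x)))
  have h5 := hAne.card_pos
  omega

/-- The triangles can be matched with edges outside `E` that they contain: if the triangles in a set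
had fewer such edges than Hall's condition requires, some nonzero chain of these triangles would
have boundary zero outside `Cut(E)`. -/
theorem IsTripleTree.exists_matching (hT : T.IsTripleTree T0 E) :
    ∃ m : T.CutTriangle T0 → StdFlag T0 Set.univ, (∀ t, stdTriangle (m t) = t) ∧
      (∀ t, T.edge Set.univ (m t).1 ∉ E) ∧
      Function.Injective fun t => T.cutEdge T0 E (stdCutFlag (m t)) := by
  classical
  have := Fintype.ofFinite (StdFlag T0 Set.univ)
  let N : T.CutTriangle T0 → Finset (T.CutEdge T0 E) := fun t =>
    (Finset.univ.filter fun x : StdFlag T0 Set.univ => stdTriangle x = t ∧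
      T.cutEdge T0 E (stdCutFlag x) ∉ T.cut T0 E).image fun x => T.cutEdge T0 E (stdCutFlag x)
  have hN : ∀ t c, c ∈ N t ↔ ∃ x : StdFlag T0 Set.univ, (stdTriangle x = t ∧
      T.cutEdge T0 E (stdCutFlag x) ∉ T.cut T0 E) ∧ T.cutEdge T0 E (stdCutFlag x) = c := by
    intro t c
    simp [N]
  have hHall : ∀ s : Finset (T.CutTriangle T0), s.card ≤ (s.biUnion N).card := by
    intro s
    by_contra! hlt
    let ext : (s → ZMod 2) →ₗ[ZMod 2] (T.CutTriangle T0 → ZMod 2) :=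
      Function.ExtendByZero.linearMap (ZMod 2) Subtype.val
    let bd : (T.CutTriangle T0 → ZMod 2) →ₗ[ZMod 2] (s.biUnion N → ZMod 2) :=
      LinearMap.pi fun c =>
        ∑ x : StdFlag T0 Set.univ with T.cutEdge T0 E (stdCutFlag x) = c,
          LinearMap.proj (stdTriangle x)
    have hker := LinearMap.ker_ne_bot_of_finrank_lt (f := bd ∘ₗ ext) (by
      simpa [Module.finrank_fintype_fun_eq_card] using hlt)
    obtain ⟨h, hh, hne⟩ := (Submodule.ne_bot_iff _).1 hker
    apply hne
    have hzero := hT.chain_eq_zero (ext h) (by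
      intro c hc
      by_cases hcs : c ∈ s.biUnion N
      · have := congrFun (show bd (ext h) = 0 from hh) ⟨c, hcs⟩
        simpa [bd] using this
      · refine Finset.sum_eq_zero fun x hx => ?_
        have hx := (Finset.mem_filter.1 hx).2
        refine Function.extend_apply' _ _ _ ?_
        rintro ⟨t, ht⟩
        refine hcs (Finset.mem_biUnion.2 ⟨t, t.2, (hN _ _).2 ⟨x, ⟨ht.symm, ?_⟩, hx⟩⟩)
        rwa [hx])
    ext t
    have := congrFun hzero t
    rwa [Function.ExtendByZero.linearMap_apply, Subtype.val_injective.extend_apply] at this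
  obtain ⟨e, he1, he2⟩ := (Finset.all_card_le_biUnion_card_iff_exists_injective N).1 hHall
  choose m hm1 hm2 using fun t => (hN t (e t)).1 (he2 t)
  refine ⟨m, fun t => (hm1 t).1, fun t ht => (hm1 t).2 (mem_cut_iff.2 ht), ?_⟩
  intro t t' h
  apply he1
  rw [← hm2 t, ← hm2 t']
  exact h

/-- In a tree of triangles, each nonempty set of matched triangles contains a triangle that is the
only one of the set on its edge: otherwise, the triangles and their edges would be linked by twice
as many sides as there are triangles. -/
theorem IsTripleTree.exists_free (hT : T.IsTripleTree T0 E)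
    {m : T.CutTriangle T0 → StdFlag T0 Set.univ} (hm1 : ∀ t, stdTriangle (m t) = t)
    (hm3 : Function.Injective fun t => T.cutEdge T0 E (stdCutFlag (m t)))
    (R : Finset (T.CutTriangle T0)) (hR : R.Nonempty) : ∃ t ∈ R, ∀ t' ∈ R,
      ¬ ∃ y : T.CutFlag T0, (⟨T.triangle y.1, y.2⟩ : T.CutTriangle T0) = t' ∧
        T.cutEdge T0 E y = T.cutEdge T0 E (stdCutFlag (m t)) ∧ T.side y.1 ≠ T.side (m t).1 := by
  classical
  by_contra! hcon
  have hcon' : ∀ t : R, ∃ y : T.CutFlag T0, (⟨T.triangle y.1, y.2⟩ : T.CutTriangle T0) ∈ R ∧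
      T.cutEdge T0 E y = T.cutEdge T0 E (stdCutFlag (m t)) ∧ T.side y.1 ≠ T.side (m t).1 := by
    rintro ⟨t, ht⟩
    obtain ⟨t', ht', y, rfl, h⟩ := hcon t ht
    exact ⟨y, ht', h⟩
  choose y hyR hyc hys using hcon'
  obtain ⟨ends, hG, hends⟩ := incidenceGraph_eq T0 E
  have htree := hT.triangles
  rw [Graph.IsTree, hG, Graph.edgeSet_ofEnds] at htree
  let f : R ⊕ R → T.CutFlag T0 := Sum.elim (fun t => stdCutFlag (m t)) y
  have hfc : ∀ a, T.cutEdge T0 E (f a) =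
      T.cutEdge T0 E (stdCutFlag (m (Sum.elim id id a : R))) := by
    rintro (t | t)
    · rfl
    · exact hyc t
  have hfR : ∀ a, (⟨T.triangle (f a).1, (f a).2⟩ : T.CutTriangle T0) ∈ R := by
    rintro (t | t)
    · show stdTriangle (m t) ∈ R
      rw [hm1]
      exact t.2
    · exact hyR t
  have hlt := htree.card_lt
    (F' := Finset.univ.image fun a => cutSide (f a)) (Set.subset_univ _)
    (by
      obtain ⟨t, ht⟩ := hR
      exact ⟨_, Finset.mem_image_of_mem _ (Finset.mem_univ (Sum.inl ⟨t, ht⟩))⟩)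
    (W := R.image Sum.inl ∪ R.image fun t => Sum.inr (T.cutEdge T0 E (stdCutFlag (m t)))) (by
      intro l hl v hv
      obtain ⟨a, -, rfl⟩ := Finset.mem_image.1 hl
      rw [hends, Sym2.mem_iff] at hv
      rcases hv with rfl | rfl
      · exact Finset.mem_union_left _ (Finset.mem_image_of_mem _ (hfR a))
      · rw [hfc]
        exact Finset.mem_union_right _ (Finset.mem_image.2 ⟨_, Subtype.mem _, rfl⟩))
  rw [Finset.card_image_of_injective, Finset.card_univ, Fintype.card_sum, Fintype.card_coe] at hlt
  · have h1 := Finset.card_union_le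
      (R.image (Sum.inl : _ → T.CutTriangle T0 ⊕ T.CutEdge T0 E))
      (R.image fun t => Sum.inr (T.cutEdge T0 E (stdCutFlag (m t))))
    have h2 : (R.image (Sum.inl : _ → T.CutTriangle T0 ⊕ T.CutEdge T0 E)).card ≤ R.card :=
      Finset.card_image_le
    have h3 : (R.image fun t => (Sum.inr (T.cutEdge T0 E (stdCutFlag (m t))) :
      T.CutTriangle T0 ⊕ T.CutEdge T0 E)).card ≤ R.card := Finset.card_image_le
    omega
  · intro a b hab
    have hside : T.side (f a).1 = T.side (f b).1 := cutSide_eq_iff.1 hab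
    have hc : T.cutEdge T0 E (f a) = T.cutEdge T0 E (f b) :=
      cutEdge_eq_iff.2 (Or.inl hside)
    rw [hfc, hfc] at hc
    have ht := Subtype.ext (hm3 hc)
    rcases a with t | t <;> rcases b with t' | t' <;> obtain rfl : t = t' := ht
    · rfl
    · exact absurd hside.symm (hys t)
    · exact absurd hside (hys t)
    · rfl

/-- A triple tree collapses: the triangles can be glued in an order in which each matched edge is
free when its triangle is glued. -/
theorem IsTripleTree.exists_localConstruction (hT : T.IsTripleTree T0 E) :
    ∃ L : LocalConstruction T0, (∀ s, T.edge Set.univ (L.flag s) ∉ E) ∧ L.critical = E := by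
  classical
  have := Fintype.ofFinite (T.CutTriangle T0)
  obtain ⟨m, hm1, hm2, hm3⟩ := hT.exists_matching
  obtain ⟨l, hl1, hl2, hl3⟩ := exists_enumeration (hT.exists_free hm1 hm3) Finset.univ
  have hlt : ∀ s : Fin l.length, T.triangle (m (l.get s)).1 = (l.get s).1 :=
    fun s => congrArg Subtype.val (hm1 (l.get s))
  have hpos : ∀ t : T.CutTriangle T0, ∃ s, l.get s = t := fun t =>
    List.mem_iff_get.1 ((hl2 t).2 (Finset.mem_univ t))
  let L : LocalConstruction T0 :=
    { n := l.length
      flag := fun s => (m (l.get s)).1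
      triangle_injective := by
        intro s r h
        have h : T.triangle (m (l.get s)).1 = T.triangle (m (l.get r)).1 := h
        rw [hlt, hlt] at h
        exact hl1.injective_get (Subtype.ext h)
      range_triangle := by
        ext t
        constructor
        · rintro ⟨s, rfl⟩
          exact (m (l.get s)).2.2.1
        · intro ht
          obtain ⟨s, hs⟩ := hpos ⟨t, ht⟩
          exact ⟨s, by show T.triangle (m (l.get s)).1 = t; rw [hlt, hs]⟩
      shared := by
        intro s
        have hnot : T.triangle (m (l.get s)).1 ∉
            T0 ∪ {f | ∃ r < s, T.triangle (m (l.get r)).1 = f} := by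
          rintro (h | ⟨r, hr, h⟩)
          · exact (m (l.get s)).2.2.1 h
          · rw [hlt, hlt] at h
            exact hr.ne (hl1.injective_get (Subtype.ext h))
        rw [orEdge_eq_glue_iff hnot]
        intro y hy hyE
        by_contra hne
        have hyT : T.triangle y ∉ T0 := fun h => hy (Or.inl h)
        obtain ⟨r, hr⟩ := hpos ⟨T.triangle y, hyT⟩
        have hrs : s ≤ r := by
          by_contra! hlt'
          exact hy (Or.inr ⟨r, hlt', by rw [hlt, hr]⟩)
        have hy' : ∃ y : T.CutFlag T0, (⟨T.triangle y.1, y.2⟩ : T.CutTriangle T0) = l.get r ∧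
            T.cutEdge T0 E y = T.cutEdge T0 E (stdCutFlag (m (l.get s))) ∧
            T.side y.1 ≠ T.side (m (l.get s)).1 := by
          refine ⟨⟨y, hyT⟩, hr.symm, cutEdge_eq_iff.2 (Or.inr ⟨?_, hyE⟩), hne⟩
          show T.edge Set.univ y ∉ E
          rw [hyE]
          exact hm2 _
        rcases hrs.lt_or_eq with hlt' | rfl
        · exact List.pairwise_iff_get.1 hl3 s r hlt' hy'
        -- if the other side belongs to the same triangle, this triangle alone has no free edge
        · obtain ⟨t, ht, hfree⟩ := hT.exists_free hm1 hm3 {l.get s} (by simp)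
          rw [Finset.mem_singleton] at ht
          subst ht
          exact hfree _ (Finset.mem_singleton_self _) hy' }
  refine ⟨L, fun s => hm2 _, ?_⟩
  -- there are at most `n` edges outside `E`, so all of them are matched
  have c1 := card_of_isTree hT.triangles
  have c2 : Nat.card (T.cut T0 E) + 1 = Nat.card (T.CutVertex T0 E) := hT.cut.card_add_one
  have c3 := T.card_cutVertex (T0 := T0) (E := E)
  have c4 := T.card_cutEdge (T0 := T0) (E := E)
  have c5 := T.card_cut (T0 := T0) (E := E)
  have c6 := T.card_stdFlag_add (T0 := T0) E
  let f : T.CutTriangle T0 → ↥(T.cut T0 E)ᶜ := fun t =>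
    ⟨T.cutEdge T0 E (stdCutFlag (m t)), fun h => hm2 t (mem_cut_iff.1 h)⟩
  have hf : Function.Injective f := fun t t' h => hm3 (congrArg Subtype.val h)
  have hfs := (hf.bijective_of_nat_card_le (by omega)).2
  ext e
  constructor
  · intro he
    by_contra heE
    obtain ⟨x, rfl⟩ := exists_cutFlag_edge hT.tets e
    obtain ⟨t, ht⟩ := hfs ⟨T.cutEdge T0 E x, fun h => heE (mem_cut_iff.1 h)⟩
    obtain ⟨s, rfl⟩ := hpos t
    exact he s (edge_of_cutEdge_eq (congrArg Subtype.val ht))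
  · rintro he s rfl
    exact hm2 _ he

/-- The collapse of a triple tree avoids the preimage of `E` in the tree of tetrahedra. It is a
spanning tree there: a potential that is constant along it has coboundary zero, and it has not more
edges than a spanning tree. -/
theorem IsTripleTree.exists_isTreeAvoiding (hT : T.IsTripleTree T0 E) :
    ∃ L : LocalConstruction T0, L.IsTreeAvoiding ∧ L.critical = E := by
  classical
  have h0 := hT.tets
  obtain ⟨L, hLE, hcrit⟩ := hT.exists_localConstruction
  refine ⟨L, ⟨toEdge T0 ⁻¹' E, ?_, L.avoids_preimage hLE⟩, hcrit⟩
  have c1 := card_of_isTree hT.triangles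
  have c2 := card_cutTriangle_add_two_le h0
  have c4 := T.card_cutEdge (T0 := T0) (E := E)
  have c5 := T.card_cut (T0 := T0) (E := E)
  have c6 := T.card_stdFlag_add (T0 := T0) E
  have c7 := card_preimage_toEdge h0 E
  have c8 : Nat.card ↥(T.cut T0 E)ᶜ ≤ Nat.card (T.CutTriangle T0) := by
    have c2 : Nat.card (T.cut T0 E) + 1 = Nat.card (T.CutVertex T0 E) := hT.cut.card_add_one
    have c3 := T.card_cutVertex (T0 := T0) (E := E)
    omega
  have c9 : Nat.card (T.CutTriangle T0) ≤ Nat.card ↥(T.cut T0 E)ᶜ := by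
    rw [← L.card_eq, ← Nat.card_fin L.n]
    refine Nat.card_le_card_of_injective (fun s => (⟨T.cutEdge T0 E
      ⟨L.flag s, L.triangle_flag_notMem s⟩, fun h => hLE s (mem_cut_iff.1 h)⟩ :
        ↥(T.cut T0 E)ᶜ)) ?_
    intro s r h
    exact L.edge_injective (edge_of_cutEdge_eq (congrArg Subtype.val h))
  obtain ⟨ends, hG, hends⟩ := T.edgeGraph_eq T0
  rw [hG]
  have : Nonempty (T.Vertex T0) := ⟨T.vertex _ (Classical.arbitrary T.Tet, 1)⟩
  refine Graph.isSpanningTree_of_connected (by omega) fun φ hφ => ?_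
  have hδ : ∀ x, Graph.coboundary ends φ (T.edge T0 x)
      = φ (T.vertex T0 x) + φ (T.vertex T0 (Flag.flip x)) :=
    fun x => Graph.coboundary_apply (hends x) φ
  have hzero := L.eq_zero_of_closed_boundary h0 hLE (dualConnected_of_isTree hT.triangles)
    (by omega) (Graph.coboundary ends φ) (by
      intro e he
      obtain ⟨x, rfl⟩ := Quot.exists_rep e
      exact (hδ x).trans (zmod_two_add_eq_zero.2 (hφ _ he _ _ (hends x)))) (by
      intro x _
      rw [hδ, hδ, hδ, ← vertex_rot, ← vertex_rot, ← vertex_rot, rot_rot_rot]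
      exact closed_of_add φ _ _ _)
  have hconst := eq_of_invariant h0 (fun x => φ (T.vertex T0 x))
    (fun x => by
      have := hzero (T.edge T0 x)
      rw [hδ, zmod_two_add_eq_zero] at this
      exact this.symm)
    (fun x => by rw [vertex_act x (by decide)])
    (fun x => by rw [Flag.turn, vertex_act x (by decide)])
    (fun x hx => by rw [vertex_glue hx])
  intro u v
  obtain ⟨x, rfl⟩ := Quot.exists_rep u
  obtain ⟨y, rfl⟩ := Quot.exists_rep v
  exact hconst x y

end Triangulation3

namespace Triangulation3

open TetGluing

/-! ### A locally constructible triangulation that is not tree-avoiding -/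

/-- The gluings of the folded tetrahedron: the faces opposite to the vertices 0 and 1 are folded
together along the edge 23, and the two other faces along the edge 01. -/
def foldPerm : Fin 4 → Equiv.Perm (Fin 4) :=
  ![Equiv.swap 0 1, Equiv.swap 0 1, Equiv.swap 2 3, Equiv.swap 2 3]

/-- A complete invariant of the oriented edges of the folded tetrahedron: the edges 01 and 23 are
not identified with any other edge, and all others are oriented from `{0, 1}` to `{2, 3}`
or conversely. -/
def foldInvariant (q : Equiv.Perm (Fin 4)) : Fin 4 × Fin 4 :=
  if (q 0 < 2 ↔ q 1 < 2) then (q 0, q 1) else if q 0 < 2 then (0, 2) else (2, 0)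

/-- The 3-sphere obtained by folding both pairs of faces of a single tetrahedron. -/
def foldedTet : Triangulation3.{u} where
  Tet := PUnit
  adj _ _ := PUnit.unit
  perm _ := foldPerm
  adj_adj _ _ := rfl
  perm_perm _ := by decide
  finite_tet := inferInstanceAs (Finite PUnit)
  nonempty_tet := ⟨PUnit.unit⟩
  mate_ne := by
    rintro ⟨_, i⟩ h
    have : foldPerm i i = i := congrArg Prod.snd h
    clear h
    revert i; decide
  sign_perm _ := by decide
  connected _ _ := .refl _
  edge_nondegenerate := by
    rintro ⟨k, q⟩ h
    have hinv : foldInvariant q = foldInvariant (q * Equiv.swap 0 1) := by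
      refine congrArg (Quot.lift (fun x => foldInvariant x.2) ?_) h
      rintro ⟨k, q⟩ _ (⟨τ, ⟨h0, h1⟩, rfl⟩ | ⟨-, rfl⟩)
      · show foldInvariant q = foldInvariant (q * τ)
        simp [foldInvariant, h0, h1]
      · show foldInvariant q = foldInvariant (foldPerm (q 3) * q)
        revert q; decide
    clear h
    revert q; decide

/-- A flag of the folded tetrahedron. -/
def foldFlag (q : Equiv.Perm (Fin 4)) : foldedTet.{u}.Flag := (PUnit.unit, q)

theorem act_foldFlag (q τ : Equiv.Perm (Fin 4)) :
    Flag.act (foldFlag.{u} q) τ = foldFlag (q * τ) := rfl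

instance : Subsingleton foldedTet.{u}.Tet := inferInstanceAs (Subsingleton PUnit)

theorem foldedTet_isSpanningTreeOfTets : foldedTet.{u}.IsSpanningTreeOfTets ∅ :=
  Graph.isSpanningTree_of_connected (by simp) fun _ _ _ _ => congrArg _ (Subsingleton.elim _ _)

theorem eq_empty_of_isSpanningTreeOfTets {T0 : Set foldedTet.{u}.Triangle}
    (h0 : foldedTet.IsSpanningTreeOfTets T0) : T0 = ∅ := by
  have h : Nat.card T0 + 1 = Nat.card foldedTet.{u}.Tet := h0.card_add_one
  have h1 : Nat.card foldedTet.{u}.Tet = 1 := Nat.card_of_subsingleton (PUnit.unit : PUnit)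
  have h2 : Nat.card T0 = 0 := by omega
  rw [Nat.card_coe_set_eq, Set.ncard_eq_zero] at h2
  exact h2

/-- Fold along the edge 23, then along the edge 01. -/
def foldConstruction : LocalConstruction (T := foldedTet.{u}) ∅ where
  n := 2
  flag := ![foldFlag (Equiv.swap 0 2 * Equiv.swap 1 3), foldFlag 1]
  triangle_injective := by
    have hne : foldedTet.{u}.triangle (foldFlag (Equiv.swap 0 2 * Equiv.swap 1 3)) ≠
        foldedTet.triangle (foldFlag 1) := by
      intro h
      rcases eq_or_mate_of_faceTriangle h with h | h
      · have : (Equiv.swap 0 2 * Equiv.swap 1 3 : Equiv.Perm (Fin 4)) 3 = 3 :=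
          congrArg Prod.snd h
        revert this; decide
      · have : (Equiv.swap 0 2 * Equiv.swap 1 3 : Equiv.Perm (Fin 4)) 3 = 2 :=
          congrArg Prod.snd h
        revert this; decide
    intro s r h
    fin_cases s <;> fin_cases r
    · rfl
    · exact absurd h hne
    · exact absurd h.symm hne
    · rfl
  range_triangle := by
    refine Set.eq_univ_of_forall (fun t => ?_) |>.trans Set.compl_empty.symm
    obtain ⟨⟨k, i⟩, rfl⟩ := Quot.exists_rep t
    fin_cases i
    · exact ⟨0, faceTriangle_mate (T := foldedTet.{u}.toTetGluing) (PUnit.unit, 0)⟩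
    · exact ⟨0, rfl⟩
    · exact ⟨1, faceTriangle_mate (T := foldedTet.{u}.toTetGluing) (PUnit.unit, 2)⟩
    · exact ⟨1, rfl⟩
  shared s := by
    have hg : Flag.glue ((![foldFlag (Equiv.swap 0 2 * Equiv.swap 1 3), foldFlag 1] :
        Fin 2 → foldedTet.{u}.Flag) s) = Flag.turn ((![foldFlag (Equiv.swap 0 2 * Equiv.swap 1 3),
          foldFlag 1] : Fin 2 → foldedTet.{u}.Flag) s) := by
      fin_cases s
      · exact congrArg foldFlag (by decide)
      · exact congrArg foldFlag (by decide)
    rw [hg, orEdge_turn]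

/-- The four edges between `{0, 1}` and `{2, 3}` form a cycle of the tetrahedron, and they are all
identified; so a saturated set of edges either contains this cycle or leaves `{0, 1}` and `{2, 3}`
disconnected. -/
theorem not_isTreeAvoiding (L : LocalConstruction (T := foldedTet.{u}) ∅) :
    ¬ L.IsTreeAvoiding := by
  rintro ⟨E0, hE0, hav⟩
  obtain ⟨E, rfl, -⟩ := hav.exists_eq_preimage
  obtain ⟨ends, hG, hends⟩ := foldedTet.{u}.edgeGraph_eq ∅
  rw [hG] at hE0
  -- the edges 02, 03, 12, 13
  let a : Equiv.Perm (Fin 4) := Equiv.swap 1 2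
  let b : Equiv.Perm (Fin 4) := Equiv.swap 2 3 * Equiv.swap 1 2
  let c : Equiv.Perm (Fin 4) := Equiv.swap 0 1 * Equiv.swap 1 2
  let d : Equiv.Perm (Fin 4) := Equiv.swap 2 3 * (Equiv.swap 0 1 * Equiv.swap 1 2)
  have hab : foldedTet.{u}.edge Set.univ (foldFlag b) = foldedTet.edge Set.univ (foldFlag a) :=
    edge_glue (x := foldFlag a) (Set.mem_univ _)
  have hcd : foldedTet.{u}.edge Set.univ (foldFlag d) = foldedTet.edge Set.univ (foldFlag c) :=
    edge_glue (x := foldFlag c) (Set.mem_univ _)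
  have hac : foldedTet.{u}.edge Set.univ (foldFlag c) = foldedTet.edge Set.univ (foldFlag a) := by
    rw [← edge_turn _ (foldFlag a), ← edge_glue (x := Flag.turn (foldFlag a)) (Set.mem_univ _),
      ← edge_turn _ (foldFlag c)]
    exact congrArg (fun q => foldedTet.{u}.edge Set.univ (foldFlag q)) (by decide)
  have hvertex : ∀ q q' : Equiv.Perm (Fin 4), q 0 = q' 0 →
      foldedTet.{u}.vertex ∅ (foldFlag q) = foldedTet.vertex ∅ (foldFlag q') := by
    intro q q' h
    rw [← vertex_act (foldFlag q) (τ := q⁻¹ * q') (by rw [Equiv.Perm.mul_apply, ← h]; simp),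
      act_foldFlag, mul_inv_cancel_left]
  -- if the cycle is contained, follow it from one end of the edge 02 to the other
  by_cases haE : foldedTet.{u}.edge Set.univ (foldFlag a) ∈ E
  · obtain ⟨φ, h1, h2⟩ := hE0.exists_coboundary (l := foldedTet.edge ∅ (foldFlag a)) haE
    have hne : ∀ q : Equiv.Perm (Fin 4), ¬ ((q 0 = 0 ∨ q 0 = 2) ∧ (q 1 = 0 ∨ q 1 = 2)) →
        foldedTet.{u}.edge ∅ (foldFlag q) ≠ foldedTet.edge ∅ (foldFlag a) := by
      intro q hq h
      refine hq ((Quot.iff_of_eq (fun x : foldedTet.{u}.Flag =>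
        (x.2 0 = 0 ∨ x.2 0 = 2) ∧ (x.2 1 = 0 ∨ x.2 1 = 2)) ?_ h).2 (by decide))
      rintro ⟨k, q⟩ _ (⟨τ, hτ, rfl⟩ | ⟨h, -⟩)
      · rcases hτ with ⟨h0, h1⟩ | ⟨h0, h1⟩
        · simp [Flag.act, h0, h1]
        · simp [Flag.act, h0, h1, and_comm]
      · exact absurd h (Set.notMem_empty _)
    have hzero : ∀ q : Equiv.Perm (Fin 4), ¬ ((q 0 = 0 ∨ q 0 = 2) ∧ (q 1 = 0 ∨ q 1 = 2)) →
        foldedTet.{u}.edge Set.univ (foldFlag q) ∈ E →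
        φ (foldedTet.vertex ∅ (foldFlag q)) =
          φ (foldedTet.vertex ∅ (foldFlag (q * Equiv.swap 0 1))) := by
      intro q hq hqE
      have := h2 _ hqE (hne q hq)
      rwa [Graph.coboundary_apply (hends _), zmod_two_add_eq_zero] at this
    have hb := hzero b (by decide) (by rwa [hab])
    have hc := hzero c (by decide) (by rwa [hac])
    have hd := hzero d (by decide) (by rwa [hcd, hac])
    rw [Graph.coboundary_apply (hends _)] at h1
    have e1 : φ (foldedTet.vertex ∅ (foldFlag a)) =
        φ (foldedTet.vertex ∅ (Flag.flip (foldFlag a))) := by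
      rw [hvertex a b (by decide), hb, hvertex _ (d * Equiv.swap 0 1) (by decide), ← hd,
        hvertex d c (by decide), hc]
      exact congrArg φ (hvertex _ _ (by decide))
    rw [e1, zmod_two_add_eq_zero.2 rfl] at h1
    exact zero_ne_one h1
  -- otherwise, no edge leads from `{0, 1}` to `{2, 3}`
  · let φ : foldedTet.{u}.Vertex ∅ → Prop := Quot.lift (fun x => x.2 0 < 2) (by
      rintro x _ (⟨τ, h, rfl⟩ | ⟨h, -⟩)
      · have h : τ 0 = 0 := h
        simp [Flag.act, h]
      · exact absurd h (Set.notMem_empty _))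
    have hφ : ∀ q, φ (foldedTet.vertex ∅ (foldFlag q)) = (q 0 < 2) := fun q => rfl
    have hq : ∀ q : Equiv.Perm (Fin 4), ¬ (q 0 < 2 ↔ q 1 < 2) →
        foldedTet.{u}.edge Set.univ (foldFlag q) = foldedTet.edge Set.univ (foldFlag a) := by
      intro q hq
      have hr : ∀ r : Equiv.Perm (Fin 4), (q 0 = r 0 ∧ q 1 = r 1) ∨ (q 0 = r 1 ∧ q 1 = r 0) →
          foldedTet.{u}.edge Set.univ (foldFlag q) = foldedTet.edge Set.univ (foldFlag r) := by
        intro r h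
        rw [← edge_act (foldFlag r) (τ := r⁻¹ * q), act_foldFlag, mul_inv_cancel_left]
        simpa [Equiv.Perm.inv_eq_iff_eq, Equiv.symm_apply_eq] using h
      have hcases : ∀ q : Equiv.Perm (Fin 4), ¬ (q 0 < 2 ↔ q 1 < 2) →
          ((q 0 = a 0 ∧ q 1 = a 1) ∨ (q 0 = a 1 ∧ q 1 = a 0)) ∨
          ((q 0 = b 0 ∧ q 1 = b 1) ∨ (q 0 = b 1 ∧ q 1 = b 0)) ∨
          ((q 0 = c 0 ∧ q 1 = c 1) ∨ (q 0 = c 1 ∧ q 1 = c 0)) ∨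
          ((q 0 = d 0 ∧ q 1 = d 1) ∨ (q 0 = d 1 ∧ q 1 = d 0)) := by decide
      rcases hcases q hq with h | h | h | h
      · exact hr a h
      · rw [hr b h, hab]
      · rw [hr c h, hac]
      · rw [hr d h, hcd, hac]
    have h := hE0.eq_of_forall φ (by
      intro e he u v huv
      obtain ⟨x, rfl⟩ := Quot.exists_rep e
      have huv : s(foldedTet.vertex ∅ x, foldedTet.vertex ∅ (Flag.flip x)) = s(u, v) :=
        (hends x).symm.trans huv
      have hx : (x.2 0 < 2) = (x.2 1 < 2) := by
        by_contra hne
        refine haE ?_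
        rw [← hq x.2 (fun h => hne (propext h))]
        exact he
      have hx' : φ (foldedTet.vertex ∅ x) = φ (foldedTet.vertex ∅ (Flag.flip x)) := by
        show (x.2 0 < 2) = ((x.2 * Equiv.swap 0 1 : Equiv.Perm (Fin 4)) 0 < 2)
        simpa using hx
      rcases Sym2.eq_iff.1 huv with ⟨rfl, rfl⟩ | ⟨rfl, rfl⟩
      · exact hx'
      · exact hx'.symm) (foldedTet.vertex ∅ (foldFlag 1))
        (foldedTet.vertex ∅ (foldFlag (Equiv.swap 0 2)))
    rw [hφ, hφ] at h
    exact absurd (h.mp (by decide)) (by decide)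

end Triangulation3

/-! ### The equivalence -/

theorem mainTheorem2 :
    (∀ (T : Triangulation3.{u}) (T0 : Set T.Triangle) (E : Set (T.Edge Set.univ)),
      T.IsSpanningTreeOfTets T0 → T.IsSpanningTreeOfEdges E →
        (T.IsTripleTree T0 E ↔
          ∃ L : Triangulation3.LocalConstruction T0, L.IsTreeAvoiding ∧ L.critical = E)) ∧
    Triangulation3.tripleTree.{u} = Triangulation3.treeAvoidingLocallyConstructible ∧
    Triangulation3.treeAvoidingLocallyConstructible.{u} ⊂ Triangulation3.locallyConstructible := by
  refine ⟨fun T T0 E h0 _ => ⟨fun hT => hT.exists_isTreeAvoiding, ?_⟩, ?_, ?_⟩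
  · rintro ⟨L, hL, rfl⟩
    exact hL.isTripleTree h0
  · ext T
    constructor
    · rintro ⟨T0, E, hT⟩
      obtain ⟨L, hL, -⟩ := hT.exists_isTreeAvoiding
      exact ⟨T0, hT.tets, L, hL⟩
    · rintro ⟨T0, h0, L, hL⟩
      exact ⟨T0, L.critical, hL.isTripleTree h0⟩
  · have hfold : Triangulation3.foldedTet.{u} ∈ Triangulation3.locallyConstructible :=
      ⟨∅, Triangulation3.foldedTet_isSpanningTreeOfTets, ⟨Triangulation3.foldConstruction⟩⟩
    refine (Set.ssubset_iff_of_subset ?_).2 ⟨Triangulation3.foldedTet, hfold, ?_⟩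
    · rintro T ⟨T0, h0, L, -⟩
      exact ⟨T0, h0, ⟨L⟩⟩
    rintro ⟨T0, h0, L, hL⟩
    obtain rfl := Triangulation3.eq_empty_of_isSpanningTreeOfTets h0
    exact Triangulation3.not_isTreeAvoiding L hL
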